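/- **Theorem (Inference on Treatment Effects).** All quantities below may depend on the sample size $n$ unless they are called constants, and the underlying probability space may change with $n$. Write $\mathbb{E}_n[f_i]=\frac1n\sum_{i=1}^n f_i$; $\|\beta\|_0$ is the number of nonzero components of $\beta$; $o_P(1)$ and $o(\cdot)$ refer to $n\to\infty$. *Model.* For fixed $z_1,\dots,z_n$ let $$y_i=d_i\alpha_0+g(z_i)+\zeta_i,\qquad d_i=m(z_i)+v_i,\qquad i=1,\dots,n,$$ where the pairs $(\zeta_i,v_i)$ are independent over $i$ and distributed as $N\big(0,\mathrm{diag}(\sigma_\zeta^2,\sigma_v^2)\big)$. Let $x_i=P(z_i)\in\mathbb{R}^p$ be a dictionary of transformations of $z_i$, with $p=p_n\to\infty$. *Condition ASTE.* (a) For constants, $\sigma_\zeta^2,\sigma_v^2$ are bounded above by $\bar\sigma$ and bounded away from zero, and $|\alpha_0|$ is bounded. (b) $\mathbb{E}_n[x_{ij}^2]=1$ for all $j$, and condition SE holds: there are $\ell_n\to\infty$ and constants $0<\kappa'<\kappa''<\infty$ such that, for all large $n$, $$\kappa'\le\min_{\delta\ne0,\ \|\delta\|_0\le \ell_n s}\frac{\delta'\mathbb{E}_n[x_ix_i']\delta}{\|\delta\|^2}\le\max_{\delta\ne0,\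 \|\delta\|_0\le \ell_n s}\frac{\delta'\mathbb{E}_n[x_ix_i']\delta}{\|\delta\|^2}\le\kappa''.$$ (c) There are $s=s_n\ge1$, a constant $K$ and vectors $\beta_{m0},\beta_{g0}$ with $\|\beta_{m0}\|_0\le s$, $\|\beta_{g0}\|_0\le s$ and $$\{\mathbb{E}_n[(m(z_i)-x_i'\beta_{m0})^2]\}^{1/2}\le K\bar\sigma\sqrt{s/n},\qquad \{\mathbb{E}_n[(g(z_i)-x_i'\beta_{g0})^2]\}^{1/2}\le K\bar\sigma\sqrt{s/n}.$$ (d) $s^2\log^2(p\vee n)=o(n)$. *Feasible Lasso.* For a regression of $w_i$ on $x_i$ whose Gaussian disturbance has standard deviation $\sigma$, fix a constant $c>1$ and $\gamma\in(0,1)$ with $\gamma=o(1)$ and $\log(1/\gamma)=O(\log(p\vee n))$. A feasible Lasso estimator is one of the following. (1) A minimizer of $\mathbb{E}_n[(w_i-x_i'\beta)^2]+\frac{\lambda}{n}\|\beta\|_1$, where $\lambda$ is $2c\hat\sigma\sqrt n\,\Phi^{-1}(1-\gamma/(2p))$ or $2c\hat\sigma\,\Lambda(1-\gamma|X)$, $\hat\sigma=\sigma+o_P(1)$,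 and $\Lambda(1-\gamma|X)$ is the $(1-\gamma)$-quantile of $n\max_j|\mathbb{E}_n[x_{ij}g_i]|$ for i.i.d. $g_i\sim N(0,1)$. (2) A minimizer of $\sqrt{\mathbb{E}_n[(w_i-x_i'\beta)^2]}+\frac{\lambda}{n}\|\beta\|_1$, where $\lambda$ is $c\sqrt n\,\Phi^{-1}(1-\gamma/(2p))$ or $c\,\widetilde\Lambda(1-\gamma|X)$, and $\widetilde\Lambda(1-\gamma|X)$ is the $(1-\gamma)$-quantile of $n\max_j|\mathbb{E}_n[x_{ij}g_i]|/\sqrt{\mathbb{E}_n[g_i^2]}$. *Estimator.* Let $\hat I_1$ and $\hat I_2$ be the supports of feasible Lasso estimators in the regression of $d_i$ on $x_i$ (where $\sigma^2=\sigma_v^2$) and of $y_i$ on $x_i$ (where $\sigma^2=\alpha_0^2\sigma_v^2+\sigma_\zeta^2$). Let $\hat I_3$ be any further, possibly data-dependent, set of controls with $|\hat I_3|\le C\,(1\vee|\hat I_1|\vee|\hat I_2|)$ almost surely for a constant $C$. Put $\hat I=\hat I_1\cup\hat I_2\cup\hat I_3$, $\hat s=|\hat I|$, and let the double-Post-Lasso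 estimator be $$(\check\alpha,\check\beta)\in\arg\min_{\alpha\in\mathbb{R},\,\beta\in\mathbb{R}^p}\big\{\mathbb{E}_n[(y_i-d_i\alpha-x_i'\beta)^2]:\ \beta_j=0\ \ \forall j\notin\hat I\big\}.$$ *Conclusion.* There are random variables $N_n$, distributed exactly as $N(0,1)$ for every $n\ge1$, such that $$\big(\sigma_\zeta^2\,[\mathbb{E}_nv_i^2]^{-1}\big)^{-1/2}\sqrt n\,(\check\alpha-\alpha_0)=N_n+o_P(1).$$ The same holds, with the same $N_n$, if $\sigma_\zeta^2$ is replaced by $\hat\sigma_\zeta^2=\mathbb{E}_n[(y_i-d_i\check\alpha-x_i'\check\beta)^2]\,\frac{n}{n-\hat s-1}$, or $\mathbb{E}_n[v_i^2]$ by $\mathbb{E}_n[\hat v_i^2]=\min_{\beta}\{\mathbb{E}_n[(d_i-x_i'\beta)^2]:\beta_j=0\ \forall j\notin\hat I\}$, or both. -/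

import Mathlib

open MeasureTheory ProbabilityTheory Filter Topology Asymptotics
open scoped NNReal ENNReal

noncomputable section

namespace DoublePostLasso

/-- Empirical average `E_n[f] = (1/n) ∑ i, f i`. -/
def En {n : ℕ} (f : Fin n → ℝ) : ℝ := (∑ i, f i) / n

/-- The indices of the nonzero components; its cardinality is the `ℓ₀`-norm. -/
def supp {p : ℕ} (β : Fin p → ℝ) : Finset (Fin p) := Finset.univ.filter fun j => β j ≠ 0

/-- The `ℓ₁`-norm. -/
def l1norm {p : ℕ} (β : Fin p → ℝ) : ℝ := ∑ j, |β j|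

/-- `X n = o_P(1)` for an array of random variables, the `n`-th one on its own probability space.
Outer measure is used, so that measurability of `X n` is not presupposed. -/
def IsLittleOP {Ω : ℕ → Type*} [∀ n, MeasurableSpace (Ω n)] (μ : ∀ n, Measure (Ω n))
    (X : ∀ n, Ω n → ℝ) : Prop :=
  ∀ ε : ℝ, 0 < ε → Tendsto (fun n => μ n {ω | ε < |X n ω|}) atTop (𝓝 0)

/-- The `q`-quantile of a probability measure on the line. -/
def quantile (ν : Measure ℝ) (q : ℝ) : ℝ := sInf {t | q ≤ cdf ν t}

/-! ### Sparse eigenvalues -/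

/-- The empirical Gram matrix `E_n[x_i x_i']`. -/
def gram {n p : ℕ} (x : Fin n → Fin p → ℝ) : Matrix (Fin p) (Fin p) ℝ :=
  fun j k => En fun i => x i j * x i k

/-- The values of `δ'Mδ / ‖δ‖²` over nonzero `δ` with at most `m` nonzero components. -/
def sparseRayleigh {p : ℕ} (M : Matrix (Fin p) (Fin p) ℝ) (m : ℝ) : Set ℝ :=
  {q | ∃ δ : Fin p → ℝ, δ ≠ 0 ∧ ((supp δ).card : ℝ) ≤ m ∧
    q = (δ ⬝ᵥ M.mulVec δ) / ∑ j, δ j ^ 2}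

/-- Minimal `m`-sparse eigenvalue. -/
def semin {p : ℕ} (M : Matrix (Fin p) (Fin p) ℝ) (m : ℝ) : ℝ := sInf (sparseRayleigh M m)

/-- Maximal `m`-sparse eigenvalue. -/
def semax {p : ℕ} (M : Matrix (Fin p) (Fin p) ℝ) (m : ℝ) : ℝ := sSup (sparseRayleigh M m)

/-- Condition SE: for some `ℓ_n → ∞` the `ℓ_n s`-sparse eigenvalues of the empirical Gram matrix
lie between two positive constants (for all large `n`). -/
def ConditionSE {p : ℕ → ℕ} (s : ℕ → ℕ) (x : ∀ n, Fin n → Fin (p n) → ℝ) : Prop :=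
  ∃ ℓ : ℕ → ℝ, Tendsto ℓ atTop atTop ∧ ∃ κ' κ'' : ℝ, 0 < κ' ∧ κ' < κ'' ∧
    ∀ᶠ n in atTop, κ' ≤ semin (gram (x n)) (ℓ n * s n) ∧
      semin (gram (x n)) (ℓ n * s n) ≤ semax (gram (x n)) (ℓ n * s n) ∧
      semax (gram (x n)) (ℓ n * s n) ≤ κ''

/-! ### Feasible Lasso -/

/-- The least squares criterion `E_n[(y_i - x_i'β)²]`. -/
def Qhat {n p : ℕ} (x : Fin n → Fin p → ℝ) (y : Fin n → ℝ) (β : Fin p → ℝ) : ℝ :=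
  En fun i => (y i - x i ⬝ᵥ β) ^ 2

/-- `β` is a Lasso solution for the penalty level `lam`. -/
def IsLasso {n p : ℕ} (x : Fin n → Fin p → ℝ) (y : Fin n → ℝ) (lam : ℝ) (β : Fin p → ℝ) : Prop :=
  ∀ b : Fin p → ℝ, Qhat x y β + lam / n * l1norm β ≤ Qhat x y b + lam / n * l1norm b

/-- `β` is a Square-root Lasso solution for the penalty level `lam`. -/
def IsSqrtLasso {n p : ℕ} (x : Fin n → Fin p → ℝ) (y : Fin n → ℝ) (lam : ℝ) (β : Fin p → ℝ) :
    Prop :=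
  ∀ b : Fin p → ℝ, √(Qhat x y β) + lam / n * l1norm β ≤ √(Qhat x y b) + lam / n * l1norm b

/-- The law of `n` independent standard normal variables. -/
def stdGaussian (n : ℕ) : Measure (Fin n → ℝ) := Measure.pi fun _ => gaussianReal 0 1

/-- `n ‖E_n[x_i g_i]‖_∞` (the norm of `Fin p → ℝ` is the maximum norm). -/
def maxScore {n p : ℕ} (x : Fin n → Fin p → ℝ) (g : Fin n → ℝ) : ℝ :=
  n * ‖fun j => En fun i => x i j * g i‖

/-- `√n Φ⁻¹(1 - γ/(2p))`, the design-independent score bound. -/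
def indepBound (n p : ℕ) (γ : ℝ) : ℝ := √n * quantile (gaussianReal 0 1) (1 - γ / (2 * p))

/-- `Λ(1-γ|X)`, the `(1-γ)`-quantile of `n ‖E_n[x_i g_i]‖_∞` for i.i.d. standard normal `g_i`. -/
def depBound {n p : ℕ} (x : Fin n → Fin p → ℝ) (γ : ℝ) : ℝ :=
  quantile ((stdGaussian n).map (maxScore x)) (1 - γ)

/-- The `(1-γ)`-quantile of `n ‖E_n[x_i g_i]‖_∞ / √(E_n[g_i²])` for i.i.d. standard normal
`g_i`. -/
def depBoundSqrt {n p : ℕ} (x : Fin n → Fin p → ℝ) (γ : ℝ) : ℝ :=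
  quantile ((stdGaussian n).map fun g => maxScore x g / √(En fun i => g i ^ 2)) (1 - γ)

/-- `βhat` is a feasible Lasso estimator in the regression of `y` on `x` with noise level `σ`:
with a constant `c > 1` and confidence levels `1 - γ_n` such that `γ = o(1)` and
`log(1/γ) ≲ log(p ∨ n)`, it is either Lasso, with an estimated noise level
`σhat = σ + o_P(1)` and a design-independent or design-dependent penalty level, or Square-root
Lasso, with a design-dependent or design-independent penalty level. -/
def IsFeasibleLasso {Ω : ℕ → Type*} [∀ n, MeasurableSpace (Ω n)] (μ : ∀ n, Measure (Ω n))
    {p : ℕ → ℕ} (x : ∀ n, Fin n → Fin (p n) → ℝ) (y : ∀ n, Fin n → Ω n → ℝ) (σ : ℕ → ℝ)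
    (βhat : ∀ n, Ω n → Fin (p n) → ℝ) : Prop :=
  ∃ c : ℝ, 1 < c ∧ ∃ γ : ℕ → ℝ, (∀ n, 0 < γ n ∧ γ n < 1) ∧ Tendsto γ atTop (𝓝 0) ∧
    ((fun n => Real.log (1 / γ n)) =O[atTop] fun n => Real.log (max (p n : ℝ) n)) ∧
    ((∃ σhat : ∀ n, Ω n → ℝ, IsLittleOP μ (fun n ω => σhat n ω - σ n) ∧
        ((∀ n, ∀ᵐ ω ∂μ n, IsLasso (x n) (fun i => y n i ω)
            (2 * c * σhat n ω * indepBound n (p n) (γ n)) (βhat n ω)) ∨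
         (∀ n, ∀ᵐ ω ∂μ n, IsLasso (x n) (fun i => y n i ω)
            (2 * c * σhat n ω * depBound (x n) (γ n)) (βhat n ω)))) ∨
      (∀ n, ∀ᵐ ω ∂μ n, IsSqrtLasso (x n) (fun i => y n i ω)
          (c * depBoundSqrt (x n) (γ n)) (βhat n ω)) ∨
      (∀ n, ∀ᵐ ω ∂μ n, IsSqrtLasso (x n) (fun i => y n i ω)
          (c * indepBound n (p n) (γ n)) (βhat n ω)))

/-! ### The partially linear model and the double-Post-Lasso estimator -/

/-- The Gaussian partially linear model with `n` observations and fixed `z_i`: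
`y_i = d_i α₀ + g(z_i) + ζ_i`, `d_i = m(z_i) + v_i`, where the pairs `(ζ_i, v_i)` are independent
over `i` and normal with mean zero and covariance matrix `diag(σζ², σv²)`. -/
structure IsGaussianPLM {Ω : Type*} [MeasurableSpace Ω] (μ : Measure Ω) {𝒵 : Type*} {n : ℕ}
    (z : Fin n → 𝒵) (m g : 𝒵 → ℝ) (α₀ : ℝ) (σζ σv : ℝ≥0) (ζ v y d : Fin n → Ω → ℝ) : Prop where
  outcome : ∀ i ω, y i ω = d i ω * α₀ + g (z i) + ζ i ω
  treatment : ∀ i ω, d i ω = m (z i) + v i ω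
  law : ∀ i, HasLaw (fun ω => (ζ i ω, v i ω))
    ((gaussianReal 0 (σζ ^ 2)).prod (gaussianReal 0 (σv ^ 2))) μ
  indep : iIndepFun (fun i ω => (ζ i ω, v i ω)) μ

/-- `f` is approximated at the design points by a combination of at most `s` regressors with root
mean square error at most `b`. -/
def ApproxSparse {n p : ℕ} (x : Fin n → Fin p → ℝ) (f : Fin n → ℝ) (s : ℕ) (b : ℝ) : Prop :=
  ∃ β : Fin p → ℝ, (supp β).card ≤ s ∧ √(En fun i => (f i - x i ⬝ᵥ β) ^ 2) ≤ b

/-- Condition ASTE, for the controls `x_i = P(z_i)` and additionally selected controls `I₃`, where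
`I₁` and `I₂` are the controls selected in the two Lasso regressions. -/
structure ConditionASTE {Ω : ℕ → Type*} [∀ n, MeasurableSpace (Ω n)] (μ : ∀ n, Measure (Ω n))
    {𝒵 : ℕ → Type*} {p : ℕ → ℕ} (s : ℕ → ℕ) (z : ∀ n, Fin n → 𝒵 n)
    (P : ∀ n, 𝒵 n → Fin (p n) → ℝ) (m g : ∀ n, 𝒵 n → ℝ) (α₀ : ℕ → ℝ) (σζ σv : ℕ → ℝ≥0)
    (ζ v y d : ∀ n, Fin n → Ω n → ℝ) (I₁ I₂ I₃ : ∀ n, Ω n → Finset (Fin (p n))) : Prop where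
  model : ∀ n, IsGaussianPLM (μ n) (z n) (m n) (g n) (α₀ n) (σζ n) (σv n) (ζ n) (v n) (y n) (d n)
  alpha_bounded : ∃ A : ℝ, ∀ n, |α₀ n| ≤ A
  normalized : ∀ n, 1 ≤ n → ∀ j, (En fun i => P n (z n i) j ^ 2) = 1
  sparse_eigenvalues : ConditionSE s fun n i => P n (z n i)
  one_le_s : ∀ n, 1 ≤ s n
  variances_and_approximation : ∃ σlow σbar K : ℝ, 0 < σlow ∧
    (∀ n, σlow ≤ (σv n : ℝ) ^ 2 ∧ (σv n : ℝ) ^ 2 ≤ σbar) ∧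
    (∀ n, σlow ≤ (σζ n : ℝ) ^ 2 ∧ (σζ n : ℝ) ^ 2 ≤ σbar) ∧
    (∀ n, ApproxSparse (fun i => P n (z n i)) (fun i => m n (z n i)) (s n)
      (K * σbar * √((s n : ℝ) / n))) ∧
    (∀ n, ApproxSparse (fun i => P n (z n i)) (fun i => g n (z n i)) (s n)
      (K * σbar * √((s n : ℝ) / n)))
  growth : (fun n => (s n : ℝ) ^ 2 * Real.log (max (p n : ℝ) n) ^ 2) =o[atTop] fun n => (n : ℝ)
  extra_controls : ∃ C : ℝ, ∀ n, ∀ᵐ ω ∂μ n,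
    ((I₃ n ω).card : ℝ) ≤ C * max 1 (max ((I₁ n ω).card : ℝ) (I₂ n ω).card)

/-- `(α, β)` is a least squares solution in the regression of `y` on `d` and the controls `x_j`,
`j ∈ I`. -/
def IsPostSelectionOLS {n p : ℕ} (x : Fin n → Fin p → ℝ) (y d : Fin n → ℝ) (I : Finset (Fin p))
    (α : ℝ) (β : Fin p → ℝ) : Prop :=
  (∀ j, j ∉ I → β j = 0) ∧
    ∀ (a : ℝ) (b : Fin p → ℝ), (∀ j, j ∉ I → b j = 0) →
      (En fun i => (y i - d i * α - x i ⬝ᵥ β) ^ 2) ≤ En fun i => (y i - d i * a - x i ⬝ᵥ b) ^ 2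

/-- `σ̂_ζ² = E_n[(y_i - d_i α - x_i'β)²] · n / (n - ŝ - 1)` with `ŝ = |I|`. -/
def sigmaHatSq {n p : ℕ} (x : Fin n → Fin p → ℝ) (y d : Fin n → ℝ) (I : Finset (Fin p))
    (α : ℝ) (β : Fin p → ℝ) : ℝ :=
  (En fun i => (y i - d i * α - x i ⬝ᵥ β) ^ 2) * ((n : ℝ) / ((n : ℝ) - I.card - 1))

/-- `E_n[v̂_i²]`, the minimum of `E_n[(d_i - x_i'β)²]` over `β` supported in `I`. -/
def vHatSq {n p : ℕ} (x : Fin n → Fin p → ℝ) (d : Fin n → ℝ) (I : Finset (Fin p)) : ℝ :=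
  sInf (Qhat x d '' {β | ∀ j, j ∉ I → β j = 0})

/-- `(S V⁻¹)^{-1/2} √n (α - α₀)`. -/
def studentized (n : ℕ) (S V α α₀ : ℝ) : ℝ :=
  (S * V⁻¹) ^ (-(1 / 2) : ℝ) * (√n * (α - α₀))

end DoublePostLasso

end

open DoublePostLasso

/-!
# Inference on a treatment effect after double selection

Why the estimator is asymptotically normal although the controls are selected from the data.
Embed the observations in a Euclidean space whose inner product is `E_n[f g]` (`emb`), so that the
design becomes a linear map `X`. Let `ν` be the residual of the treatment `d = m + v` after
projection on the selected controls. The normal equations of the final regression give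
`‖ν‖² (α̌ - α₀) = ⟨ν, g + ζ⟩`. Here `⟨ν, ζ⟩` is `⟨v, ζ⟩` plus the inner product of `ζ` with the
error of estimating `m`, and `⟨ν, g⟩ = ⟨ν, g - X b⟩` for every `b` supported on the selected
controls. Since the selected set contains the supports of an estimator of `m` and of an estimator
of `α₀ m + g`, such a `b` approximates `g` well. So all remainders are products of two errors of
the order `√(s log (p ∨ n) / n)`, or inner products of fixed approximation errors with noise, and
`s² log² (p ∨ n) = o(n)` makes them `o(1 / √n)` (`SelectionBounds.abs_alpha_sub_le`). The leading
term `√n E_n[v ζ]`, divided by `σζ √(E_n[v²])`, is exactly standard normal, because it is so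
conditionally on `v` (`hasLaw_selfNormalized`); this is the variable `N_n`.

The rates come from the theory of Lasso under sparse eigenvalue conditions. A restricted eigenvalue
inequality (`SparseLower.le_norm_add`) yields the prediction rate (`DesignBounds.lasso_rate`), and
the optimality conditions bound the number of selected controls by a multiple of `s`
(`LassoMin.card_supp_le`). The penalty levels dominate the score of the noise and have the order
`√(n log (p ∨ n))` (`IsScoreBound`). Square-root Lasso is Lasso with the noise level estimated by
its own residuals, which are consistent (`SparseRegression.tendsto_sqrtLasso_residual`). The data
dependence of the selected set is harmless because the bounds hold uniformly over all sparse
models.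

Convergence in probability along a sequence of probability spaces `Ω n` is expressed as ordinary
convergence along a filter `whp` on `Σ n, Ω n`, which turns statements about `o_P(1)` into limit
calculus.
-/

namespace DoublePostLasso

section

/-! ### Sparse eigenvalues and scores -/

variable {H : Type*} [NormedAddCommGroup H] [InnerProductSpace ℝ H] {p : ℕ}

/-- Greedy selection: among at most `m` elements of `A` one can place the largest values of `f`,
so that every value left over is at most the `m`-th part of the sum of the selected ones. -/
theorem exists_top_values {ι : Type*} [DecidableEq ι] (A : Finset ι) (f : ι → ℝ) (m : ℕ) :
    ∃ S ⊆ A, S.card ≤ m ∧ ∀ j ∈ A \ S, m * f j ≤ ∑ i ∈ S, f i := by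
  induction m with
  | zero => exact ⟨∅, by simp, by simp, by simp⟩
  | succ m ih =>
    obtain ⟨S, hSA, hcard, hS⟩ := ih
    rcases (A \ S).eq_empty_or_nonempty with h | h
    · exact ⟨S, hSA, by omega, by simp [h]⟩
    · obtain ⟨i, hi, hmax⟩ := Finset.exists_max_image (A \ S) f h
      have hi' := Finset.mem_sdiff.1 hi
      refine ⟨insert i S, Finset.insert_subset hi'.1 hSA,
        (Finset.card_insert_le _ _).trans (by omega), fun j hj => ?_⟩
      have hj' : j ∈ A \ S := by
        simp only [Finset.mem_sdiff, Finset.mem_insert, not_or] at hj ⊢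
        exact ⟨hj.1, hj.2.2⟩
      rw [Finset.sum_insert hi'.2]
      push_cast
      linarith [hS j hj', hmax j hj']

/-- The restriction of a coefficient vector to a set of indices. -/
def restr (T : Finset (Fin p)) (δ : Fin p → ℝ) : Fin p → ℝ := fun j => if j ∈ T then δ j else 0

theorem restr_add_compl (T : Finset (Fin p)) (δ : Fin p → ℝ) : restr T δ + restr Tᶜ δ = δ := by
  ext j; by_cases h : j ∈ T <;> simp [restr, h]

theorem supp_restr_subset (T : Finset (Fin p)) (δ : Fin p → ℝ) : supp (restr T δ) ⊆ T := by
  intro j hj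
  by_contra h
  simp [supp, restr, h] at hj

theorem sum_sq_restr (T : Finset (Fin p)) (δ : Fin p → ℝ) :
    ∑ j, restr T δ j ^ 2 = ∑ j ∈ T, δ j ^ 2 := by
  simp [restr, ite_pow, Finset.sum_ite_mem]

theorem l1norm_restr (T : Finset (Fin p)) (δ : Fin p → ℝ) :
    l1norm (restr T δ) = ∑ j ∈ T, |δ j| := by
  simp [l1norm, restr, apply_ite abs, Finset.sum_ite_mem]

theorem l1norm_eq_add_compl (T : Finset (Fin p)) (δ : Fin p → ℝ) :
    l1norm δ = ∑ j ∈ T, |δ j| + ∑ j ∈ Tᶜ, |δ j| :=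
  (Finset.sum_add_sum_compl T _).symm

theorem l1norm_nonneg (δ : Fin p → ℝ) : 0 ≤ l1norm δ := Finset.sum_nonneg fun _ _ => abs_nonneg _

theorem sum_abs_le_sqrt_card_mul (T : Finset (Fin p)) (δ : Fin p → ℝ) :
    ∑ j ∈ T, |δ j| ≤ √(T.card : ℝ) * √(∑ j ∈ T, δ j ^ 2) := by
  rw [← Real.sqrt_mul (by positivity)]
  apply Real.le_sqrt_of_sq_le
  have := sq_sum_le_card_mul_sum_sq (s := T) (f := fun j => |δ j|)
  simpa using this

theorem supp_add_card_le (β γ : Fin p → ℝ) :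
    (supp (β + γ)).card ≤ (supp β).card + (supp γ).card := by
  refine (Finset.card_le_card ?_).trans (Finset.card_union_le _ _)
  intro j hj
  by_contra h
  simp only [supp, Finset.mem_union, Finset.mem_filter, Finset.mem_univ, true_and, not_or,
    not_not, Pi.add_apply] at h hj
  exact hj (by simp [h.1, h.2])

theorem supp_smul_card_le (c : ℝ) (β : Fin p → ℝ) : (supp (c • β)).card ≤ (supp β).card := by
  refine Finset.card_le_card fun j hj => ?_
  simp only [supp, Finset.mem_filter, Finset.mem_univ, true_and, Pi.smul_apply, smul_eq_mul]
    at hj ⊢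
  exact fun h => hj (by simp [h])

theorem supp_sub_card_le (β γ : Fin p → ℝ) :
    (supp (β - γ)).card ≤ (supp β).card + (supp γ).card := by
  have h1 := supp_add_card_le β ((-1 : ℝ) • γ)
  have h2 := supp_smul_card_le (-1) γ
  have : β - γ = β + (-1 : ℝ) • γ := by simp [sub_eq_add_neg]
  rw [this]; omega

theorem sqrt_mul_div_self (m x : ℝ) : √m * (x / m) = x / √m := by
  rw [mul_div_assoc', mul_comm, mul_div_assoc, Real.sqrt_div_self', mul_one_div]

/-- The design `X` maps `m`-sparse vectors to vectors at most `M` times as long. -/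
def SparseUpper (X : (Fin p → ℝ) →ₗ[ℝ] H) (m : ℕ) (M : ℝ) : Prop :=
  ∀ δ : Fin p → ℝ, (supp δ).card ≤ m → ‖X δ‖ ≤ M * √(∑ j, δ j ^ 2)

/-- The design `X` maps `m`-sparse vectors to vectors at least `a` times as long. -/
def SparseLower (X : (Fin p → ℝ) →ₗ[ℝ] H) (m : ℕ) (a : ℝ) : Prop :=
  ∀ δ : Fin p → ℝ, (supp δ).card ≤ m → a * √(∑ j, δ j ^ 2) ≤ ‖X δ‖

variable {X : (Fin p → ℝ) →ₗ[ℝ] H}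

/-- A vector that need not be sparse is split into blocks of its `m` largest remaining components;
this controls the image by the sup norm and the `ℓ₁`-norm. -/
theorem SparseUpper.norm_le {m : ℕ} {M : ℝ} (hX : SparseUpper X m M) (hm : 1 ≤ m) (hM : 0 ≤ M)
    (u : Fin p → ℝ) (B : ℝ) (hB : ∀ j, |u j| ≤ B) (hB0 : 0 ≤ B) :
    ‖X u‖ ≤ M * (√m * B + l1norm u / √m) := by
  induction hk : (supp u).card using Nat.strong_induction_on generalizing u B with
  | _ k ih =>
  have hm0 : (0 : ℝ) < m := by exact_mod_cast hm
  have hsm : 0 < √(m : ℝ) := Real.sqrt_pos.2 hm0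
  obtain ⟨S, hSA, hScard, hS⟩ := exists_top_values (supp u) (fun j => |u j|) m
  rcases (supp u).eq_empty_or_nonempty with h0 | h0
  · have : u = 0 := by
      ext j
      by_contra h
      have : j ∈ supp u := by simpa [supp] using h
      simp [h0] at this
    subst this
    simp only [map_zero, norm_zero]
    have := l1norm_nonneg (0 : Fin p → ℝ)
    positivity
  have hSne : S.Nonempty := by
    by_contra hne
    rw [Finset.not_nonempty_iff_eq_empty] at hne
    obtain ⟨j, hj⟩ := h0
    have h1 := hS j (by simpa [hne] using hj)
    simp only [hne, Finset.sum_empty] at h1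
    have h2 : 0 < |u j| := abs_pos.2 (by simpa [supp] using hj)
    nlinarith
  -- the block of the largest components
  have hfirst : ‖X (restr S u)‖ ≤ M * (√m * B) := by
    refine (hX _ ((Finset.card_le_card (supp_restr_subset S u)).trans hScard)).trans ?_
    gcongr
    rw [sum_sq_restr]
    apply Real.sqrt_le_iff.2 ⟨by positivity, ?_⟩
    calc ∑ j ∈ S, u j ^ 2 ≤ ∑ j ∈ S, B ^ 2 := by
          refine Finset.sum_le_sum fun j _ => ?_
          rw [← sq_abs (u j)]
          exact pow_le_pow_left₀ (abs_nonneg _) (hB j) 2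
      _ = S.card * B ^ 2 := by simp
      _ ≤ m * B ^ 2 := by gcongr
      _ = (√m * B) ^ 2 := by rw [mul_pow, Real.sq_sqrt hm0.le]
  -- the remaining components
  have hsub : supp (restr Sᶜ u) ⊆ supp u \ S := by
    intro j hj
    simp only [supp, restr, Finset.mem_filter, Finset.mem_univ, true_and, Finset.mem_compl,
      ite_not, Finset.mem_sdiff] at hj ⊢
    by_cases h : j ∈ S <;> simp [h] at hj ⊢
    exact hj
  have hlt : (supp (restr Sᶜ u)).card < k := by
    rw [← hk]
    refine (Finset.card_le_card hsub).trans_lt (Finset.card_lt_card ?_)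
    refine Finset.sdiff_ssubset hSA hSne
  have hrest := ih _ hlt (restr Sᶜ u) ((∑ i ∈ S, |u i|) / m) (fun j => ?_)
    (by positivity) rfl
  · rw [l1norm_restr] at hrest
    have htot := l1norm_eq_add_compl S u
    calc ‖X u‖ = ‖X (restr S u) + X (restr Sᶜ u)‖ := by rw [← map_add, restr_add_compl]
      _ ≤ ‖X (restr S u)‖ + ‖X (restr Sᶜ u)‖ := norm_add_le _ _
      _ ≤ M * (√m * B) + M * (√m * ((∑ i ∈ S, |u i|) / m) + (∑ j ∈ Sᶜ, |u j|) / √m) := by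
          gcongr
      _ = M * (√m * B + l1norm u / √m) := by
          rw [htot]
          rw [sqrt_mul_div_self]; ring
  · by_cases h : j ∈ S
    · have : (0 : ℝ) ≤ (∑ i ∈ S, |u i|) / m := by positivity
      simpa [restr, h] using this
    · by_cases h' : u j = 0
      · have : (0 : ℝ) ≤ (∑ i ∈ S, |u i|) / m := by positivity
        simpa [restr, h, h'] using this
      · have := hS j (by simp [supp, h, h'])
        rw [le_div_iff₀ hm0]
        simp only [restr, Finset.mem_compl, h, not_false_eq_true, if_true]
        linarith

/-- Restricted eigenvalue bound: the sparse lower bound survives, up to the `ℓ₁`-mass outside a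
small set `T`, for vectors that are not sparse. -/
theorem SparseLower.le_norm_add {s m : ℕ} {a M : ℝ} (hl : SparseLower X (s + m) a)
    (hu : SparseUpper X m M) (hm : 1 ≤ m) (ha : 0 ≤ a) (hM : 0 ≤ M) (T : Finset (Fin p))
    (hT : T.card ≤ s) (δ : Fin p → ℝ) :
    a * √(∑ j ∈ T, δ j ^ 2) ≤ ‖X δ‖ + 2 * M / √m * ∑ j ∈ Tᶜ, |δ j| := by
  have hm0 : (0 : ℝ) < m := by exact_mod_cast hm
  have hsm : 0 < √(m : ℝ) := Real.sqrt_pos.2 hm0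
  obtain ⟨S, hSA, hScard, hS⟩ := exists_top_values Tᶜ (fun j => |δ j|) m
  set U := T ∪ S
  have hUcard : U.card ≤ s + m := (Finset.card_union_le _ _).trans (by omega)
  have hUc : Uᶜ ⊆ Tᶜ := Finset.compl_subset_compl.2 Finset.subset_union_left
  have h1 : a * √(∑ j ∈ T, δ j ^ 2) ≤ ‖X (restr U δ)‖ := by
    refine le_trans ?_ (hl _ ((Finset.card_le_card (supp_restr_subset U δ)).trans hUcard))
    rw [sum_sq_restr]
    gcongr
    exact Finset.subset_union_left
  have h2 : ‖X (restr Uᶜ δ)‖ ≤ M * (√m * ((∑ j ∈ Tᶜ, |δ j|) / m) + (∑ j ∈ Uᶜ, |δ j|) / √m) := by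
    rw [← l1norm_restr Uᶜ]
    refine hu.norm_le hm hM _ _ (fun j => ?_) (by positivity)
    by_cases h : j ∈ U
    · have : (0 : ℝ) ≤ (∑ j ∈ Tᶜ, |δ j|) / m := by positivity
      simpa [restr, h] using this
    · have hj : j ∈ Tᶜ \ S := by
        simp only [U, Finset.mem_union, not_or] at h
        simp [h.1, h.2]
      rw [le_div_iff₀ hm0]
      simp only [restr, Finset.mem_compl, h, not_false_eq_true, if_true]
      calc |δ j| * m = m * |δ j| := by ring
        _ ≤ ∑ i ∈ S, |δ i| := hS j hj
        _ ≤ ∑ i ∈ Tᶜ, |δ i| := Finset.sum_le_sum_of_subset_of_nonneg hSA (by simp)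
  have h3 : ∑ j ∈ Uᶜ, |δ j| ≤ ∑ j ∈ Tᶜ, |δ j| :=
    Finset.sum_le_sum_of_subset_of_nonneg hUc (by simp)
  have h4 : ‖X (restr U δ)‖ ≤ ‖X δ‖ + ‖X (restr Uᶜ δ)‖ := by
    have : X (restr U δ) = X δ - X (restr Uᶜ δ) := by
      rw [← map_sub]; congr 1; rw [eq_sub_iff_add_eq, restr_add_compl]
    rw [this]; exact norm_sub_le _ _
  have h6 : M * ((∑ j ∈ Uᶜ, |δ j|) / √m) ≤ M * ((∑ j ∈ Tᶜ, |δ j|) / √m) := by gcongr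
  calc a * √(∑ j ∈ T, δ j ^ 2) ≤ ‖X δ‖ + ‖X (restr Uᶜ δ)‖ := h1.trans h4
    _ ≤ ‖X δ‖ + (M * ((∑ j ∈ Tᶜ, |δ j|) / √m) + M * ((∑ j ∈ Tᶜ, |δ j|) / √m)) := by
        rw [sqrt_mul_div_self] at h2; linarith
    _ = _ := by ring

/-- Conditions on the design under which the cone arguments below work: `s` bounds the size of the
support of the target, and `k` is the number of blocks of size `s` that are added to it. -/
structure DesignBounds (X : (Fin p → ℝ) →ₗ[ℝ] H) (s k : ℕ) (a M : ℝ) : Prop where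
  one_le_s : 1 ≤ s
  one_le_k : 1 ≤ k
  a_pos : 0 < a
  M_nonneg : 0 ≤ M
  lower : SparseLower X (s + k * s) a
  upper : SparseUpper X (k * s) M

/-- The constant in the compatibility inequality `l1norm_le_of_cone`. -/
noncomputable def coneConst (a M c b : ℝ) : ℝ := (1 + c) * (2 / a) * (1 + 2 * M * b) + b

theorem coneConst_nonneg {a M c b : ℝ} (ha : 0 < a) (hM : 0 ≤ M) (hc : 0 ≤ c) (hb : 0 ≤ b) :
    0 ≤ coneConst a M c b := by unfold coneConst; positivity

/-- Compatibility inequality: if `δ` lies in a cone around the vectors supported in `T`, up to a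
multiple of its prediction norm, then its `ℓ₁`-norm is controlled by its prediction norm. -/
theorem DesignBounds.l1norm_le_of_cone {s k : ℕ} {a M : ℝ} (hX : DesignBounds X s k a M)
    {c b : ℝ} (hc : 0 ≤ c) (hb : 0 ≤ b) (hk : 4 * M * c ≤ a * √k)
    {T : Finset (Fin p)} (hT : T.card ≤ s) {δ : Fin p → ℝ}
    (hcone : ∑ j ∈ Tᶜ, |δ j| ≤ c * ∑ j ∈ T, |δ j| + b * (√s * ‖X δ‖)) :
    l1norm δ ≤ coneConst a M c b * (√s * ‖X δ‖) := by
  have hs := hX.one_le_s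
  have hk1 := hX.one_le_k
  have ha := hX.a_pos
  have hM := hX.M_nonneg
  have hs0 : (0 : ℝ) < s := by exact_mod_cast hs
  have hss : 0 < √(s : ℝ) := Real.sqrt_pos.2 hs0
  have hk0 : (1 : ℝ) ≤ √(k : ℝ) := Real.one_le_sqrt.2 (by exact_mod_cast hk1)
  have hre := hX.lower.le_norm_add hX.upper (Nat.one_le_iff_ne_zero.2 (by positivity)) ha.le hM T hT δ
  set q := √(∑ j ∈ T, δ j ^ 2) with hq
  have hq0 : 0 ≤ q := Real.sqrt_nonneg _
  have hN : 0 ≤ ‖X δ‖ := norm_nonneg _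
  have hTq : ∑ j ∈ T, |δ j| ≤ √s * q := (sum_abs_le_sqrt_card_mul T δ).trans (by gcongr)
  have hcone' : ∑ j ∈ Tᶜ, |δ j| ≤ √s * (c * q + b * ‖X δ‖) := by
    refine hcone.trans ?_
    nlinarith [mul_le_mul_of_nonneg_left hTq hc]
  have h1 : a * q ≤ ‖X δ‖ + 2 * M / √k * (c * q + b * ‖X δ‖) := by
    refine hre.trans ?_
    have : (2 * M / √((k * s : ℕ) : ℝ)) * ∑ j ∈ Tᶜ, |δ j|
        ≤ (2 * M / √((k * s : ℕ) : ℝ)) * (√s * (c * q + b * ‖X δ‖)) := by gcongr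
    refine (add_le_add_right this _).trans (le_of_eq ?_)
    push_cast
    rw [Real.sqrt_mul (by positivity)]
    field_simp
  have h2 : 2 * M / √k * (c * q) ≤ a / 2 * q := by
    have : 2 * M / √k * c ≤ a / 2 := by
      rw [div_mul_eq_mul_div, div_le_iff₀ (by linarith)]; linarith
    nlinarith
  have h3 : 2 * M / √k * (b * ‖X δ‖) ≤ 2 * M * (b * ‖X δ‖) := by
    gcongr; exact div_le_self (by positivity) hk0
  have h4 : q ≤ 2 / a * (1 + 2 * M * b) * ‖X δ‖ := by
    have : a / 2 * q ≤ (1 + 2 * M * b) * ‖X δ‖ := by nlinarith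
    calc q = 2 / a * (a / 2 * q) := by field_simp
      _ ≤ 2 / a * ((1 + 2 * M * b) * ‖X δ‖) := by gcongr
      _ = _ := by ring
  rw [l1norm_eq_add_compl T]
  calc ∑ j ∈ T, |δ j| + ∑ j ∈ Tᶜ, |δ j| ≤ √s * ((1 + c) * q + b * ‖X δ‖) := by nlinarith
    _ ≤ √s * ((1 + c) * (2 / a * (1 + 2 * M * b) * ‖X δ‖) + b * ‖X δ‖) := by gcongr
    _ = _ := by unfold coneConst; ring

end

section

variable {H : Type*} [NormedAddCommGroup H] [InnerProductSpace ℝ H] {p : ℕ}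
variable {X : (Fin p → ℝ) →ₗ[ℝ] H}

/-- `ε` is nearly orthogonal to the columns of the design: all inner products are at most `t`. -/
def ScoreLE (X : (Fin p → ℝ) →ₗ[ℝ] H) (ε : H) (t : ℝ) : Prop :=
  ∀ j, |inner ℝ (X (Pi.single j 1)) ε| ≤ t

theorem inner_design (X : (Fin p → ℝ) →ₗ[ℝ] H) (δ : Fin p → ℝ) (ε : H) :
    inner ℝ (X δ) ε = ∑ j, δ j * inner ℝ (X (Pi.single j 1)) ε := by
  conv_lhs => rw [pi_eq_sum_univ' δ, map_sum, sum_inner]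
  refine Finset.sum_congr rfl fun j _ => ?_
  rw [map_smul, real_inner_smul_left]

theorem ScoreLE.abs_inner_le {ε : H} {t : ℝ} (h : ScoreLE X ε t) (δ : Fin p → ℝ) :
    |inner ℝ (X δ) ε| ≤ t * l1norm δ := by
  rw [inner_design, l1norm, Finset.mul_sum]
  refine (Finset.abs_sum_le_sum_abs _ _).trans (Finset.sum_le_sum fun j _ => ?_)
  rw [abs_mul, mul_comm]
  exact mul_le_mul_of_nonneg_right (h j) (abs_nonneg _)

/-- On sparse vectors the `ℓ₁`-norm is controlled by the prediction norm. -/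
theorem SparseLower.l1norm_le {K : ℕ} {a : ℝ} (hl : SparseLower X K a) (ha : 0 < a)
    {e : Fin p → ℝ} (he : (supp e).card ≤ K) : l1norm e ≤ √K / a * ‖X e‖ := by
  have h0 : l1norm e = ∑ j ∈ supp e, |e j| := by
    refine (Finset.sum_subset (Finset.subset_univ _) fun j _ hj => ?_).symm
    simpa [supp] using hj
  have h1 : ∑ j ∈ supp e, e j ^ 2 ≤ ∑ j, e j ^ 2 :=
    Finset.sum_le_sum_of_subset_of_nonneg (Finset.subset_univ _) fun _ _ _ => sq_nonneg _
  have h2 := hl e he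
  rw [h0, div_mul_eq_mul_div, le_div_iff₀ ha]
  calc (∑ j ∈ supp e, |e j|) * a ≤ (√((supp e).card : ℝ) * √(∑ j ∈ supp e, e j ^ 2)) * a := by
        gcongr; exact sum_abs_le_sqrt_card_mul _ _
    _ ≤ (√K * √(∑ j, e j ^ 2)) * a := by gcongr
    _ = √K * (a * √(∑ j, e j ^ 2)) := by ring
    _ ≤ √K * ‖X e‖ := by gcongr

/-- Least squares over a sparse model: the noise contributes the square root of the number of
parameters times the score, and the approximation error enters additively. -/
theorem SparseLower.norm_le_of_sq_le {K : ℕ} {a : ℝ} (hl : SparseLower X K a) (ha : 0 < a)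
    {e : Fin p → ℝ} (he : (supp e).card ≤ K) {ε : H} {t R : ℝ} (ht : ScoreLE X ε t)
    (ht0 : 0 ≤ t) (hR : 0 ≤ R) (h : ‖X e‖ ^ 2 ≤ inner ℝ (X e) ε + R * ‖X e‖) :
    ‖X e‖ ≤ √K * t / a + R := by
  rcases (norm_nonneg (X e)).eq_or_lt with h0 | h0
  · rw [← h0]; positivity
  have h1 := (le_abs_self _).trans (ht.abs_inner_le e)
  have h2 := mul_le_mul_of_nonneg_left (hl.l1norm_le ha he) ht0
  have : ‖X e‖ * ‖X e‖ ≤ ‖X e‖ * (√K * t / a + R) := by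
    calc ‖X e‖ * ‖X e‖ = ‖X e‖ ^ 2 := by ring
      _ ≤ t * (√K / a * ‖X e‖) + R * ‖X e‖ := by linarith
      _ = _ := by ring
  exact le_of_mul_le_mul_left this h0

/-! ### Lasso and Square-root Lasso -/

/-- `β` minimizes the Lasso criterion with penalty `τ`. -/
def LassoMin (X : (Fin p → ℝ) →ₗ[ℝ] H) (w : H) (τ : ℝ) (β : Fin p → ℝ) : Prop :=
  ∀ b, ‖w - X β‖ ^ 2 + τ * l1norm β ≤ ‖w - X b‖ ^ 2 + τ * l1norm b

/-- `β` minimizes the Square-root Lasso criterion with penalty `τ`. -/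
def SqrtLassoMin (X : (Fin p → ℝ) →ₗ[ℝ] H) (w : H) (τ : ℝ) (β : Fin p → ℝ) : Prop :=
  ∀ b, ‖w - X β‖ + τ * l1norm β ≤ ‖w - X b‖ + τ * l1norm b

/-- A Square-root Lasso solution is a Lasso solution, for a penalty proportional to its residual
norm. -/
theorem SqrtLassoMin.lassoMin {w : H} {τ : ℝ} {β : Fin p → ℝ} (h : SqrtLassoMin X w τ β)
    (hq : 0 < ‖w - X β‖) : LassoMin X w (2 * ‖w - X β‖ * τ) β := by
  intro b
  nlinarith [mul_le_mul_of_nonneg_left (h b) hq.le, sq_nonneg (‖w - X b‖ - ‖w - X β‖)]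

theorem l1norm_sub_l1norm_le (β₀ β : Fin p → ℝ) :
    l1norm β₀ - l1norm β ≤
      ∑ j ∈ supp β₀, |(β - β₀) j| - ∑ j ∈ (supp β₀)ᶜ, |(β - β₀) j| := by
  rw [l1norm_eq_add_compl (supp β₀) β₀, l1norm_eq_add_compl (supp β₀) β]
  have h0 : ∀ j ∈ (supp β₀)ᶜ, β₀ j = 0 := fun j hj => by simpa [supp] using hj
  have h1 : ∑ j ∈ (supp β₀)ᶜ, |β₀ j| = 0 :=
    Finset.sum_eq_zero fun j hj => by simp [h0 j hj]
  have h2 : ∑ j ∈ (supp β₀)ᶜ, |(β - β₀) j| = ∑ j ∈ (supp β₀)ᶜ, |β j| :=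
    Finset.sum_congr rfl fun j hj => by simp [h0 j hj]
  have h3 : ∑ j ∈ supp β₀, |β₀ j| ≤ ∑ j ∈ supp β₀, |(β - β₀) j| + ∑ j ∈ supp β₀, |β j| := by
    rw [← Finset.sum_add_distrib]
    refine Finset.sum_le_sum fun j _ => ?_
    have := abs_sub_abs_le_abs_sub (β₀ j) (β j)
    rw [abs_sub_comm] at this
    simp only [Pi.sub_apply]; linarith
  linarith

theorem le_div_cone {θ A B N : ℝ} (hθ : θ < 1) (h : (1 - θ) * A ≤ (1 + θ) * B + N) :
    A ≤ (1 + θ) / (1 - θ) * B + N / (1 - θ) := by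
  have : 0 < 1 - θ := by linarith
  rw [div_mul_eq_mul_div, ← add_div, le_div_iff₀ this]
  linarith

/-- Prediction error of Lasso under a sparse linear approximation with error `r`, when the penalty
dominates the score of the noise `ε`. -/
theorem DesignBounds.lasso_rate {s k : ℕ} {a M : ℝ} (hX : DesignBounds X s k a M) {θ b τ : ℝ}
    (hθ0 : 0 ≤ θ) (hθ : θ < 1) (hb : 0 ≤ b) (hτ : 0 < τ)
    (hk : 4 * M * ((1 + θ) / (1 - θ)) ≤ a * √k) {β₀ β : Fin p → ℝ} (hβ₀ : (supp β₀).card ≤ s)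
    {ε r : H} (hr : ‖r‖ ≤ b * (τ * √s)) (hε : ScoreLE X ε (θ * τ / 2))
    (hβ : LassoMin X (X β₀ + r + ε) τ β) :
    ‖X (β - β₀)‖ ≤
      2 * (coneConst a M ((1 + θ) / (1 - θ)) (2 * b / (1 - θ)) + b) * (τ * √s) := by
  have h1θ : 0 < 1 - θ := by linarith
  set δ := β - β₀ with hδ
  set N := ‖X δ‖ with hN
  have hN0 : 0 ≤ N := norm_nonneg _
  have hres : X β₀ + r + ε - X β = (r + ε) - X δ := by rw [hδ, map_sub]; abel
  have hres0 : X β₀ + r + ε - X β₀ = r + ε := by abel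
  have hbasic := hβ β₀
  rw [hres, hres0, norm_sub_sq_real, real_inner_comm, inner_add_right] at hbasic
  have hsc := (le_abs_self _).trans (hε.abs_inner_le δ)
  have hri : inner ℝ (X δ) r ≤ b * (τ * √s) * N := by
    refine (real_inner_le_norm _ _).trans ?_
    rw [mul_comm]; gcongr
  have hl1 := mul_le_mul_of_nonneg_left (l1norm_sub_l1norm_le β₀ β) hτ.le
  rw [← hδ] at hl1
  set A := ∑ j ∈ (supp β₀)ᶜ, |δ j| with hA
  set B := ∑ j ∈ supp β₀, |δ j| with hB
  have hAB : l1norm δ = B + A := l1norm_eq_add_compl _ _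
  have hA0 : 0 ≤ A := Finset.sum_nonneg fun _ _ => abs_nonneg _
  have hB0 : 0 ≤ B := Finset.sum_nonneg fun _ _ => abs_nonneg _
  rw [hAB] at hsc
  have hmain : N ^ 2 ≤ θ * τ * (B + A) + 2 * (b * (τ * √s) * N) + τ * (B - A) := by nlinarith
  have hcone : A ≤ (1 + θ) / (1 - θ) * B + 2 * b / (1 - θ) * (√s * N) := by
    have h : (1 - θ) * A ≤ (1 + θ) * B + 2 * b * (√s * N) := by
      have : τ * ((1 - θ) * A) ≤ τ * ((1 + θ) * B + 2 * b * (√s * N)) := by nlinarith [sq_nonneg N]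
      exact le_of_mul_le_mul_left this hτ
    refine (le_div_cone hθ h).trans (le_of_eq ?_)
    ring
  have hl := hX.l1norm_le_of_cone (c := (1 + θ) / (1 - θ)) (b := 2 * b / (1 - θ))
    (by positivity) (by positivity) hk hβ₀ hcone
  rw [hAB] at hl
  set C := coneConst a M ((1 + θ) / (1 - θ)) (2 * b / (1 - θ)) with hC
  have h2 : N * N ≤ N * (2 * (C + b) * (τ * √s)) := by
    have h3 : θ * τ * (B + A) + τ * (B - A) ≤ 2 * τ * (B + A) := by
      nlinarith [mul_nonneg hτ.le hA0, mul_nonneg hτ.le hB0,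
        mul_nonneg (mul_nonneg hτ.le h1θ.le) (add_nonneg hB0 hA0)]
    have h4 : 2 * τ * (B + A) ≤ 2 * τ * (C * (√s * N)) := by gcongr
    nlinarith
  rcases hN0.eq_or_lt with h0 | h0
  · rw [← h0]
    have : 0 ≤ C := coneConst_nonneg hX.a_pos hX.M_nonneg (by positivity) (by positivity)
    positivity
  · exact le_of_mul_le_mul_left h2 h0

/-- The residual norm of Square-root Lasso is close to the norm of the disturbance, in relative
terms. -/
theorem DesignBounds.sqrtLasso_residual {s k : ℕ} {a M : ℝ} (hX : DesignBounds X s k a M)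
    {θ b τ : ℝ} (hθ0 : 0 ≤ θ) (hθ : θ < 1) (hb : 0 ≤ b) (hτ : 0 < τ)
    (hk : 4 * M * ((1 + θ) / (1 - θ)) ≤ a * √k) {β₀ β : Fin p → ℝ} (hβ₀ : (supp β₀).card ≤ s)
    {ε r : H} (hq : 0 < ‖r + ε‖) (hr : ‖r‖ ≤ b * (τ * √s) * ‖r + ε‖)
    (hε : ScoreLE X ε (θ * τ * ‖r + ε‖)) (hβ : SqrtLassoMin X (X β₀ + r + ε) τ β) :
    |‖X β₀ + r + ε - X β‖ - ‖r + ε‖| ≤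
      (coneConst a M ((1 + θ) / (1 - θ)) (b / (1 - θ)) + b) * (τ * √s) *
        (‖X β₀ + r + ε - X β‖ + ‖r + ε‖) := by
  have h1θ : 0 < 1 - θ := by linarith
  set δ := β - β₀ with hδ
  set N := ‖X δ‖ with hN
  have hN0 : 0 ≤ N := norm_nonneg _
  have hres : X β₀ + r + ε - X β = (r + ε) - X δ := by rw [hδ, map_sub]; abel
  have hres0 : X β₀ + r + ε - X β₀ = r + ε := by abel
  have hbasic := hβ β₀
  rw [hres0] at hbasic
  rw [hres] at hbasic ⊢
  set q₀ := ‖r + ε‖ with hq₀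
  set q := ‖r + ε - X δ‖ with hqd
  have hNq : N ≤ q + q₀ := by
    have : X δ = (r + ε) - (r + ε - X δ) := by abel
    rw [hN, this]; linarith [norm_sub_le (r + ε) (r + ε - X δ)]
  have hsc := (le_abs_self _).trans (hε.abs_inner_le δ)
  have hri : inner ℝ (X δ) r ≤ b * (τ * √s) * q₀ * N := by
    refine (real_inner_le_norm _ _).trans ?_
    rw [mul_comm]; gcongr
  have hl1 := mul_le_mul_of_nonneg_left (l1norm_sub_l1norm_le β₀ β) hτ.le
  rw [← hδ] at hl1
  set A := ∑ j ∈ (supp β₀)ᶜ, |δ j| with hA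
  set B := ∑ j ∈ supp β₀, |δ j| with hB
  have hAB : l1norm δ = B + A := l1norm_eq_add_compl _ _
  have hA0 : 0 ≤ A := Finset.sum_nonneg fun _ _ => abs_nonneg _
  have hB0 : 0 ≤ B := Finset.sum_nonneg fun _ _ => abs_nonneg _
  rw [hAB] at hsc
  have hlow : q₀ - q ≤ θ * τ * (B + A) + b * (τ * √s) * N := by
    have h1 : inner ℝ (r + ε) (r + ε - X δ) ≤ q₀ * q := real_inner_le_norm _ _
    rw [inner_sub_right, real_inner_self_eq_norm_sq, real_inner_comm, inner_add_right] at h1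
    have : q₀ * (q₀ - q) ≤ q₀ * (θ * τ * (B + A) + b * (τ * √s) * N) := by nlinarith
    exact le_of_mul_le_mul_left this hq
  have hup : q - q₀ ≤ τ * (B - A) := by nlinarith
  have hcone : A ≤ (1 + θ) / (1 - θ) * B + b / (1 - θ) * (√s * N) := by
    have h : (1 - θ) * A ≤ (1 + θ) * B + b * (√s * N) := by
      have : τ * ((1 - θ) * A) ≤ τ * ((1 + θ) * B + b * (√s * N)) := by nlinarith
      exact le_of_mul_le_mul_left this hτ
    refine (le_div_cone hθ h).trans (le_of_eq ?_)
    ring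
  have hl := hX.l1norm_le_of_cone (c := (1 + θ) / (1 - θ)) (b := b / (1 - θ))
    (by positivity) (by positivity) hk hβ₀ hcone
  rw [hAB] at hl
  set C := coneConst a M ((1 + θ) / (1 - θ)) (b / (1 - θ)) with hC
  have hC0 : 0 ≤ C := coneConst_nonneg hX.a_pos hX.M_nonneg (by positivity) (by positivity)
  have hfin : |q - q₀| ≤ (C + b) * (τ * √s) * N := by
    have h4 : τ * (B + A) ≤ τ * (C * (√s * N)) := by gcongr
    have h5 : 0 ≤ b * (τ * √s) * N := by positivity
    rw [abs_le]
    constructor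
    · nlinarith [mul_nonneg (mul_nonneg hτ.le h1θ.le) (add_nonneg hB0 hA0)]
    · nlinarith [mul_nonneg hτ.le hA0]
  refine hfin.trans ?_
  gcongr

theorem linear_nonneg_of_quadratic {A B t₀ : ℝ} (ht₀ : 0 < t₀)
    (h : ∀ t, 0 < t → t < t₀ → 0 ≤ t * A + t ^ 2 * B) : 0 ≤ A := by
  by_contra hA
  push Not at hA
  set t := min (t₀ / 2) (-A / (2 * (|B| + 1)))
  have hB : 0 < |B| + 1 := by positivity
  have h1 : 0 < -A / (2 * (|B| + 1)) := div_pos (by linarith) (by positivity)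
  have ht : 0 < t := lt_min (by linarith) h1
  have h2 := h t ht ((min_le_left _ _).trans_lt (by linarith))
  have h3 : t * (2 * (|B| + 1)) ≤ -A := (le_div_iff₀ (by positivity)).1 (min_le_right _ _)
  have h4 : t * B ≤ t * |B| := by gcongr; exact le_abs_self B
  have h5 : 0 ≤ t * (A + t * B) := by nlinarith
  have h6 : 0 ≤ A + t * B := nonneg_of_mul_nonneg_right h5 ht
  nlinarith

theorem l1norm_add_single (β : Fin p → ℝ) (j : Fin p) (t : ℝ) :
    l1norm (β + t • (Pi.single j 1 : Fin p → ℝ)) = l1norm β + (|β j + t| - |β j|) := by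
  unfold l1norm
  rw [← Finset.add_sum_erase _ _ (Finset.mem_univ j),
    ← Finset.add_sum_erase _ (fun i => |β i|) (Finset.mem_univ j)]
  have : ∑ i ∈ Finset.univ.erase j, |(β + t • (Pi.single j 1 : Fin p → ℝ)) i|
      = ∑ i ∈ Finset.univ.erase j, |β i| :=
    Finset.sum_congr rfl fun i hi => by simp [Finset.ne_of_mem_erase hi]
  rw [this]
  simp
  ring

/-- Optimality condition of Lasso: the residual has maximal correlation with every selected
column. -/
theorem LassoMin.abs_inner_residual {w : H} {τ : ℝ} {β : Fin p → ℝ} (h : LassoMin X w τ β)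
    (hτ : 0 ≤ τ) {j : Fin p} (hj : β j ≠ 0) :
    2 * |inner ℝ (X (Pi.single j 1)) (w - X β)| = τ := by
  set c := inner ℝ (X (Pi.single j 1)) (w - X β) with hc
  have key : ∀ t, 0 ≤ -2 * t * c + t ^ 2 * ‖X (Pi.single j 1)‖ ^ 2 + τ * (|β j + t| - |β j|) := by
    intro t
    have h1 := h (β + t • Pi.single j 1)
    rw [l1norm_add_single, map_add, map_smul, ← sub_sub, norm_sub_sq_real (w - X β),
      real_inner_smul_right, real_inner_comm, norm_smul, mul_pow, Real.norm_eq_abs, sq_abs] at h1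
    rw [← hc] at h1
    linarith
  rcases hj.lt_or_gt with hneg | hpos
  · have e1 : 0 ≤ -2 * c - τ := linear_nonneg_of_quadratic (neg_pos.2 hneg)
      (B := ‖X (Pi.single j 1)‖ ^ 2) fun t ht ht' => by
        have := key t
        rw [abs_of_neg (by linarith : β j + t < 0), abs_of_neg hneg] at this
        linarith
    have e2 : 0 ≤ 2 * c + τ := linear_nonneg_of_quadratic (neg_pos.2 hneg)
      (B := ‖X (Pi.single j 1)‖ ^ 2) fun t ht ht' => by
        have := key (-t)
        rw [abs_of_neg (by linarith : β j + -t < 0), abs_of_neg hneg] at this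
        linarith
    rw [abs_of_nonpos (by linarith)]; linarith
  · have e1 : 0 ≤ -2 * c + τ := linear_nonneg_of_quadratic hpos
      (B := ‖X (Pi.single j 1)‖ ^ 2) fun t ht ht' => by
        have := key t
        rw [abs_of_pos (by linarith : 0 < β j + t), abs_of_pos hpos] at this
        linarith
    have e2 : 0 ≤ 2 * c - τ := linear_nonneg_of_quadratic hpos
      (B := ‖X (Pi.single j 1)‖ ^ 2) fun t ht ht' => by
        have := key (-t)
        rw [abs_of_pos (by linarith : 0 < β j + -t), abs_of_pos hpos] at this
        linarith
    rw [abs_of_nonneg (by linarith)]; linarith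

/-- Sparsity of Lasso: the selected columns all have a sizable correlation with the estimation
error, so there cannot be many of them. -/
theorem LassoMin.card_supp_le {w ε : H} {τ θ M B : ℝ} {m : ℕ} {β : Fin p → ℝ}
    (h : LassoMin X w τ β) (hτ : 0 < τ) (hθ : θ < 1) (hX : SparseUpper X m M)
    (hε : ScoreLE X ε (θ * τ / 2)) (hB : (2 * M * ‖w - ε - X β‖) ^ 2 ≤ B * (τ * (1 - θ)) ^ 2)
    (hBm : B < m) : ((supp β).card : ℝ) ≤ B := by
  have h1θ : 0 < 1 - θ := by linarith
  have key : ∀ S ⊆ supp β, S.card ≤ m → (S.card : ℝ) ≤ B := by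
    intro S hS hSm
    set c : Fin p → ℝ := fun j => inner ℝ (X (Pi.single j 1)) (w - ε - X β) with hc
    have hclow : ∀ j ∈ S, (τ * (1 - θ) / 2) ^ 2 ≤ c j ^ 2 := by
      intro j hj
      have h1 := h.abs_inner_residual hτ.le (j := j) (by simpa [supp] using hS hj)
      have h2 : inner ℝ (X (Pi.single j 1)) (w - X β) =
          c j + inner ℝ (X (Pi.single j 1)) ε := by
        rw [hc, ← inner_add_right]; congr 1; abel
      rw [h2] at h1
      have h3 := abs_add_le (c j) (inner ℝ (X (Pi.single j 1)) ε)
      have h4 := hε j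
      rw [← sq_abs (c j)]
      have : 0 ≤ τ * (1 - θ) / 2 := by positivity
      gcongr
      linarith
    set Q := ∑ j ∈ S, c j ^ 2 with hQ
    have hQ0 : 0 ≤ Q := Finset.sum_nonneg fun _ _ => sq_nonneg _
    have h5 : Q ≤ M * √Q * ‖w - ε - X β‖ := by
      have e1 : inner ℝ (X (restr S c)) (w - ε - X β) = Q := by
        rw [inner_design, hQ]
        simp [restr, ite_mul, Finset.sum_ite_mem, pow_two, hc]
      rw [← e1]
      refine (real_inner_le_norm _ _).trans ?_
      gcongr
      have := hX (restr S c) ((Finset.card_le_card (supp_restr_subset S c)).trans hSm)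
      rw [sum_sq_restr] at this
      rwa [e1]
    have h6 : Q ≤ (M * ‖w - ε - X β‖) ^ 2 := by
      rcases hQ0.eq_or_lt with h0 | h0
      · rw [← h0]; positivity
      have hs : 0 < √Q := Real.sqrt_pos.2 h0
      have h7 : √Q * √Q ≤ √Q * (M * ‖w - ε - X β‖) := by
        rw [Real.mul_self_sqrt hQ0]; linarith
      have h8 := le_of_mul_le_mul_left h7 hs
      calc Q = √Q ^ 2 := (Real.sq_sqrt hQ0).symm
        _ ≤ _ := by gcongr
    have h9 : (S.card : ℝ) * (τ * (1 - θ) / 2) ^ 2 ≤ Q := by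
      rw [← nsmul_eq_mul]
      exact Finset.card_nsmul_le_sum _ _ _ hclow
    have h10 : (S.card : ℝ) * (τ * (1 - θ)) ^ 2 ≤ B * (τ * (1 - θ)) ^ 2 := by nlinarith
    exact le_of_mul_le_mul_right h10 (by positivity)
  by_contra hlt
  push Not at hlt
  rcases le_total (supp β).card m with hm | hm
  · exact absurd (key _ subset_rfl hm) (not_le.2 hlt)
  · obtain ⟨S, hS, hSc⟩ := Finset.exists_subset_card_eq hm
    have := key S hS hSc.le
    rw [hSc] at this
    linarith

end

section

variable {H : Type*} [NormedAddCommGroup H] [InnerProductSpace ℝ H] {p : ℕ}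
variable {X : (Fin p → ℝ) →ₗ[ℝ] H}

/-! ### Least squares after selection -/

/-- The coefficient vectors supported in `I`. -/
def modelSpace (I : Finset (Fin p)) : Submodule ℝ (Fin p → ℝ) where
  carrier := {b | ∀ j, j ∉ I → b j = 0}
  add_mem' ha hb j hj := by simp [ha j hj, hb j hj]
  zero_mem' j _ := rfl
  smul_mem' c b hb j hj := by simp [hb j hj]

theorem mem_modelSpace {I : Finset (Fin p)} {b : Fin p → ℝ} :
    b ∈ modelSpace I ↔ ∀ j, j ∉ I → b j = 0 := Iff.rfl

theorem mem_modelSpace_of_supp_subset {I : Finset (Fin p)} {b : Fin p → ℝ} (h : supp b ⊆ I) :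
    b ∈ modelSpace I := fun j hj => by
  by_contra hb
  exact hj (h (by simpa [supp] using hb))

theorem card_supp_le_of_mem {I : Finset (Fin p)} {b : Fin p → ℝ} (h : b ∈ modelSpace I) :
    (supp b).card ≤ I.card := by
  refine Finset.card_le_card fun j hj => ?_
  by_contra hI
  simp [supp, h j hI] at hj

theorem inner_eq_zero_of_norm_le {u z : H} (h : ∀ t : ℝ, ‖u‖ ≤ ‖u - t • z‖) :
    inner ℝ z u = 0 := by
  rcases eq_or_ne z 0 with rfl | hz
  · simp
  have h1 := h (inner ℝ z u / ‖z‖ ^ 2)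
  have h2 := pow_le_pow_left₀ (norm_nonneg _) h1 2
  have hz' : ‖z‖ ^ 2 ≠ 0 := by simpa using hz
  rw [norm_sub_sq_real, real_inner_smul_right, norm_smul, mul_pow, real_inner_comm,
    Real.norm_eq_abs, sq_abs] at h2
  have h3 : inner ℝ u z ^ 2 / ‖z‖ ^ 2 ≤ 0 := by
    have e : inner ℝ u z / ‖z‖ ^ 2 * inner ℝ u z = inner ℝ u z ^ 2 / ‖z‖ ^ 2 := by ring
    have e' : (inner ℝ u z / ‖z‖ ^ 2) ^ 2 * ‖z‖ ^ 2 = inner ℝ u z ^ 2 / ‖z‖ ^ 2 := by field_simp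
    rw [e, e'] at h2; linarith
  have h4 : 0 < ‖z‖ ^ 2 := lt_of_le_of_ne (sq_nonneg _) hz'.symm
  have h5 : inner ℝ u z ^ 2 ≤ 0 := by
    have := (div_le_iff₀ h4).1 h3; linarith
  rw [real_inner_comm]
  exact pow_eq_zero_iff (two_ne_zero) |>.1 (le_antisymm h5 (sq_nonneg _))

/-- Least squares projection of `D` on the columns with index in `I`. -/
theorem exists_projection (X : (Fin p → ℝ) →ₗ[ℝ] H) (I : Finset (Fin p)) (D : H) :
    ∃ b ∈ modelSpace I, ∀ b' ∈ modelSpace I, inner ℝ (X b') (D - X b) = 0 := by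
  set S := (modelSpace I).map X
  obtain ⟨b, hb, hbD⟩ := Submodule.mem_map.1 (S.starProjection_apply_mem D)
  refine ⟨b, hb, fun b' hb' => ?_⟩
  rw [hbD]
  exact Submodule.sub_starProjection_mem_orthogonal D _ (Submodule.mem_map_of_mem hb')

/-- The deterministic inputs of the double selection argument, for the model
`D = m + v`, `Y = α₀ D + g + ζ`: the functions `m` and `g` are approximated by `X βm` and `X βg`,
the selected set `I` contains the supports of estimators `β₁` of `m` and `β₂` of `α₀ m + g`, all
approximation and estimation errors are at most `R`, the scores of the disturbances are at most
`t`, and the inner products of the disturbances with the approximation errors are at most `κ`. The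
integer `K` bounds the size of all models that occur, on which `X` has the sparse lower bound `a`;
`score_R` says that the noise explained by such a model is at most `R`. -/
structure SelectionBounds (X : (Fin p → ℝ) →ₗ[ℝ] H) (I : Finset (Fin p)) (α₀ : ℝ) (m g v ζ : H)
    (βm βg β₁ β₂ : Fin p → ℝ) (K : ℕ) (a A R t κ : ℝ) : Prop where
  a_pos : 0 < a
  R_nonneg : 0 ≤ R
  t_nonneg : 0 ≤ t
  alpha : |α₀| ≤ A
  lower : SparseLower X K a
  card_m : I.card + (supp βm).card ≤ K
  card_g : I.card + (supp βg).card ≤ K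
  mem_one : β₁ ∈ modelSpace I
  mem_two : β₂ ∈ modelSpace I
  rate_one : ‖m - X β₁‖ ≤ R
  rate_two : ‖α₀ • m + g - X β₂‖ ≤ R
  approx_m : ‖m - X βm‖ ≤ R
  approx_g : ‖g - X βg‖ ≤ R
  score_v : ScoreLE X v t
  score_ζ : ScoreLE X ζ t
  score_R : √K * t ≤ a * R
  inner_v_m : |inner ℝ v (m - X βm)| ≤ κ
  inner_v_g : |inner ℝ v (g - X βg)| ≤ κ
  inner_ζ_m : |inner ℝ ζ (m - X βm)| ≤ κ

namespace SelectionBounds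

variable {I : Finset (Fin p)} {α₀ : ℝ} {m g v ζ : H} {βm βg β₁ β₂ : Fin p → ℝ} {K : ℕ}
  {a A R t κ : ℝ}

/-- A sparse projection of a disturbance `ε` plus a remainder `f` of size `Q`. -/
theorem projection_le (h : SelectionBounds X I α₀ m g v ζ βm βg β₁ β₂ K a A R t κ)
    {e : Fin p → ℝ} (he : e ∈ modelSpace I) {ε f : H} (hε : ScoreLE X ε t) {Q : ℝ}
    (hf : ‖f‖ ≤ Q) (heq : ‖X e‖ ^ 2 = inner ℝ (X e) (ε + f)) : ‖X e‖ ≤ R + Q := by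
  have hQ : 0 ≤ Q := (norm_nonneg _).trans hf
  have := h.lower.norm_le_of_sq_le h.a_pos (e := e) (R := Q)
    ((card_supp_le_of_mem he).trans (by have := h.card_m; omega)) hε h.t_nonneg hQ (by
      rw [heq, inner_add_right]
      have := real_inner_le_norm (X e) f
      nlinarith [norm_nonneg (X e)])
  refine this.trans ?_
  gcongr
  rw [div_le_iff₀ h.a_pos]
  linarith [h.score_R]

/-- A disturbance is nearly orthogonal to the error of any approximation supported in `I`. -/
theorem abs_inner_le (h : SelectionBounds X I α₀ m g v ζ βm βg β₁ β₂ K a A R t κ)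
    {b βf : Fin p → ℝ} (hb : b ∈ modelSpace I) (hc : I.card + (supp βf).card ≤ K) {ε f : H}
    (hε : ScoreLE X ε t) {Q : ℝ} (hf : ‖f - X b‖ ≤ Q) (hβf : ‖f - X βf‖ ≤ R)
    (hi : |inner ℝ ε (f - X βf)| ≤ κ) : |inner ℝ ε (f - X b)| ≤ κ + R * (Q + R) := by
  have h1 : f - X b = (f - X βf) - X (b - βf) := by rw [map_sub]; abel
  have h2 : ‖X (b - βf)‖ ≤ Q + R := by
    have : X (b - βf) = (f - X βf) - (f - X b) := by rw [map_sub]; abel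
    rw [this]
    linarith [norm_sub_le (f - X βf) (f - X b)]
  have h3 : (supp (b - βf)).card ≤ K :=
    (supp_sub_card_le _ _).trans (by have := card_supp_le_of_mem hb; omega)
  have h4 := hε.abs_inner_le (b - βf)
  have h5 := h.lower.l1norm_le h.a_pos h3
  have h6 : |inner ℝ (X (b - βf)) ε| ≤ R * (Q + R) := by
    have ha := h.a_pos
    calc |inner ℝ (X (b - βf)) ε| ≤ t * (√K / a * ‖X (b - βf)‖) :=
          h4.trans (mul_le_mul_of_nonneg_left h5 h.t_nonneg)
      _ = (√K * t) / a * ‖X (b - βf)‖ := by ring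
      _ ≤ R * (Q + R) := by
          have : √K * t / a ≤ R := by rw [div_le_iff₀ ha]; linarith [h.score_R]
          have := h.R_nonneg
          gcongr
  rw [real_inner_comm] at h6
  rw [h1, inner_sub_right]
  exact (abs_sub _ _).trans (add_le_add hi h6)

/-- Since `g = (α₀ m + g) - α₀ m`, the two selection steps together approximate `g`, although no
regression estimates `g` directly. -/
theorem norm_g_sub_le (h : SelectionBounds X I α₀ m g v ζ βm βg β₁ β₂ K a A R t κ) :
    ‖g - X (β₂ - α₀ • β₁)‖ ≤ (1 + A) * R := by
  have : g - X (β₂ - α₀ • β₁) = (α₀ • m + g - X β₂) - α₀ • (m - X β₁) := by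
    rw [map_sub, map_smul, smul_sub]; abel
  rw [this]
  refine (norm_sub_le _ _).trans ?_
  rw [norm_smul, Real.norm_eq_abs]
  have := mul_le_mul h.alpha h.rate_one (norm_nonneg _) ((abs_nonneg _).trans h.alpha)
  linarith [h.rate_two]

theorem mem_sub (h : SelectionBounds X I α₀ m g v ζ βm βg β₁ β₂ K a A R t κ) :
    β₂ - α₀ • β₁ ∈ modelSpace I :=
  Submodule.sub_mem _ h.mem_two (Submodule.smul_mem _ _ h.mem_one)

variable {bhat : Fin p → ℝ}

/-- Least squares on the selected controls estimates `m` as well as the Lasso does. -/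
theorem norm_m_sub_le (h : SelectionBounds X I α₀ m g v ζ βm βg β₁ β₂ K a A R t κ)
    (hb : bhat ∈ modelSpace I)
    (hperp : ∀ b ∈ modelSpace I, inner ℝ (X b) (m + v - X bhat) = 0) :
    ‖m - X bhat‖ ≤ 3 * R := by
  have he : bhat - β₁ ∈ modelSpace I := Submodule.sub_mem _ hb h.mem_one
  have h1 : ‖X (bhat - β₁)‖ ≤ R + R := by
    refine h.projection_le he h.score_v h.rate_one ?_
    have h2 := hperp _ he
    have h3 : v + (m - X β₁) = (m + v - X bhat) + X (bhat - β₁) := by rw [map_sub]; abel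
    rw [h3, inner_add_right, h2, real_inner_self_eq_norm_sq, zero_add]
  have h4 : m - X bhat = (m - X β₁) - X (bhat - β₁) := by rw [map_sub]; abel
  rw [h4]
  linarith [norm_sub_le (m - X β₁) (X (bhat - β₁)), h.rate_one]

/-- The residual treatment variance is close to the variance of the treatment disturbance. -/
theorem abs_residual_sq_sub_le (h : SelectionBounds X I α₀ m g v ζ βm βg β₁ β₂ K a A R t κ)
    (hb : bhat ∈ modelSpace I)
    (hperp : ∀ b ∈ modelSpace I, inner ℝ (X b) (m + v - X bhat) = 0) :
    |‖m + v - X bhat‖ ^ 2 - ‖v‖ ^ 2| ≤ 2 * κ + 17 * R ^ 2 := by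
  have h1 := h.norm_m_sub_le hb hperp
  have h2 := h.abs_inner_le hb h.card_m h.score_v h1 h.approx_m h.inner_v_m
  have h3 : m + v - X bhat = v + (m - X bhat) := by abel
  have h4 : ‖m - X bhat‖ ^ 2 ≤ (3 * R) ^ 2 := by gcongr
  rw [h3, norm_add_sq_real]
  rw [abs_le] at h2 ⊢
  constructor <;> nlinarith [sq_nonneg ‖m - X bhat‖, sq_nonneg R]

variable {αc : ℝ} {βc : Fin p → ℝ}

/-- Normal equation for the treatment effect, with the residual treatment as instrument: up to
second order terms, the estimation error is that of the regression of `ζ` on `v`. -/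
theorem abs_alpha_sub_le (h : SelectionBounds X I α₀ m g v ζ βm βg β₁ β₂ K a A R t κ)
    (hb : bhat ∈ modelSpace I)
    (hperp : ∀ b ∈ modelSpace I, inner ℝ (X b) (m + v - X bhat) = 0)
    (hc : βc ∈ modelSpace I)
    (hols : inner ℝ (m + v - X bhat) (g + ζ - (αc - α₀) • (m + v) - X βc) = 0) :
    |‖m + v - X bhat‖ ^ 2 * (αc - α₀) - inner ℝ v ζ| ≤ 2 * κ + (9 + 4 * A) * R ^ 2 := by
  have h1 := h.norm_m_sub_le hb hperp
  have h2 := h.abs_inner_le hb h.card_m h.score_ζ h1 h.approx_m h.inner_ζ_m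
  have h3 := h.abs_inner_le h.mem_sub h.card_g h.score_v h.norm_g_sub_le h.approx_g h.inner_v_g
  have hA : 0 ≤ A := (abs_nonneg _).trans h.alpha
  have hR := h.R_nonneg
  have h4 : |inner ℝ (m - X bhat) (g - X (β₂ - α₀ • β₁))| ≤ 3 * R * ((1 + A) * R) := by
    refine (abs_real_inner_le_norm _ _).trans ?_
    gcongr
    exact h.norm_g_sub_le
  set ν := m + v - X bhat with hν
  have e1 : inner ℝ ν (m + v) = ‖ν‖ ^ 2 := by
    have : m + v = ν + X bhat := by rw [hν]; abel
    rw [this, inner_add_right, real_inner_self_eq_norm_sq, real_inner_comm, hperp _ hb, add_zero]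
  have e2 : inner ℝ ν (X βc) = 0 := by rw [real_inner_comm]; exact hperp _ hc
  have e3 : inner ℝ ν (X (β₂ - α₀ • β₁)) = 0 := by rw [real_inner_comm]; exact hperp _ h.mem_sub
  rw [inner_sub_right, inner_sub_right, real_inner_smul_right, e1, e2, inner_add_right] at hols
  have e4 : inner ℝ ν g = inner ℝ v (g - X (β₂ - α₀ • β₁)) +
      inner ℝ (m - X bhat) (g - X (β₂ - α₀ • β₁)) := by
    have h5 : inner ℝ ν g = inner ℝ ν (g - X (β₂ - α₀ • β₁)) := by
      rw [inner_sub_right, e3, sub_zero]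
    rw [h5, ← inner_add_left]
    congr 1
    rw [hν]; abel
  have e5 : inner ℝ ν ζ = inner ℝ v ζ + inner ℝ ζ (m - X bhat) := by
    rw [real_inner_comm (m - X bhat) ζ, ← inner_add_left]
    congr 1
    rw [hν]; abel
  rw [e4, e5] at hols
  rw [abs_le] at *
  constructor <;> nlinarith

/-- The residual norm of the final regression is close to the norm of the disturbance. -/
theorem abs_residual_sub_le (h : SelectionBounds X I α₀ m g v ζ βm βg β₁ β₂ K a A R t κ)
    (hb : bhat ∈ modelSpace I) (hc : βc ∈ modelSpace I)
    (hperp : ∀ b ∈ modelSpace I, inner ℝ (X b) (m + v - X bhat) = 0)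
    (hols : ∀ b ∈ modelSpace I, inner ℝ (X b) (g + ζ - (αc - α₀) • (m + v) - X βc) = 0) :
    |‖g + ζ - (αc - α₀) • (m + v) - X βc‖ - ‖ζ‖| ≤
      (3 + 2 * A) * R + |αc - α₀| * ‖m + v - X bhat‖ := by
  set bs := β₂ - α₀ • β₁ with hbs
  set e := βc - bs + (αc - α₀) • bhat with he
  have heI : e ∈ modelSpace I :=
    Submodule.add_mem _ (Submodule.sub_mem _ hc h.mem_sub) (Submodule.smul_mem _ _ hb)
  set ν := m + v - X bhat with hν
  set u := g + ζ - (αc - α₀) • (m + v) - X βc with hu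
  have hXe : X e = X βc - X bs + (αc - α₀) • X bhat := by
    rw [he, map_add, map_sub, map_smul]
  have hdec : u = ζ + (g - X bs) - (αc - α₀) • ν - X e := by
    rw [hu, hXe, hν, smul_sub]; abel
  have h1 : ‖X e‖ ≤ R + (1 + A) * R := by
    refine h.projection_le heI h.score_ζ h.norm_g_sub_le ?_
    have : ζ + (g - X bs) = u + (αc - α₀) • ν + X e := by rw [hdec]; abel
    rw [this, inner_add_right, inner_add_right, hols _ heI, real_inner_smul_right, hperp _ heI,
      real_inner_self_eq_norm_sq]
    ring
  refine (abs_norm_sub_norm_le _ _).trans ?_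
  have h2 : u - ζ = (g - X bs) - (αc - α₀) • ν - X e := by rw [hdec]; abel
  rw [h2]
  have h3 := norm_sub_le ((g - X bs) - (αc - α₀) • ν) (X e)
  have h4 := norm_sub_le (g - X bs) ((αc - α₀) • ν)
  rw [norm_smul, Real.norm_eq_abs] at h4
  have h5 := h.norm_g_sub_le
  linarith

end SelectionBounds

end

section

/-! ### Convergence in probability as convergence along a filter -/

section whp

variable {Ω : ℕ → Type*} [∀ n, MeasurableSpace (Ω n)] (μ : ∀ n, Measure (Ω n))

/-- The filter of events that hold with probability tending to one, for a sequence of probability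
spaces. An event of the array is a set of pairs `(n, ω)` with `ω : Ω n`. -/
def whp : Filter (Σ n, Ω n) where
  sets := {A | Tendsto (fun n => μ n {ω | (⟨n, ω⟩ : Σ n, Ω n) ∉ A}) atTop (𝓝 0)}
  univ_sets := by simp
  sets_of_superset {A B} hA hAB :=
    tendsto_of_tendsto_of_tendsto_of_le_of_le tendsto_const_nhds hA (fun _ => zero_le)
      fun n => measure_mono fun ω hω h => hω (hAB h)
  inter_sets {A B} hA hB := by
    have h := Tendsto.add hA hB
    rw [add_zero] at h
    refine tendsto_of_tendsto_of_tendsto_of_le_of_le tendsto_const_nhds h (fun _ => zero_le)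
      fun n => (measure_mono fun ω hω => ?_).trans (measure_union_le _ _)
    by_contra hcon
    simp only [Set.mem_union, Set.mem_ofPred_eq, not_or, not_not] at hcon
    exact hω ⟨hcon.1, hcon.2⟩

variable {μ}

theorem eventually_whp {P : ∀ n, Ω n → Prop} :
    (∀ᶠ q in whp μ, P q.1 q.2) ↔ Tendsto (fun n => μ n {ω | ¬ P n ω}) atTop (𝓝 0) := Iff.rfl

theorem tendsto_fst_whp : Tendsto Sigma.fst (whp μ) atTop := by
  intro A hA
  refine (eventually_whp (P := fun n _ => n ∈ A)).2 ?_
  refine tendsto_const_nhds.congr' ?_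
  filter_upwards [hA] with n hn
  simp [hn]

theorem Eventually.whp {P : ℕ → Prop} (h : ∀ᶠ n in atTop, P n) : ∀ᶠ q in whp μ, P q.1 :=
  tendsto_fst_whp.eventually h

theorem Tendsto.whp {α : Type*} {l : Filter α} {u : ℕ → α} (h : Tendsto u atTop l) :
    Tendsto (fun q => u q.1) (whp μ) l := h.comp tendsto_fst_whp

theorem whp_of_ae {P : ∀ n, Ω n → Prop} (h : ∀ n, ∀ᵐ ω ∂μ n, P n ω) :
    ∀ᶠ q in whp μ, P q.1 q.2 :=
  eventually_whp.2 (tendsto_const_nhds.congr fun n => (ae_iff.1 (h n)).symm)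

theorem isLittleOP_iff {Z : ∀ n, Ω n → ℝ} :
    IsLittleOP μ Z ↔ Tendsto (fun q => Z q.1 q.2) (whp μ) (𝓝 0) := by
  have key : ∀ ε : ℝ, Tendsto (fun n => μ n {ω | ε < |Z n ω|}) atTop (𝓝 0) ↔
      ∀ᶠ q in whp μ, |Z q.1 q.2| ≤ ε := fun ε => by
    rw [eventually_whp (P := fun n ω => |Z n ω| ≤ ε)]
    simp only [not_le]
  constructor
  · intro h
    rw [Metric.tendsto_nhds]
    intro ε hε
    filter_upwards [(key (ε / 2)).1 (h (ε / 2) (by positivity))] with q hq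
    rw [Real.dist_eq, sub_zero]
    linarith
  · intro h ε hε
    rw [key]
    filter_upwards [Metric.tendsto_nhds.1 h ε hε] with q hq
    rw [Real.dist_eq, sub_zero] at hq
    exact hq.le

/-- A vanishing array times an array with a fixed law vanishes. -/
theorem tendsto_mul_of_hasLaw {ν : Measure ℝ} [IsProbabilityMeasure ν] {N Z : ∀ n, Ω n → ℝ}
    (hN : ∀ n, 1 ≤ n → HasLaw (N n) ν (μ n))
    (hZ : Tendsto (fun q => Z q.1 q.2) (whp μ) (𝓝 0)) :
    Tendsto (fun q => Z q.1 q.2 * N q.1 q.2) (whp μ) (𝓝 0) := by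
  rw [← isLittleOP_iff (Z := fun n ω => Z n ω * N n ω)]
  rw [← isLittleOP_iff] at hZ
  intro ε hε
  -- the tails of a fixed law are small
  have htail : Tendsto (fun k : ℕ => ν {x | (k : ℝ) < |x|}) atTop (𝓝 0) := by
    have hanti : Antitone fun k : ℕ => {x : ℝ | (k : ℝ) < |x|} := fun a b hab x hx => by
      have h1 : (b : ℝ) < |x| := hx
      have h2 : (a : ℝ) ≤ b := by exact_mod_cast hab
      exact h2.trans_lt h1
    have h := tendsto_measure_iInter_atTop (μ := ν)
      (fun k => (measurableSet_lt measurable_const (by fun_prop)).nullMeasurableSet) hanti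
      ⟨0, measure_ne_top _ _⟩
    have he : ⋂ k : ℕ, {x : ℝ | (k : ℝ) < |x|} = ∅ := by
      ext x
      obtain ⟨k, hk⟩ := exists_nat_ge |x|
      simp only [Set.mem_iInter, Set.mem_ofPred_eq, Set.mem_empty_iff_false, iff_false, not_forall]
      exact ⟨k, not_lt.2 hk⟩
    rwa [he, measure_empty] at h
  rw [ENNReal.tendsto_atTop_zero]
  intro η hη
  have hη2 : 0 < η / 2 := ENNReal.half_pos hη.ne'
  obtain ⟨k, hk⟩ := ENNReal.tendsto_atTop_zero.1 htail (η / 2) hη2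
  have hk' := hk (k + 1) (by omega)
  obtain ⟨n₀, hn₀⟩ := ENNReal.tendsto_atTop_zero.1 (hZ (ε / ((k + 1 : ℕ) : ℝ)) (by positivity))
    (η / 2) hη2
  refine ⟨max n₀ 1, fun n hn => ?_⟩
  have h1 := hn₀ n (le_trans (le_max_left _ _) hn)
  have h2 : μ n {ω | ((k + 1 : ℕ) : ℝ) < |N n ω|} ≤ η / 2 := by
    rw [(hN n (le_trans (le_max_right _ _) hn)).measure_eq (p := fun x => ((k + 1 : ℕ) : ℝ) < |x|)
      (measurableSet_lt measurable_const (by fun_prop))]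
    exact hk'
  calc μ n {ω | ε < |Z n ω * N n ω|}
      ≤ μ n ({ω | ε / ((k + 1 : ℕ) : ℝ) < |Z n ω|} ∪ {ω | ((k + 1 : ℕ) : ℝ) < |N n ω|}) := by
        refine measure_mono fun ω hω => ?_
        by_contra hcon
        simp only [Set.mem_union, Set.mem_ofPred_eq, not_or, not_lt] at hcon hω
        rw [abs_mul] at hω
        have := mul_le_mul hcon.1 hcon.2 (abs_nonneg _) (by positivity)
        rw [div_mul_cancel₀ _ (by positivity)] at this
        linarith
    _ ≤ η / 2 + η / 2 := (measure_union_le _ _).trans (add_le_add h1 h2)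
    _ = η := ENNReal.add_halves η

/-- Transfer of an event from the law of a random vector. -/
theorem whp_of_hasLaw {E : ℕ → Type*} [∀ n, MeasurableSpace (E n)] {ν : ∀ n, Measure (E n)}
    {G : ∀ n, Ω n → E n} (hG : ∀ n, HasLaw (G n) (ν n) (μ n)) {P : ∀ n, E n → Prop}
    (hP : ∀ n, MeasurableSet {g | ¬ P n g})
    (h : Tendsto (fun n => ν n {g | ¬ P n g}) atTop (𝓝 0)) :
    ∀ᶠ q in whp μ, P q.1 (G q.1 q.2) := by
  refine (eventually_whp (P := fun n ω => P n (G n ω))).2 (h.congr fun n => ?_)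
  exact ((hG n).measure_eq (p := fun g => ¬ P n g) (hP n)).symm

end whp

/-! ### Quantiles -/

section quantile

variable (ν : Measure ℝ) {q t : ℝ}

theorem bddBelow_quantile_set (hq : 0 < q) : BddBelow {t | q ≤ cdf ν t} := by
  obtain ⟨b, hb⟩ := ((tendsto_cdf_atBot ν).eventually (gt_mem_nhds hq)).exists
  refine ⟨b, fun t ht => ?_⟩
  by_contra hlt
  push Not at hlt
  exact absurd (ht.trans (monotone_cdf ν hlt.le)) (not_le.2 hb)

theorem quantile_le (hq : 0 < q) (h : q ≤ cdf ν t) : quantile ν q ≤ t :=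
  csInf_le (bddBelow_quantile_set ν hq) h

theorem le_cdf_quantile (hq1 : q < 1) : q ≤ cdf ν (quantile ν q) := by
  have hne : {t | q ≤ cdf ν t}.Nonempty := by
    obtain ⟨b, hb⟩ := ((tendsto_cdf_atTop ν).eventually (lt_mem_nhds hq1)).exists
    exact ⟨b, hb.le⟩
  have hcont : ContinuousWithinAt (cdf ν) (Set.Ioi (quantile ν q)) (quantile ν q) :=
    ((cdf ν).right_continuous _).mono Set.Ioi_subset_Ici_self
  refine ge_of_tendsto hcont ?_
  filter_upwards [self_mem_nhdsWithin] with t ht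
  obtain ⟨u, hu, hut⟩ := exists_lt_of_csInf_lt hne ht
  exact le_trans hu (monotone_cdf ν hut.le)

theorem measure_Ioi_le_iff [IsProbabilityMeasure ν] {γ : ℝ} (hγ : 0 ≤ γ) :
    ν (Set.Ioi t) ≤ ENNReal.ofReal γ ↔ 1 - γ ≤ cdf ν t := by
  rw [← Set.compl_Iic, prob_compl_eq_one_sub measurableSet_Iic, ← ofReal_cdf, tsub_le_iff_right,
    ← ENNReal.ofReal_add hγ (cdf_nonneg _ _), ENNReal.one_le_ofReal]
  constructor <;> intro h <;> linarith

end quantile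

/-! ### Gaussian vectors -/

theorem gaussian_tail {t : ℝ} (ht : 0 ≤ t) :
    gaussianReal 0 1 (Set.Ioi t) ≤ ENNReal.ofReal (Real.exp (-t ^ 2 / 2)) := by
  have h := measure_ge_le_exp_mul_mgf (μ := gaussianReal 0 1) (X := id) t ht
    (by simpa using integrable_exp_mul_gaussianReal (μ := 0) (v := 1) t)
  rw [mgf_id_gaussianReal, ← Real.exp_add] at h
  calc gaussianReal 0 1 (Set.Ioi t) ≤ gaussianReal 0 1 {x | t ≤ id x} :=
        measure_mono fun x hx => by
          have h1 : t < x := hx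
          exact h1.le
    _ = ENNReal.ofReal ((gaussianReal 0 1).real {x | t ≤ id x}) := by
        rw [ofReal_measureReal]
    _ ≤ _ := ENNReal.ofReal_le_ofReal (h.trans (le_of_eq ?_))
  congr 1
  push_cast
  ring

theorem gaussian_abs_tail (t : ℝ) :
    gaussianReal 0 1 {x | t < |x|} ≤ 2 * gaussianReal 0 1 (Set.Ioi t) := by
  have h1 : {x : ℝ | t < |x|} ⊆ Set.Ioi t ∪ (fun x => -x) ⁻¹' Set.Ioi t := by
    intro x hx
    have hx' : t < |x| := hx
    rcases lt_abs.1 hx' with h | h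
    · exact Or.inl h
    · exact Or.inr h
  have h2 : gaussianReal 0 1 ((fun x => -x) ⁻¹' Set.Ioi t) = gaussianReal 0 1 (Set.Ioi t) := by
    rw [← Measure.map_apply (by fun_prop) measurableSet_Ioi, gaussianReal_map_neg, neg_zero]
  calc _ ≤ _ := measure_mono h1
    _ ≤ _ := measure_union_le _ _
    _ = _ := by rw [h2, two_mul]

instance (n : ℕ) : IsProbabilityMeasure (stdGaussian n) := by unfold stdGaussian; infer_instance

theorem hasLaw_eval_stdGaussian (n : ℕ) (i : Fin n) :
    HasLaw (fun g : Fin n → ℝ => g i) (gaussianReal 0 1) (stdGaussian n) :=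
  (measurePreserving_eval (fun _ : Fin n => gaussianReal 0 1) i).hasLaw

theorem iIndepFun_eval_stdGaussian (n : ℕ) :
    iIndepFun (fun i (g : Fin n → ℝ) => g i) (stdGaussian n) :=
  iIndepFun_pi (X := fun _ => id) fun _ => aemeasurable_id

/-- A linear combination of independent standard normal variables is normal. -/
theorem hasLaw_linear_stdGaussian {n : ℕ} (a : Fin n → ℝ) {c : ℝ≥0}
    (hc : (c : ℝ) = ∑ i, a i ^ 2) :
    HasLaw (fun g : Fin n → ℝ => ∑ i, a i * g i) (gaussianReal 0 c) (stdGaussian n) := by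
  refine ⟨(Finset.measurable_sum _ fun i _ => by fun_prop).aemeasurable, ?_⟩
  have hX : ∀ i, HasLaw (fun g : Fin n → ℝ => a i * g i)
      (gaussianReal (a i * 0) (.mk (a i ^ 2) (sq_nonneg _) * 1)) (stdGaussian n) :=
    fun i => gaussianReal_const_mul (hasLaw_eval_stdGaussian n i) (a i)
  have hind : iIndepFun (fun i (g : Fin n → ℝ) => a i * g i) (stdGaussian n) :=
    (iIndepFun_eval_stdGaussian n).comp (fun i x => a i * x) fun i => by fun_prop
  apply Measure.ext_of_charFun
  have hsum : (fun g : Fin n → ℝ => ∑ i, a i * g i) = ∑ i, fun g : Fin n → ℝ => a i * g i := by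
    ext g; simp
  rw [hsum, hind.charFun_map_sum_eq_prod fun i => (hX i).aemeasurable]
  ext t
  rw [Finset.prod_apply]
  simp_rw [fun i => (hX i).map_eq, charFun_gaussianReal]
  rw [← Complex.exp_sum]
  congr 1
  have hc' : (c : ℂ) = ∑ i, (a i : ℂ) ^ 2 := by exact_mod_cast congrArg (fun x : ℝ => (x : ℂ)) hc
  simp [hc', Finset.sum_mul, Finset.sum_div]

theorem En_smul_left {n : ℕ} (c : ℝ) (f : Fin n → ℝ) : (En fun i => c * f i) = c * En f := by
  rw [En, En, ← Finset.mul_sum, mul_div_assoc]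

/-- A normalized regressor has a standard normal score. -/
theorem hasLaw_score {n : ℕ} (hn : 1 ≤ n) (a : Fin n → ℝ) (ha : (En fun i => a i ^ 2) = 1) :
    HasLaw (fun g : Fin n → ℝ => √n * En fun i => a i * g i) (gaussianReal 0 1)
      (stdGaussian n) := by
  have hn0 : (0 : ℝ) < n := by exact_mod_cast hn
  have h := hasLaw_linear_stdGaussian (fun i => a i / √n) (c := 1) (by
    simp only [div_pow, Real.sq_sqrt hn0.le, ← Finset.sum_div]
    exact ha.symm)
  refine h.congr (ae_of_all _ fun g => ?_)
  simp only [En, Finset.sum_div, Finset.mul_sum]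
  refine Finset.sum_congr rfl fun i _ => ?_
  have : √(n : ℝ) ≠ 0 := (Real.sqrt_pos.2 hn0).ne'
  have h2 : (n : ℝ) = √n * √n := (Real.mul_self_sqrt hn0.le).symm
  generalize √(n : ℝ) = w at *
  rw [h2]
  field_simp

theorem measurable_maxScore {n p : ℕ} (x : Fin n → Fin p → ℝ) : Measurable (maxScore x) := by
  unfold maxScore En
  fun_prop

theorem lt_maxScore_iff {n p : ℕ} (x : Fin n → Fin p → ℝ) (hn : 1 ≤ n) (g : Fin n → ℝ) {t : ℝ}
    (ht : 0 ≤ t) : √n * t < maxScore x g ↔ ∃ j, t < |√n * En fun i => x i j * g i| := by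
  have hn0 : (0 : ℝ) < √n := Real.sqrt_pos.2 (by exact_mod_cast hn)
  have h2 : (n : ℝ) = √n * √n := (Real.mul_self_sqrt (Nat.cast_nonneg n)).symm
  have h1 : √n * t < maxScore x g ↔ t / √n < ‖fun j => En fun i => x i j * g i‖ := by
    unfold maxScore
    nth_rewrite 2 [h2]
    rw [mul_assoc, mul_lt_mul_iff_right₀ hn0, div_lt_iff₀ hn0, mul_comm]
  rw [h1, ← not_iff_not, not_lt, pi_norm_le_iff_of_nonneg (by positivity)]
  push Not
  refine forall_congr' fun j => ?_
  rw [abs_mul, abs_of_pos hn0, le_div_iff₀ hn0, Real.norm_eq_abs, mul_comm]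

/-- Union bound for the maximal score. -/
theorem stdGaussian_maxScore_le {n p : ℕ} (hn : 1 ≤ n) (x : Fin n → Fin p → ℝ)
    (hx : ∀ j, (En fun i => x i j ^ 2) = 1) {t : ℝ} (ht : 0 ≤ t) :
    stdGaussian n {g | √n * t < maxScore x g} ≤ p * (2 * gaussianReal 0 1 (Set.Ioi t)) := by
  have h1 : {g | √n * t < maxScore x g} = ⋃ j, {g | t < |√n * En fun i => x i j * g i|} := by
    ext g; simp [lt_maxScore_iff x hn g ht]
  rw [h1]
  refine (measure_iUnion_fintype_le _ _).trans ?_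
  calc ∑ j : Fin p, stdGaussian n {g | t < |√n * En fun i => x i j * g i|}
      ≤ ∑ _j : Fin p, 2 * gaussianReal 0 1 (Set.Ioi t) := by
        refine Finset.sum_le_sum fun j _ => ?_
        rw [(hasLaw_score hn _ (hx j)).measure_eq (p := fun y => t < |y|)
          (measurableSet_lt measurable_const (by fun_prop))]
        exact gaussian_abs_tail t
    _ = _ := by simp

end

section

/-! ### The empirical second moment of the noise -/

theorem memLp_sq_gaussian : MemLp (fun x : ℝ => x ^ 2) 2 (gaussianReal 0 1) := by
  rw [memLp_two_iff_integrable_sq (by fun_prop)]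
  have h := (memLp_id_gaussianReal (μ := 0) (v := 1) 4).integrable_norm_pow (p := 4) (by norm_num)
  refine h.congr (ae_of_all _ fun x => ?_)
  simp only [id, Real.norm_eq_abs]
  rw [← abs_pow, abs_of_nonneg (by positivity)]
  ring

theorem integral_sq_gaussian : ∫ x : ℝ, x ^ 2 ∂gaussianReal 0 1 = 1 := by
  have h := variance_fun_id_gaussianReal (μ := 0) (v := 1)
  rw [variance_of_integral_eq_zero (by fun_prop) (by simp)] at h
  simpa using h

theorem measurable_En {n : ℕ} {E : Type*} [MeasurableSpace E] {f : Fin n → E → ℝ}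
    (hf : ∀ i, Measurable (f i)) : Measurable fun e => En fun i => f i e :=
  (Finset.measurable_sum _ fun i _ => hf i).div_const _

theorem iIndepFun_sq_stdGaussian (n : ℕ) :
    iIndepFun (fun i (g : Fin n → ℝ) => g i ^ 2) (stdGaussian n) :=
  (iIndepFun_eval_stdGaussian n).comp (fun _ x => x ^ 2) fun _ => by fun_prop

/-- Law of large numbers for the squares of standard normal variables. -/
theorem tendsto_En_sq {η : ℝ} (hη : 0 < η) :
    Tendsto (fun n => stdGaussian n {g | ¬ |(En fun i => g i ^ 2) - 1| ≤ η}) atTop (𝓝 0) := by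
  set V := Var[fun x : ℝ => x ^ 2; gaussianReal 0 1] with hV
  have hlim : Tendsto (fun n : ℕ => ENNReal.ofReal (V / η ^ 2 / n)) atTop (𝓝 0) := by
    rw [← ENNReal.ofReal_zero]
    exact ENNReal.tendsto_ofReal (tendsto_const_div_atTop_nhds_zero_nat _)
  refine tendsto_of_tendsto_of_tendsto_of_le_of_le' tendsto_const_nhds hlim
    (Eventually.of_forall fun _ => zero_le) ?_
  filter_upwards [eventually_ge_atTop 1] with n hn
  have hn0 : (0 : ℝ) < n := by exact_mod_cast hn
  have hmem : ∀ i : Fin n, MemLp (fun g : Fin n → ℝ => g i ^ 2) 2 (stdGaussian n) := fun i =>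
    memLp_sq_gaussian.comp_measurePreserving
      (measurePreserving_eval (fun _ : Fin n => gaussianReal 0 1) i)
  have hvar : ∀ i : Fin n, Var[fun g : Fin n → ℝ => g i ^ 2; stdGaussian n] = V := fun i =>
    HasLaw.variance_eq (X := fun g : Fin n → ℝ => g i ^ 2)
      (μ := (gaussianReal 0 1).map fun x => x ^ 2)
      (HasLaw.comp (Y := fun x : ℝ => x ^ 2) ⟨by fun_prop, rfl⟩ (hasLaw_eval_stdGaussian n i))
      |>.trans (by rw [variance_map (by fun_prop) (by fun_prop)]; rfl)
  have hint : ∀ i : Fin n, ∫ g, g i ^ 2 ∂stdGaussian n = 1 := fun i => by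
    rw [← integral_sq_gaussian]
    exact (hasLaw_eval_stdGaussian n i).integral_comp (f := fun x => x ^ 2) (by fun_prop)
  have hsum : MemLp (∑ i, fun g : Fin n → ℝ => g i ^ 2) 2 (stdGaussian n) :=
    memLp_finsetSum' _ fun i _ => hmem i
  have hmean : ∫ g, (∑ i, fun g : Fin n → ℝ => g i ^ 2) g ∂stdGaussian n = n := by
    simp only [Finset.sum_apply]
    rw [integral_finsetSum _ fun i _ => (hmem i).integrable (by norm_num)]
    simp [hint]
  have hV' : Var[∑ i, fun g : Fin n → ℝ => g i ^ 2; stdGaussian n] = n * V := by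
    rw [IndepFun.variance_sum (fun i _ => hmem i)
      fun i _ j _ hij => (iIndepFun_sq_stdGaussian n).indepFun hij]
    simp [hvar]
  have h := meas_ge_le_variance_div_sq hsum (c := n * η) (by positivity)
  rw [hV', hmean] at h
  refine (measure_mono fun g hg => ?_).trans (h.trans (le_of_eq ?_))
  · have hg' : ¬ |(En fun i => g i ^ 2) - 1| ≤ η := hg
    show n * η ≤ |(∑ i, fun g : Fin n → ℝ => g i ^ 2) g - n|
    have : (∑ i, fun g : Fin n → ℝ => g i ^ 2) g - n = n * ((En fun i => g i ^ 2) - 1) := by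
      simp only [Finset.sum_apply, En]
      field_simp
    rw [this, abs_mul, abs_of_pos hn0]
    push Not at hg'
    gcongr
  · congr 1
    field_simp

/-- The empirical second moment is bounded away from zero up to an exponentially small
probability, by the Chernoff bound: `a` is half the negative logarithm of `𝔼 exp (-g²)`. -/
theorem exists_En_sq_lower_tail : ∃ a : ℝ, 0 < a ∧ ∀ n,
    stdGaussian n {g | (En fun i => g i ^ 2) < a} ≤ ENNReal.ofReal (Real.exp (-(a * n))) := by
  set ρ := ∫ x : ℝ, Real.exp (-1 * x ^ 2) ∂gaussianReal 0 1 with hρ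
  have hle1 : ∀ x : ℝ, Real.exp (-1 * x ^ 2) ≤ 1 := fun x =>
    Real.exp_le_one_iff.2 (by nlinarith [sq_nonneg x])
  have hint : Integrable (fun x : ℝ => Real.exp (-1 * x ^ 2)) (gaussianReal 0 1) :=
    Integrable.of_bound (by fun_prop) 1 (ae_of_all _ fun x => by
      rw [Real.norm_eq_abs, abs_of_pos (Real.exp_pos _)]; exact hle1 x)
  have hρ0 : 0 < ρ := integral_exp_pos hint
  have hρ1 : ρ < 1 := by
    have h1 : 0 < ∫ x : ℝ, (1 - Real.exp (-1 * x ^ 2)) ∂gaussianReal 0 1 := by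
      rw [integral_pos_iff_support_of_nonneg (fun x => sub_nonneg.2 (hle1 x))
        ((integrable_const 1).sub hint)]
      have hsupp : Function.support (fun x : ℝ => 1 - Real.exp (-1 * x ^ 2)) = {0}ᶜ := by
        ext x
        simp [sub_eq_zero, eq_comm (a := (1 : ℝ))]
      have := nullSingletonClass_gaussianReal (μ := 0) (v := 1) one_ne_zero
      rw [hsupp, prob_compl_eq_one_sub (measurableSet_singleton 0), measure_singleton]
      simp
    rw [integral_sub (integrable_const 1) hint] at h1
    simp only [integral_const, probReal_univ, smul_eq_mul, mul_one] at h1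
    linarith
  have hlog : Real.log ρ < 0 := Real.log_neg hρ0 hρ1
  refine ⟨-Real.log ρ / 2, by linarith, fun n => ?_⟩
  set a := -Real.log ρ / 2 with ha
  have hmgf : mgf (∑ i, fun g : Fin n → ℝ => g i ^ 2) (stdGaussian n) (-1) = ρ ^ n := by
    rw [(iIndepFun_sq_stdGaussian n).mgf_sum (fun i => by fun_prop)]
    have : ∀ i : Fin n, mgf (fun g : Fin n → ℝ => g i ^ 2) (stdGaussian n) (-1) = ρ := fun i =>
      (hasLaw_eval_stdGaussian n i).integral_comp (f := fun x => Real.exp (-1 * x ^ 2))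
        (by fun_prop)
    simp [this]
  have h := measure_le_le_exp_mul_mgf (μ := stdGaussian n)
    (X := ∑ i, fun g : Fin n → ℝ => g i ^ 2) (t := -1) (n * a) (by norm_num) (by
      refine Integrable.of_bound (C := 1) ?_ (ae_of_all _ fun g => ?_)
      · have : Measurable (∑ i, fun g : Fin n → ℝ => g i ^ 2) := by
          rw [show (∑ i, fun g : Fin n → ℝ => g i ^ 2) = fun g => ∑ i, g i ^ 2 by ext; simp]
          exact Finset.measurable_sum _ fun i _ => by fun_prop
        fun_prop
      · rw [Real.norm_eq_abs, abs_of_pos (Real.exp_pos _), Real.exp_le_one_iff]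
        have : 0 ≤ (∑ i, fun g : Fin n → ℝ => g i ^ 2) g := by
          simp only [Finset.sum_apply]; positivity
        linarith)
  rw [hmgf] at h
  calc stdGaussian n {g | (En fun i => g i ^ 2) < a}
      ≤ stdGaussian n {g | (∑ i, fun g : Fin n → ℝ => g i ^ 2) g ≤ n * a} := by
        refine measure_mono fun g hg => ?_
        have hg' : (En fun i => g i ^ 2) < a := hg
        show (∑ i, fun g : Fin n → ℝ => g i ^ 2) g ≤ n * a
        simp only [Finset.sum_apply]
        rcases Nat.eq_zero_or_pos n with rfl | hn
        · simp
        · have hn0 : (0 : ℝ) < n := by exact_mod_cast hn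
          unfold En at hg'
          rw [div_lt_iff₀ hn0] at hg'
          linarith
    _ = ENNReal.ofReal ((stdGaussian n).real {g | (∑ i, fun g : Fin n → ℝ => g i ^ 2) g ≤ n * a}) := by
        rw [ofReal_measureReal]
    _ ≤ ENNReal.ofReal (Real.exp (-(a * n))) := by
        refine ENNReal.ofReal_le_ofReal (h.trans (le_of_eq ?_))
        have : ρ ^ n = Real.exp (n * Real.log ρ) := by
          rw [Real.exp_nat_mul, Real.exp_log hρ0]
        rw [this, ← Real.exp_add]
        congr 1
        rw [ha]; ring

/-! ### Exact normality of the self-normalized score -/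

/-- Conditionally on its first factor, the self-normalized inner product of two independent
standard normal vectors is standard normal; hence so it is unconditionally. -/
theorem hasLaw_selfNormalized {n : ℕ} (hn : 1 ≤ n) :
    HasLaw (fun q : (Fin n → ℝ) × (Fin n → ℝ) => (∑ i, q.1 i * q.2 i) / √(∑ i, q.1 i ^ 2))
      (gaussianReal 0 1) ((stdGaussian n).prod (stdGaussian n)) := by
  have hmeas : Measurable fun q : (Fin n → ℝ) × (Fin n → ℝ) =>
      (∑ i, q.1 i * q.2 i) / √(∑ i, q.1 i ^ 2) :=
    (Finset.measurable_sum _ fun i _ => by fun_prop).div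
      (Finset.measurable_sum _ fun i _ => by fun_prop).sqrt
  refine ⟨hmeas.aemeasurable, Measure.ext fun s hs => ?_⟩
  rw [Measure.map_apply hmeas hs, Measure.prod_apply (hmeas hs)]
  have hae : ∀ᵐ x ∂stdGaussian n, stdGaussian n (Prod.mk x ⁻¹'
      ((fun q : (Fin n → ℝ) × (Fin n → ℝ) =>
        (∑ i, q.1 i * q.2 i) / √(∑ i, q.1 i ^ 2)) ⁻¹' s)) = gaussianReal 0 1 s := by
    have hne : ∀ᵐ x ∂stdGaussian n, x ⟨0, hn⟩ ≠ 0 := by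
      have := nullSingletonClass_gaussianReal (μ := 0) (v := 1) one_ne_zero
      refine ((hasLaw_eval_stdGaussian n ⟨0, hn⟩).ae_iff (p := fun y => y ≠ 0) ?_).2 ?_
      · exact measurable_to_prop (by
          have : (fun y : ℝ => y ≠ 0) ⁻¹' {True} = {0}ᶜ := by ext; simp
          rw [this]; exact (measurableSet_singleton 0).compl)
      · rw [ae_iff]; simp
    filter_upwards [hne] with x hx
    have hQ : 0 < ∑ i, x i ^ 2 :=
      Finset.sum_pos' (fun i _ => sq_nonneg _) ⟨⟨0, hn⟩, Finset.mem_univ _, by positivity⟩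
    have hl := hasLaw_linear_stdGaussian (fun i => x i / √(∑ i, x i ^ 2)) (c := 1) (by
      simp only [div_pow, Real.sq_sqrt hQ.le, ← Finset.sum_div]
      rw [div_self hQ.ne']; rfl)
    rw [← hl.map_eq, Measure.map_apply (Finset.measurable_sum _ fun i _ => by fun_prop) hs]
    congr 1
    ext g
    simp only [Set.mem_preimage, Finset.sum_div, div_mul_eq_mul_div]
  rw [lintegral_congr_ae hae]
  simp

theorem hasLaw_const_mul_gaussian (c : ℝ) (v w : ℝ≥0) (h : (w : ℝ) = c ^ 2 * v) :
    HasLaw (fun x : ℝ => c * x) (gaussianReal 0 w) (gaussianReal 0 v) := by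
  refine ⟨by fun_prop, ?_⟩
  rw [gaussianReal_map_const_mul, mul_zero]
  congr 1
  ext
  rw [h]; simp

theorem hasLaw_prod_map {E F E' F' : Type*} [MeasurableSpace E] [MeasurableSpace F]
    [MeasurableSpace E'] [MeasurableSpace F'] {μ : Measure E} {ν : Measure F} {μ' : Measure E'}
    {ν' : Measure F'} [SFinite μ] [SFinite ν] [SFinite μ'] [SFinite ν'] {f : E → E'} {g : F → F'}
    (hf : HasLaw f μ' μ) (hg : HasLaw g ν' ν) (hfm : Measurable f) (hgm : Measurable g) :
    HasLaw (fun q : E × F => (f q.1, g q.2)) (μ'.prod ν') (μ.prod ν) := by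
  refine ⟨by fun_prop, ?_⟩
  rw [← hf.map_eq, ← hg.map_eq, Measure.map_prod_map _ _ hfm hgm]
  rfl

namespace IsGaussianPLM

variable {Ω : Type*} [MeasurableSpace Ω] {μ : Measure Ω} {𝒵 : Type*} {n : ℕ}
  {z : Fin n → 𝒵} {m g : 𝒵 → ℝ} {α₀ : ℝ} {σζ σv : ℝ≥0} {ζ v y d : Fin n → Ω → ℝ}

/-- The standardized disturbances are two independent standard normal vectors. -/
theorem hasLaw_disturbances (h : IsGaussianPLM μ z m g α₀ σζ σv ζ v y d) (hζ : 0 < σζ)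
    (hv : 0 < σv) :
    HasLaw (fun ω => ((fun i => v i ω / σv), (fun i => ζ i ω / σζ)))
      ((stdGaussian n).prod (stdGaussian n)) μ := by
  have hζ' : (σζ : ℝ) ≠ 0 := by exact_mod_cast hζ.ne'
  have hv' : (σv : ℝ) ≠ 0 := by exact_mod_cast hv.ne'
  have h1 : ∀ i, HasLaw (fun ω => ((σv : ℝ)⁻¹ * v i ω, (σζ : ℝ)⁻¹ * ζ i ω))
      ((gaussianReal 0 1).prod (gaussianReal 0 1)) μ := fun i => by
    have e := hasLaw_prod_map
      (hasLaw_const_mul_gaussian (σζ : ℝ)⁻¹ (σζ ^ 2) 1 (by push_cast; field_simp))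
      (hasLaw_const_mul_gaussian (σv : ℝ)⁻¹ (σv ^ 2) 1 (by push_cast; field_simp))
      (by fun_prop) (by fun_prop)
    have e2 : HasLaw Prod.swap ((gaussianReal 0 1).prod (gaussianReal 0 1))
      ((gaussianReal 0 1).prod (gaussianReal 0 1)) := ⟨by fun_prop, Measure.prod_swap⟩
    exact e2.comp (e.comp (h.law i))
  have h2 : iIndepFun (fun i ω => ((σv : ℝ)⁻¹ * v i ω, (σζ : ℝ)⁻¹ * ζ i ω)) μ :=
    h.indep.comp (fun _ q => ((σv : ℝ)⁻¹ * q.2, (σζ : ℝ)⁻¹ * q.1)) fun _ => by fun_prop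
  have h3 := (measurePreserving_arrowProdEquivProdArrow ℝ ℝ (Fin n)
    (fun _ => gaussianReal 0 1) (fun _ => gaussianReal 0 1)).comp_hasLaw (h2.hasLaw_pi h1)
  refine h3.congr (ae_of_all _ fun ω => ?_)
  ext i <;> simp [MeasurableEquiv.arrowProdEquivProdArrow, Equiv.arrowProdEquivProdArrow,
    div_eq_inv_mul]

theorem hasLaw_v (h : IsGaussianPLM μ z m g α₀ σζ σv ζ v y d) (hζ : 0 < σζ) (hv : 0 < σv) :
    HasLaw (fun ω i => v i ω / σv) (stdGaussian n) μ :=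
  measurePreserving_fst.comp_hasLaw (h.hasLaw_disturbances hζ hv)

theorem hasLaw_ζ (h : IsGaussianPLM μ z m g α₀ σζ σv ζ v y d) (hζ : 0 < σζ) (hv : 0 < σv) :
    HasLaw (fun ω i => ζ i ω / σζ) (stdGaussian n) μ :=
  measurePreserving_snd.comp_hasLaw (h.hasLaw_disturbances hζ hv)

/-- The disturbance of the reduced form of the outcome equation. -/
theorem hasLaw_reducedForm (h : IsGaussianPLM μ z m g α₀ σζ σv ζ v y d) (hζ : 0 < σζ) :
    HasLaw (fun ω i => (α₀ * v i ω + ζ i ω) / √(α₀ ^ 2 * (σv : ℝ) ^ 2 + (σζ : ℝ) ^ 2))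
      (stdGaussian n) μ := by
  have hσ0 : 0 < α₀ ^ 2 * (σv : ℝ) ^ 2 + (σζ : ℝ) ^ 2 := by positivity
  set σ := √(α₀ ^ 2 * (σv : ℝ) ^ 2 + (σζ : ℝ) ^ 2) with hσ
  have hσpos : 0 < σ := Real.sqrt_pos.2 hσ0
  have hσ2 : σ ^ 2 = α₀ ^ 2 * (σv : ℝ) ^ 2 + (σζ : ℝ) ^ 2 := Real.sq_sqrt hσ0.le
  set w₁ : ℝ≥0 := .mk ((σ⁻¹) ^ 2 * (σζ : ℝ) ^ 2) (by positivity) with hw₁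
  set w₂ : ℝ≥0 := .mk ((α₀ / σ) ^ 2 * (σv : ℝ) ^ 2) (by positivity) with hw₂
  have hw : w₁ + w₂ = 1 := by
    ext
    simp only [hw₁, hw₂, NNReal.coe_add, NNReal.coe_mk, NNReal.coe_one]
    field_simp
    rw [hσ2]; ring
  have h1 : ∀ i, HasLaw (fun ω => σ⁻¹ * ζ i ω + α₀ / σ * v i ω) (gaussianReal 0 1) μ := fun i => by
    have e := hasLaw_prod_map
      (hasLaw_const_mul_gaussian σ⁻¹ (σζ ^ 2) w₁ (by simp [hw₁]))
      (hasLaw_const_mul_gaussian (α₀ / σ) (σv ^ 2) w₂ (by simp [hw₂]))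
      (by fun_prop) (by fun_prop)
    have e2 : HasLaw (fun q : ℝ × ℝ => q.1 + q.2) (gaussianReal 0 1)
        ((gaussianReal 0 w₁).prod (gaussianReal 0 w₂)) := by
      refine ⟨by fun_prop, ?_⟩
      have := gaussianReal_conv_gaussianReal (m₁ := 0) (m₂ := 0) (v₁ := w₁) (v₂ := w₂)
      rw [add_zero, hw] at this
      exact this
    exact e2.comp (e.comp (h.law i))
  have h2 : iIndepFun (fun i ω => σ⁻¹ * ζ i ω + α₀ / σ * v i ω) μ :=
    h.indep.comp (fun _ q => σ⁻¹ * q.1 + α₀ / σ * q.2) fun _ => by fun_prop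
  refine (h2.hasLaw_pi h1).congr (ae_of_all _ fun ω => ?_)
  ext i
  field_simp
  ring

end IsGaussianPLM

end

section

/-! ### Penalty levels -/

/-- `log (p ∨ n)`. -/
noncomputable def logDim (p n : ℕ) : ℝ := Real.log (max (p : ℝ) n)

/-- `Λ` dominates the maximal score of standard normal noise, up to a factor arbitrarily close to
one and with probability tending to one, and has the order `√(n log (p ∨ n))`. -/
structure IsScoreBound {p : ℕ → ℕ} (x : ∀ n, Fin n → Fin (p n) → ℝ) (Λ : ℕ → ℝ) : Prop where
  exceed : ∀ η : ℝ, 0 < η →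
    Tendsto (fun n => stdGaussian n {g | (1 + η) * Λ n < maxScore (x n) g}) atTop (𝓝 0)
  upper : ∃ C : ℝ, ∀ᶠ n in atTop, Λ n ≤ C * √(n * logDim (p n) n)

theorem tendsto_logDim {p : ℕ → ℕ} : Tendsto (fun n => logDim (p n) n) atTop atTop :=
  Real.tendsto_log_atTop.comp
    (tendsto_atTop_mono (fun n => le_max_right (p n : ℝ) n) tendsto_natCast_atTop_atTop)

theorem maxScore_nonneg {n p : ℕ} (x : Fin n → Fin p → ℝ) (g : Fin n → ℝ) : 0 ≤ maxScore x g := by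
  unfold maxScore; positivity

/-- A score bound is at least of the order `√n`: the maximal score exceeds the absolute value of
a single normal variable. -/
theorem IsScoreBound.lower {p : ℕ → ℕ} {x : ∀ n, Fin n → Fin (p n) → ℝ} {Λ : ℕ → ℝ}
    (h : IsScoreBound x Λ) (hp : Tendsto p atTop atTop)
    (hx : ∀ n, 1 ≤ n → ∀ j, (En fun i => x n i j ^ 2) = 1) :
    ∀ᶠ n : ℕ in atTop, √(n : ℝ) ≤ 2 * Λ n := by
  have hpos : 0 < gaussianReal 0 1 {y | 1 < |y|} := by
    rw [pos_iff_ne_zero]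
    intro h0
    have h1 := gaussianReal_absolutelyContinuous' 0 (v := 1) one_ne_zero h0
    have h2 : volume (Set.Ioi (1 : ℝ)) ≤ volume {y : ℝ | 1 < |y|} :=
      measure_mono fun y hy => by
        have hy' : 1 < y := hy
        exact hy'.trans_le (le_abs_self y)
    rw [h1, Real.volume_Ioi] at h2
    simp at h2
  filter_upwards [(h.exceed 1 one_pos).eventually (gt_mem_nhds hpos), hp.eventually_ge_atTop 1,
    eventually_ge_atTop 1] with n hn hpn hn1
  by_contra hlt
  push Not at hlt
  refine absurd hn (not_lt.2 ?_)
  rw [← (hasLaw_score hn1 _ (hx n hn1 ⟨0, hpn⟩)).measure_eq (p := fun y => 1 < |y|)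
    (measurableSet_lt measurable_const (by fun_prop))]
  refine measure_mono fun g hg => ?_
  have h1 := (lt_maxScore_iff (x n) hn1 g zero_le_one).2 ⟨_, hg⟩
  show (1 + 1) * Λ n < maxScore (x n) g
  linarith

theorem tendsto_maxScore_of_le {p : ℕ → ℕ} {x : ∀ n, Fin n → Fin (p n) → ℝ} {Λ γ : ℕ → ℝ}
    (hγ : Tendsto γ atTop (𝓝 0))
    (h : ∀ᶠ n in atTop, stdGaussian n {g | Λ n < maxScore (x n) g} ≤ ENNReal.ofReal (γ n))
    {η : ℝ} (hη : 0 < η) :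
    Tendsto (fun n => stdGaussian n {g | (1 + η) * Λ n < maxScore (x n) g}) atTop (𝓝 0) := by
  have hlim : Tendsto (fun n => ENNReal.ofReal (γ n)) atTop (𝓝 0) := by
    rw [← ENNReal.ofReal_zero]; exact ENNReal.tendsto_ofReal hγ
  refine tendsto_of_tendsto_of_tendsto_of_le_of_le' tendsto_const_nhds hlim
    (Eventually.of_forall fun _ => zero_le) ?_
  filter_upwards [h] with n hn
  refine (measure_mono fun g hg => ?_).trans hn
  have hg' : (1 + η) * Λ n < maxScore (x n) g := hg
  show Λ n < maxScore (x n) g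
  have := maxScore_nonneg (x n) g
  by_contra hcon
  push Not at hcon
  nlinarith

section

variable {p : ℕ → ℕ} {x : ∀ n, Fin n → Fin (p n) → ℝ} {γ : ℕ → ℝ}

theorem exists_log_le (hp : Tendsto p atTop atTop) (hγ : ∀ n, 0 < γ n ∧ γ n < 1)
    (hO : (fun n => Real.log (1 / γ n)) =O[atTop] fun n => Real.log (max (p n : ℝ) n)) :
    ∃ C : ℝ, 0 < C ∧ ∀ᶠ n in atTop, 2 * Real.log (4 * p n / γ n) ≤ C * logDim (p n) n := by
  obtain ⟨C, hC, hO⟩ := hO.exists_pos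
  refine ⟨2 * (Real.log 4 + 1 + C), by positivity, ?_⟩
  filter_upwards [hO.bound, hp.eventually_ge_atTop 1,
    (tendsto_logDim (p := p)).eventually_ge_atTop 1] with n hn hpn hL
  have hp0 : (0 : ℝ) < p n := by exact_mod_cast hpn
  have h1 : Real.log (4 * p n / γ n) = Real.log 4 + Real.log (p n) + Real.log (1 / γ n) := by
    rw [mul_div_assoc, Real.log_mul (by norm_num) (div_pos hp0 (hγ n).1).ne',
      div_eq_mul_one_div, Real.log_mul hp0.ne' (one_div_pos.2 (hγ n).1).ne', add_assoc]
  have h2 : Real.log (p n) ≤ logDim (p n) n := Real.log_le_log hp0 (le_max_left _ _)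
  have h3 : Real.log (1 / γ n) ≤ C * logDim (p n) n := by
    refine (le_abs_self _).trans (hn.trans (le_of_eq ?_))
    rw [Real.norm_eq_abs]
    show C * |logDim (p n) n| = _
    rw [abs_of_nonneg (by linarith)]
  have h4 : Real.log 4 ≤ Real.log 4 * logDim (p n) n :=
    le_mul_of_one_le_right (Real.log_nonneg (by norm_num)) hL
  rw [h1]
  linarith

/-- The Gaussian tail beyond `√(2 log (q / r))` is at most `r / q`. -/
theorem gaussian_tail_log {q r : ℝ} (hr : 0 < r) (hq : r ≤ q) :
    gaussianReal 0 1 (Set.Ioi √(2 * Real.log (q / r))) ≤ ENNReal.ofReal (r / q) := by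
  have hq0 : 0 < q := hr.trans_le hq
  have hl : 0 ≤ Real.log (q / r) := Real.log_nonneg ((one_le_div hr).2 hq)
  refine (gaussian_tail (Real.sqrt_nonneg _)).trans (le_of_eq ?_)
  rw [Real.sq_sqrt (by positivity), neg_div, mul_div_cancel_left₀ _ two_ne_zero, Real.exp_neg,
    Real.exp_log (div_pos hq0 hr), inv_div]

theorem stdGaussian_maxScore_log_le {n P : ℕ} (hn : 1 ≤ n) (hP : 1 ≤ P) {x : Fin n → Fin P → ℝ}
    (hx : ∀ j, (En fun i => x i j ^ 2) = 1) {r : ℝ} (hr : 0 < r) (hr1 : r < 1) :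
    stdGaussian n {g | √n * √(2 * Real.log (2 * P / r)) < maxScore x g} ≤ ENNReal.ofReal r := by
  have hP0 : (1 : ℝ) ≤ P := by exact_mod_cast hP
  refine (stdGaussian_maxScore_le hn x hx (Real.sqrt_nonneg _)).trans ?_
  calc (P : ℝ≥0∞) * (2 * gaussianReal 0 1 (Set.Ioi √(2 * Real.log (2 * P / r))))
      ≤ P * (2 * ENNReal.ofReal (r / (2 * P))) := by
        gcongr
        exact gaussian_tail_log hr (by linarith)
    _ = ENNReal.ofReal r := by
        rw [← ENNReal.ofReal_natCast, ← ENNReal.ofReal_ofNat 2, ← ENNReal.ofReal_mul (by norm_num),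
          ← ENNReal.ofReal_mul (by positivity)]
        congr 1
        field_simp

theorem sqrt_mul_sqrt_log_le {n P : ℕ} {C r : ℝ} (hC : 0 ≤ C)
    (h : 2 * Real.log r ≤ C * logDim P n) :
    √(n : ℝ) * √(2 * Real.log r) ≤ √C * √(n * logDim P n) := by
  rw [← Real.sqrt_mul (by positivity), ← Real.sqrt_mul hC]
  apply Real.sqrt_le_sqrt
  have : (0 : ℝ) ≤ n := Nat.cast_nonneg n
  nlinarith

theorem log_two_le {P : ℕ} (hP : 1 ≤ P) {r : ℝ} (hr : 0 < r) :
    Real.log (2 * P / r) ≤ Real.log (4 * P / r) := by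
  have : (1 : ℝ) ≤ P := by exact_mod_cast hP
  apply Real.log_le_log (by positivity)
  gcongr
  norm_num

/-- The design-independent penalty level. -/
theorem isScoreBound_indepBound (hp : Tendsto p atTop atTop)
    (hx : ∀ n, 1 ≤ n → ∀ j, (En fun i => x n i j ^ 2) = 1) (hγ : ∀ n, 0 < γ n ∧ γ n < 1)
    (hγ0 : Tendsto γ atTop (𝓝 0))
    (hO : (fun n => Real.log (1 / γ n)) =O[atTop] fun n => Real.log (max (p n : ℝ) n)) :
    IsScoreBound x fun n => indepBound n (p n) (γ n) := by
  refine ⟨fun η hη => tendsto_maxScore_of_le hγ0 ?_ hη, ?_⟩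
  · filter_upwards [eventually_ge_atTop 1, hp.eventually_ge_atTop 1] with n hn hpn
    have hp0 : (1 : ℝ) ≤ p n := by exact_mod_cast hpn
    have hr : 0 < γ n / (2 * p n) := div_pos (hγ n).1 (by positivity)
    have htail := (measure_Ioi_le_iff (gaussianReal 0 1) hr.le).2
      (le_cdf_quantile (gaussianReal 0 1) (q := 1 - γ n / (2 * p n)) (by linarith))
    set t := quantile (gaussianReal 0 1) (1 - γ n / (2 * p n)) with ht
    -- the quantile is nonnegative because `1 - γ/(2p) > 1/2`
    have ht0 : 0 ≤ t := by
      by_contra hneg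
      push Not at hneg
      have h1 := gaussian_abs_tail t
      have h2 : {y : ℝ | t < |y|} = Set.univ := by
        ext y; simpa using hneg.trans_le (abs_nonneg y)
      rw [h2, measure_univ] at h1
      have h3 : (1 : ℝ≥0∞) ≤ ENNReal.ofReal (2 * (γ n / (2 * p n))) := by
        rw [ENNReal.ofReal_mul (by norm_num), ENNReal.ofReal_ofNat]
        exact h1.trans (by gcongr)
      rw [ENNReal.one_le_ofReal, mul_div_assoc', mul_div_mul_left _ _ two_ne_zero,
        le_div_iff₀ (by linarith)] at h3
      linarith [(hγ n).2]
    calc stdGaussian n {g | √n * t < maxScore (x n) g}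
        ≤ p n * (2 * gaussianReal 0 1 (Set.Ioi t)) := stdGaussian_maxScore_le hn (x n) (hx n hn) ht0
      _ ≤ p n * (2 * ENNReal.ofReal (γ n / (2 * p n))) := by gcongr
      _ = ENNReal.ofReal (γ n) := by
          rw [← ENNReal.ofReal_natCast, ← ENNReal.ofReal_ofNat 2,
            ← ENNReal.ofReal_mul (by norm_num), ← ENNReal.ofReal_mul (by positivity)]
          congr 1
          field_simp
  · obtain ⟨C, hC, hlog⟩ := exists_log_le hp hγ hO
    refine ⟨√C, ?_⟩
    filter_upwards [hlog, hp.eventually_ge_atTop 1] with n hn hpn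
    have hp0 : (1 : ℝ) ≤ p n := by exact_mod_cast hpn
    have hr : 0 < γ n / (2 * p n) := div_pos (hγ n).1 (by positivity)
    have hr1 : γ n / (2 * p n) < 1 := by
      rw [div_lt_one (by positivity)]; linarith [(hγ n).2]
    have hq : quantile (gaussianReal 0 1) (1 - γ n / (2 * p n)) ≤
        √(2 * Real.log (2 * p n / γ n)) := by
      apply quantile_le _ (by linarith)
      rw [← measure_Ioi_le_iff _ hr.le]
      exact gaussian_tail_log (hγ n).1 (by linarith [(hγ n).2])
    refine (mul_le_mul_of_nonneg_left hq (Real.sqrt_nonneg _)).trans ?_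
    exact sqrt_mul_sqrt_log_le hC.le (by linarith [log_two_le hpn (hγ n).1])

/-- The design-dependent penalty level of Lasso. -/
theorem isScoreBound_depBound (hp : Tendsto p atTop atTop)
    (hx : ∀ n, 1 ≤ n → ∀ j, (En fun i => x n i j ^ 2) = 1) (hγ : ∀ n, 0 < γ n ∧ γ n < 1)
    (hγ0 : Tendsto γ atTop (𝓝 0))
    (hO : (fun n => Real.log (1 / γ n)) =O[atTop] fun n => Real.log (max (p n : ℝ) n)) :
    IsScoreBound x fun n => depBound (x n) (γ n) := by
  have hprob : ∀ n, IsProbabilityMeasure ((stdGaussian n).map (maxScore (x n))) := fun n =>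
    Measure.isProbabilityMeasure_map (measurable_maxScore _).aemeasurable
  refine ⟨fun η hη => tendsto_maxScore_of_le hγ0 (Eventually.of_forall fun n => ?_) hη, ?_⟩
  · have h1 := (measure_Ioi_le_iff ((stdGaussian n).map (maxScore (x n))) (hγ n).1.le).2
      (le_cdf_quantile _ (q := 1 - γ n) (by linarith [(hγ n).1]))
    rwa [Measure.map_apply (measurable_maxScore _) measurableSet_Ioi] at h1
  · obtain ⟨C, hC, hlog⟩ := exists_log_le hp hγ hO
    refine ⟨√C, ?_⟩
    filter_upwards [hlog, hp.eventually_ge_atTop 1, eventually_ge_atTop 1] with n hn hpn hn1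
    refine le_trans ?_ (sqrt_mul_sqrt_log_le hC.le
      (show 2 * Real.log (2 * p n / γ n) ≤ _ by linarith [log_two_le hpn (hγ n).1]))
    apply quantile_le _ (by linarith [(hγ n).2])
    rw [← measure_Ioi_le_iff _ (hγ n).1.le,
      Measure.map_apply (measurable_maxScore _) measurableSet_Ioi]
    exact stdGaussian_maxScore_log_le hn1 hpn (hx n hn1) (hγ n).1 (hγ n).2

theorem measurable_maxScore_div {n P : ℕ} (x : Fin n → Fin P → ℝ) :
    Measurable fun g : Fin n → ℝ => maxScore x g / √(En fun i => g i ^ 2) :=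
  (measurable_maxScore x).div
    (measurable_En (f := fun i (g : Fin n → ℝ) => g i ^ 2) fun i => by fun_prop).sqrt

/-- The design-dependent penalty level of Square-root Lasso. -/
theorem isScoreBound_depBoundSqrt (hp : Tendsto p atTop atTop)
    (hL : Tendsto (fun n => logDim (p n) n / n) atTop (𝓝 0))
    (hx : ∀ n, 1 ≤ n → ∀ j, (En fun i => x n i j ^ 2) = 1) (hγ : ∀ n, 0 < γ n ∧ γ n < 1)
    (hγ0 : Tendsto γ atTop (𝓝 0))
    (hO : (fun n => Real.log (1 / γ n)) =O[atTop] fun n => Real.log (max (p n : ℝ) n)) :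
    IsScoreBound x fun n => depBoundSqrt (x n) (γ n) := by
  have hprob : ∀ n, IsProbabilityMeasure
      ((stdGaussian n).map fun g => maxScore (x n) g / √(En fun i => g i ^ 2)) := fun n =>
    Measure.isProbabilityMeasure_map (measurable_maxScore_div _).aemeasurable
  constructor
  · intro η hη
    have hη' : 0 < min η (1 / 2) := by positivity
    have hlim : Tendsto (fun n => ENNReal.ofReal (γ n) +
        stdGaussian n {g | ¬ |(En fun i => g i ^ 2) - 1| ≤ min η (1 / 2)}) atTop (𝓝 0) := by
      have h1 : Tendsto (fun n => ENNReal.ofReal (γ n)) atTop (𝓝 0) := by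
        rw [← ENNReal.ofReal_zero]; exact ENNReal.tendsto_ofReal hγ0
      simpa using h1.add (tendsto_En_sq hη')
    refine tendsto_of_tendsto_of_tendsto_of_le_of_le tendsto_const_nhds hlim
      (fun _ => zero_le) fun n => ?_
    have h1 := (measure_Ioi_le_iff ((stdGaussian n).map
      fun g => maxScore (x n) g / √(En fun i => g i ^ 2)) (hγ n).1.le).2
      (le_cdf_quantile _ (q := 1 - γ n) (by linarith [(hγ n).1]))
    rw [Measure.map_apply (measurable_maxScore_div _) measurableSet_Ioi] at h1
    refine (measure_mono fun g hg => ?_).trans ((measure_union_le _ _).trans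
      (add_le_add_left h1 _))
    by_contra hcon
    rw [Set.mem_union, not_or] at hcon
    have hc1 : ¬ depBoundSqrt (x n) (γ n) < maxScore (x n) g / √(En fun i => g i ^ 2) := hcon.1
    have hc2 : |(En fun i => g i ^ 2) - 1| ≤ min η (1 / 2) := not_not.1 hcon.2
    have hg' : (1 + η) * depBoundSqrt (x n) (γ n) < maxScore (x n) g := hg
    rw [abs_le] at hc2
    have hlo : 0 < En fun i => g i ^ 2 := by linarith [min_le_right η (1 / 2 : ℝ)]
    have hs : √(En fun i => g i ^ 2) ≤ 1 + η := by
      rw [Real.sqrt_le_iff]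
      exact ⟨by linarith, by nlinarith [min_le_left η (1 / 2 : ℝ)]⟩
    have hs0 := Real.sqrt_pos.2 hlo
    rw [not_lt, div_le_iff₀ hs0] at hc1
    have h0 : 0 ≤ depBoundSqrt (x n) (γ n) := by
      by_contra hneg
      push Not at hneg
      nlinarith [maxScore_nonneg (x n) g]
    nlinarith
  · obtain ⟨a, ha, htail⟩ := exists_En_sq_lower_tail
    obtain ⟨C, hC, hlog⟩ := exists_log_le hp hγ hO
    refine ⟨√C / √a, ?_⟩
    filter_upwards [hlog, hp.eventually_ge_atTop 1, eventually_ge_atTop 1,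
      (hL.const_mul C).eventually (gt_mem_nhds (by simpa using ha : C * 0 < a))]
      with n hn hpn hn1 hLn
    have hn0 : (0 : ℝ) < n := by exact_mod_cast hn1
    have hp0 : (1 : ℝ) ≤ p n := by exact_mod_cast hpn
    have hγn := hγ n
    have hsa : 0 < √a := Real.sqrt_pos.2 ha
    set T := √(n : ℝ) * √(2 * Real.log (2 * p n / (γ n / 2))) with hT
    have hTeq : 2 * p n / (γ n / 2) = 4 * p n / γ n := by field_simp; norm_num
    have hTle : T / √a ≤ √C / √a * √(n * logDim (p n) n) := by
      rw [div_mul_eq_mul_div]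
      gcongr
      rw [hT, hTeq]
      exact sqrt_mul_sqrt_log_le hC.le hn
    refine le_trans ?_ hTle
    apply quantile_le _ (by linarith)
    rw [← measure_Ioi_le_iff _ hγn.1.le,
      Measure.map_apply (measurable_maxScore_div _) measurableSet_Ioi]
    have h1 := stdGaussian_maxScore_log_le hn1 hpn (hx n hn1) (r := γ n / 2) (by linarith)
      (by linarith)
    -- the exponentially small probability is at most `γ / 2`
    have h2 : Real.exp (-(a * n)) ≤ γ n / 2 := by
      rw [← Real.le_log_iff_exp_le (by linarith)]
      have e1 : C * logDim (p n) n ≤ a * n := by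
        rw [mul_div_assoc', div_lt_iff₀ hn0] at hLn; exact hLn.le
      have e2 : Real.log (4 * p n / γ n) = Real.log (2 * p n) - Real.log (γ n / 2) := by
        rw [← Real.log_div (by positivity) (by linarith), hTeq]
      have e3 : 0 ≤ Real.log (2 * p n) := Real.log_nonneg (by linarith)
      have e4 : 0 ≤ Real.log (4 * p n / γ n) := Real.log_nonneg (by
        rw [one_le_div hγn.1]; linarith)
      linarith
    calc _ ≤ stdGaussian n ({g | T < maxScore (x n) g} ∪ {g | (En fun i => g i ^ 2) < a}) := by
          refine measure_mono fun g hg => ?_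
          have hg' : T / √a < maxScore (x n) g / √(En fun i => g i ^ 2) := hg
          by_contra hcon
          rw [Set.mem_union, not_or] at hcon
          have hc1 : maxScore (x n) g ≤ T := not_lt.1 hcon.1
          have hc2 : a ≤ En fun i => g i ^ 2 := not_lt.1 hcon.2
          have hT0 : 0 ≤ T := by positivity
          have : maxScore (x n) g / √(En fun i => g i ^ 2) ≤ T / √a := by gcongr
          linarith
      _ ≤ ENNReal.ofReal (γ n / 2) + ENNReal.ofReal (γ n / 2) :=
          (measure_union_le _ _).trans (add_le_add h1
            ((htail n).trans (ENNReal.ofReal_le_ofReal h2)))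
      _ = ENNReal.ofReal (γ n) := by
          rw [← ENNReal.ofReal_add (by linarith) (by linarith), add_halves]

end

end

/-! ### The empirical inner product -/

/-- A vector of `n` observations, scaled such that the Euclidean inner product is the empirical
second moment `E_n[f g]`. -/
noncomputable def emb {n : ℕ} : (Fin n → ℝ) →ₗ[ℝ] EuclideanSpace ℝ (Fin n) :=
  (√(n : ℝ))⁻¹ • (WithLp.linearEquiv 2 ℝ (Fin n → ℝ)).symm.toLinearMap

theorem inner_emb {n : ℕ} (f g : Fin n → ℝ) :
    inner ℝ (emb f) (emb g) = En fun i => f i * g i := by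
  have h : (√(n : ℝ))⁻¹ * (√(n : ℝ))⁻¹ = (n : ℝ)⁻¹ := by
    rw [← mul_inv, Real.mul_self_sqrt (Nat.cast_nonneg n)]
  simp only [emb, LinearMap.smul_apply, real_inner_smul_left, real_inner_smul_right]
  rw [← mul_assoc, h, En, div_eq_inv_mul]
  congr 1
  simp [PiLp.inner_apply, mul_comm]

theorem norm_emb_sq {n : ℕ} (f : Fin n → ℝ) : ‖emb f‖ ^ 2 = En fun i => f i ^ 2 := by
  rw [← real_inner_self_eq_norm_sq, inner_emb]
  simp only [pow_two]

theorem norm_emb {n : ℕ} (f : Fin n → ℝ) : ‖emb f‖ = √(En fun i => f i ^ 2) := by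
  rw [← norm_emb_sq, Real.sqrt_sq (norm_nonneg _)]

/-- The linear map `β ↦ (x_i'β)_i` into the space of observations. -/
noncomputable def design {n p : ℕ} (x : Fin n → Fin p → ℝ) :
    (Fin p → ℝ) →ₗ[ℝ] EuclideanSpace ℝ (Fin n) :=
  emb ∘ₗ Matrix.mulVecLin (Matrix.of x)

theorem design_apply {n p : ℕ} (x : Fin n → Fin p → ℝ) (β : Fin p → ℝ) :
    design x β = emb fun i => x i ⬝ᵥ β := rfl

theorem design_single {n p : ℕ} (x : Fin n → Fin p → ℝ) (j : Fin p) :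
    design x (Pi.single j 1) = emb fun i => x i j := by
  rw [design_apply]; simp

theorem Qhat_eq {n p : ℕ} (x : Fin n → Fin p → ℝ) (y : Fin n → ℝ) (β : Fin p → ℝ) :
    Qhat x y β = ‖emb y - design x β‖ ^ 2 := by
  rw [design_apply, ← map_sub, norm_emb_sq]; rfl

theorem isLasso_iff {n p : ℕ} {x : Fin n → Fin p → ℝ} {y : Fin n → ℝ} {lam : ℝ}
    {β : Fin p → ℝ} : IsLasso x y lam β ↔ LassoMin (design x) (emb y) (lam / n) β := by
  simp only [IsLasso, LassoMin, Qhat_eq]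

theorem isSqrtLasso_iff {n p : ℕ} {x : Fin n → Fin p → ℝ} {y : Fin n → ℝ} {lam : ℝ}
    {β : Fin p → ℝ} : IsSqrtLasso x y lam β ↔ SqrtLassoMin (design x) (emb y) (lam / n) β := by
  simp only [IsSqrtLasso, SqrtLassoMin, Qhat_eq, Real.sqrt_sq (norm_nonneg _)]

theorem gram_quadratic {n p : ℕ} (x : Fin n → Fin p → ℝ) (δ : Fin p → ℝ) :
    δ ⬝ᵥ (gram x).mulVec δ = ‖design x δ‖ ^ 2 := by
  rw [design_apply, norm_emb_sq]
  have h : ∀ j, δ j * (gram x).mulVec δ j =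
      ∑ i, ∑ k, x i j * δ j * (x i k * δ k) / n := fun j => by
    rw [Finset.sum_comm]
    simp only [Matrix.mulVec, dotProduct, gram, En, Finset.mul_sum, Finset.sum_div, Finset.sum_mul]
    refine Finset.sum_congr rfl fun k _ => Finset.sum_congr rfl fun i _ => ?_
    ring
  rw [dotProduct, Finset.sum_congr rfl fun j _ => h j, Finset.sum_comm, En, Finset.sum_div]
  refine Finset.sum_congr rfl fun i _ => ?_
  rw [pow_two, dotProduct, Finset.sum_mul_sum, Finset.sum_div]
  simp only [Finset.sum_div]

theorem scoreLE_of_maxScore_le {n p : ℕ} {x : Fin n → Fin p → ℝ} {g : Fin n → ℝ} {σ t : ℝ}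
    (hn : 1 ≤ n) (hσ : 0 ≤ σ) (h : σ * (maxScore x g / n) ≤ t) :
    ScoreLE (design x) (emb fun i => σ * g i) t := by
  intro j
  have hn0 : (0 : ℝ) < n := by exact_mod_cast hn
  rw [design_single, inner_emb]
  have h1 : (En fun i => x i j * (σ * g i)) = σ * En fun i => x i j * g i := by
    rw [← En_smul_left]; congr 1; ext i; ring
  rw [h1, abs_mul, abs_of_nonneg hσ]
  refine le_trans ?_ h
  gcongr
  unfold maxScore
  rw [mul_div_cancel_left₀ _ hn0.ne']
  exact norm_le_pi_norm (fun j => En fun i => x i j * g i) j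

/-- Under condition SE, sparse vectors of any fixed multiple of the sparsity index have comparable
Euclidean and prediction norms. -/
theorem ConditionSE.exists_sparse_bounds {p : ℕ → ℕ} {s : ℕ → ℕ}
    {x : ∀ n, Fin n → Fin (p n) → ℝ} (h : ConditionSE s x) :
    ∃ a M : ℝ, 0 < a ∧ 0 < M ∧ ∀ K : ℕ, ∀ᶠ n in atTop,
      SparseLower (design (x n)) (K * s n) a ∧ SparseUpper (design (x n)) (K * s n) M := by
  obtain ⟨ℓ, hℓ, κ', κ'', h0, h1, hev⟩ := h
  refine ⟨√κ', √κ'', Real.sqrt_pos.2 h0, Real.sqrt_pos.2 (h0.trans h1), fun K => ?_⟩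
  filter_upwards [hev, hℓ.eventually_ge_atTop (K : ℝ)] with n hn hK
  have hmem : ∀ δ : Fin (p n) → ℝ, δ ≠ 0 → (supp δ).card ≤ K * s n →
      ‖design (x n) δ‖ ^ 2 / ∑ j, δ j ^ 2 ∈ sparseRayleigh (gram (x n)) (ℓ n * s n) := by
    intro δ hδ hc
    refine ⟨δ, hδ, ?_, by rw [gram_quadratic]⟩
    calc ((supp δ).card : ℝ) ≤ ((K * s n : ℕ) : ℝ) := by exact_mod_cast hc
      _ = K * s n := by push_cast; ring
      _ ≤ ℓ n * s n := by gcongr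
  have hpos : ∀ δ : Fin (p n) → ℝ, δ ≠ 0 → 0 < ∑ j, δ j ^ 2 := by
    intro δ hδ
    obtain ⟨j, hj⟩ := Function.ne_iff.1 hδ
    exact Finset.sum_pos' (fun _ _ => sq_nonneg _)
      ⟨j, Finset.mem_univ _, by
        have : δ j ≠ 0 := hj
        positivity⟩
  constructor
  · intro δ hc
    rcases eq_or_ne δ 0 with rfl | hδ
    · simp
    have hb : BddBelow (sparseRayleigh (gram (x n)) (ℓ n * s n)) := by
      refine ⟨0, ?_⟩
      rintro q ⟨δ, -, -, rfl⟩
      rw [gram_quadratic]; positivity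
    have h2 := hn.1.trans (csInf_le hb (hmem δ hδ hc))
    rw [le_div_iff₀ (hpos δ hδ)] at h2
    rw [← Real.sqrt_mul h0.le]
    exact Real.sqrt_le_iff.2 ⟨norm_nonneg _, h2⟩
  · intro δ hc
    rcases eq_or_ne δ 0 with rfl | hδ
    · simp
    have hb : BddAbove (sparseRayleigh (gram (x n)) (ℓ n * s n)) := by
      refine ⟨‖(design (x n)).toContinuousLinearMap‖ ^ 2, ?_⟩
      rintro q ⟨δ, hδ, -, rfl⟩
      rw [gram_quadratic, div_le_iff₀ (hpos δ hδ)]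
      have e1 : ‖design (x n) δ‖ ≤ ‖(design (x n)).toContinuousLinearMap‖ * ‖δ‖ :=
        (design (x n)).toContinuousLinearMap.le_opNorm δ
      have e2 : ‖δ‖ ≤ √(∑ j, δ j ^ 2) := by
        rw [pi_norm_le_iff_of_nonneg (Real.sqrt_nonneg _)]
        intro j
        apply Real.le_sqrt_of_sq_le
        rw [Real.norm_eq_abs, sq_abs]
        exact Finset.single_le_sum (f := fun j => δ j ^ 2) (fun _ _ => sq_nonneg _)
          (Finset.mem_univ j)
      calc ‖design (x n) δ‖ ^ 2
          ≤ (‖(design (x n)).toContinuousLinearMap‖ * √(∑ j, δ j ^ 2)) ^ 2 := by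
            gcongr; exact e1.trans (by gcongr)
        _ = _ := by rw [mul_pow, Real.sq_sqrt (hpos δ hδ).le]
    have h2 := (le_csSup hb (hmem δ hδ hc)).trans hn.2.2
    rw [div_le_iff₀ (hpos δ hδ)] at h2
    rw [← Real.sqrt_mul (h0.trans h1).le]
    exact Real.le_sqrt_of_sq_le h2

/-- Prediction error and sparsity of Lasso, for one sample. -/
theorem DesignBounds.lasso_bounds {H : Type*} [NormedAddCommGroup H] [InnerProductSpace ℝ H]
    {p : ℕ} {X : (Fin p → ℝ) →ₗ[ℝ] H} {s k m : ℕ} {a M : ℝ} (hX : DesignBounds X s k a M)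
    {θ b τ C : ℝ} (hθ0 : 0 ≤ θ) (hθ : θ < 1) (hb : 0 ≤ b) (hτ : 0 < τ)
    (hk : 4 * M * ((1 + θ) / (1 - θ)) ≤ a * √k)
    (hC : C = 2 * (coneConst a M ((1 + θ) / (1 - θ)) (2 * b / (1 - θ)) + b) + b)
    (hm : SparseUpper X m M) (hCm : (2 * M * C / (1 - θ)) ^ 2 * s < m)
    {β₀ β : Fin p → ℝ} (hβ₀ : (supp β₀).card ≤ s) {f ε : H} (hr : ‖f - X β₀‖ ≤ b * (τ * √s))
    (hε : ScoreLE X ε (θ * τ / 2)) (hβ : LassoMin X (f + ε) τ β) :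
    ‖f - X β‖ ≤ C * (τ * √s) ∧ ((supp β).card : ℝ) ≤ (2 * M * C / (1 - θ)) ^ 2 * s := by
  have h1θ : 0 < 1 - θ := by linarith
  have hM := hX.M_nonneg
  have hdec : f + ε = X β₀ + (f - X β₀) + ε := by abel
  have h1 := hX.lasso_rate hθ0 hθ hb hτ hk hβ₀ hr hε (hdec ▸ hβ)
  have h2 : ‖f - X β‖ ≤ C * (τ * √s) := by
    have : f - X β = (f - X β₀) - X (β - β₀) := by rw [map_sub]; abel
    rw [this, hC]
    refine (norm_sub_le _ _).trans ?_
    linarith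
  refine ⟨h2, hβ.card_supp_le hτ hθ hm hε ?_ hCm⟩
  have h3 : f + ε - ε - X β = f - X β := by abel
  rw [h3]
  calc (2 * M * ‖f - X β‖) ^ 2 ≤ (2 * M * (C * (τ * √s))) ^ 2 := by gcongr
    _ = (2 * M * C / (1 - θ)) ^ 2 * s * (τ * (1 - θ)) ^ 2 := by
      have : √(s : ℝ) ^ 2 = s := Real.sq_sqrt (Nat.cast_nonneg s)
      field_simp
      rw [this]

section

/-! ### Feasible Lasso estimators -/

section regression

variable {Ω : ℕ → Type*} [∀ n, MeasurableSpace (Ω n)] {μ : ∀ n, Measure (Ω n)} {p : ℕ → ℕ}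
  {x : ∀ n, Fin n → Fin (p n) → ℝ} {s : ℕ → ℕ} {f : ∀ n, Fin n → ℝ} {σ : ℕ → ℝ}
  {G : ∀ n, Ω n → Fin n → ℝ} {y : ∀ n, Fin n → Ω n → ℝ} {Λ : ℕ → ℝ}

/-- A high-dimensional Gaussian regression `y = f + σ G` with an approximately sparse regression
function and standard normal `G`. The sparsity is `2 s`, to cover the reduced form of the outcome
equation, which combines two sparse functions. -/
structure SparseRegression (μ : ∀ n, Measure (Ω n)) (x : ∀ n, Fin n → Fin (p n) → ℝ) (s : ℕ → ℕ)
    (f : ∀ n, Fin n → ℝ) (σ : ℕ → ℝ) (G : ∀ n, Ω n → Fin n → ℝ) (y : ∀ n, Fin n → Ω n → ℝ) :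
    Prop where
  tendsto_p : Tendsto p atTop atTop
  normalized : ∀ n, 1 ≤ n → ∀ j, (En fun i => x n i j ^ 2) = 1
  se : ConditionSE s x
  one_le_s : ∀ n, 1 ≤ s n
  growth : Tendsto (fun n => s n * logDim (p n) n / n) atTop (𝓝 0)
  approx : ∃ C : ℝ, 0 ≤ C ∧ ∀ n, ∃ β : Fin (p n) → ℝ, (supp β).card ≤ 2 * s n ∧
    ‖emb (f n) - design (x n) β‖ ≤ C * √(s n / n)
  sigma : ∃ lo hi : ℝ, 0 < lo ∧ ∀ n, lo ≤ σ n ∧ σ n ≤ hi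
  law : ∀ n, HasLaw (G n) (stdGaussian n) (μ n)
  model : ∀ n i ω, y n i ω = f n i + σ n * G n ω i

theorem IsScoreBound.whp (h : IsScoreBound x Λ) (hG : ∀ n, HasLaw (G n) (stdGaussian n) (μ n))
    {η : ℝ} (hη : 0 < η) :
    ∀ᶠ q in whp μ, maxScore (x q.1) (G q.1 q.2) ≤ (1 + η) * Λ q.1 := by
  refine whp_of_hasLaw hG (P := fun n g => maxScore (x n) g ≤ (1 + η) * Λ n)
    (fun n => (measurableSet_le (measurable_maxScore _) measurable_const).compl) ?_
  simpa only [not_le] using h.exceed η hη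

theorem tendsto_En_sq_whp (hG : ∀ n, HasLaw (G n) (stdGaussian n) (μ n)) :
    Tendsto (fun q => En fun i => G q.1 q.2 i ^ 2) (whp μ) (𝓝 1) := by
  rw [Metric.tendsto_nhds]
  intro ε hε
  have h : ∀ᶠ q in DoublePostLasso.whp μ, |(En fun i => G q.1 q.2 i ^ 2) - 1| ≤ ε / 2 := by
    refine whp_of_hasLaw hG (P := fun n g => |(En fun i => g i ^ 2) - 1| ≤ ε / 2)
      (fun n => ?_) (tendsto_En_sq (half_pos hε))
    have hm : Measurable fun g : Fin n → ℝ => |(En fun i => g i ^ 2) - 1| :=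
      ((measurable_En (f := fun i (g : Fin n → ℝ) => g i ^ 2) fun i => by fun_prop).sub_const
        1).abs
    exact (measurableSet_le hm measurable_const).compl
  filter_upwards [h] with q hq
  rw [Real.dist_eq]
  linarith

theorem SparseRegression.tendsto_sqrt (h : SparseRegression μ x s f σ G y) :
    Tendsto (fun n => √(s n * logDim (p n) n / n)) atTop (𝓝 0) := by
  have := h.growth.sqrt
  rwa [Real.sqrt_zero] at this

theorem SparseRegression.emb_eq (h : SparseRegression μ x s f σ G y) (n : ℕ) (ω : Ω n) :
    emb (fun i => y n i ω) = emb (f n) + emb fun i => σ n * G n ω i := by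
  rw [← map_add]
  congr 1
  ext i
  exact h.model n i ω

/-- A number of blocks sufficient for the cone arguments. -/
theorem exists_blocks {a : ℝ} (ha : 0 < a) (D : ℝ) : ∃ k : ℕ, 1 ≤ k ∧ D ≤ a * √k := by
  obtain ⟨k, hk⟩ := exists_nat_ge ((|D| / a) ^ 2)
  refine ⟨k + 1, by omega, ?_⟩
  have h1 : |D| / a ≤ √((k + 1 : ℕ) : ℝ) := by
    apply Real.le_sqrt_of_sq_le
    push_cast
    linarith
  rw [div_le_iff₀ ha] at h1
  linarith [le_abs_self D]

theorem exists_designBounds (hse : ConditionSE s x) (hs : ∀ n, 1 ≤ s n) :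
    ∃ a M : ℝ, 0 < a ∧ 0 < M ∧ (∀ k : ℕ, 1 ≤ k → ∀ᶠ n in atTop,
      DesignBounds (design (x n)) (2 * s n) k a M) ∧
      ∀ K : ℕ, ∀ᶠ n in atTop, SparseUpper (design (x n)) (K * s n) M := by
  obtain ⟨a, M, ha, hM, h⟩ := hse.exists_sparse_bounds
  refine ⟨a, M, ha, hM, fun k hk => ?_, fun K => (h K).mono fun n hn => hn.2⟩
  filter_upwards [h (2 + 2 * k), h (2 * k)] with n h1 h2
  refine ⟨by have := hs n; omega, hk, ha, hM.le, ?_, ?_⟩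
  · have : 2 * s n + k * (2 * s n) = (2 + 2 * k) * s n := by ring
    rw [this]; exact h1.1
  · have : k * (2 * s n) = 2 * k * s n := by ring
    rw [this]; exact h2.2

/-- Splitting the slack of the penalty factor `c > 1`: the fraction `η` is lost both in the score
bound and in the estimate of the noise level, and the penalty still dominates the score by the
factor `1 / θ > 1`, where `θ = (1 + η) / (c (1 - η))`. -/
theorem exists_slack {c : ℝ} (hc : 1 < c) :
    ∃ η : ℝ, 0 < η ∧ η < 1 / 2 ∧ 0 ≤ (1 + η) / (c * (1 - η)) ∧ (1 + η) / (c * (1 - η)) < 1 := by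
  have h1 : (c - 1) / (2 * (c + 1)) * (2 * (c + 1)) = c - 1 := div_mul_cancel₀ _ (by linarith)
  have h2 : (c - 1) / (2 * (c + 1)) < 1 / 2 := by
    rw [div_lt_div_iff₀ (by linarith) (by norm_num)]; linarith
  have h3 : 0 < (c - 1) / (2 * (c + 1)) := div_pos (by linarith) (by linarith)
  generalize (c - 1) / (2 * (c + 1)) = η at *
  have h4 : 0 < c * (1 - η) := mul_pos (by linarith) (by linarith)
  refine ⟨η, h3, h2, div_nonneg (by linarith) h4.le, ?_⟩
  rw [div_lt_one h4]
  nlinarith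

/-- The order of magnitude of the penalty `t Λ / n`, for a score bound `Λ` between the orders `√n`
and `√(n L)` and a bounded factor `t`. -/
theorem penalty_bounds {n : ℕ} (hn : 1 ≤ n) {Λ D L t lo hi : ℝ} (hΛ : √(n : ℝ) ≤ 2 * Λ)
    (hΛ' : Λ ≤ D * √(n * L)) (hlo : 0 < lo) (ht : lo ≤ t) (ht' : t ≤ hi) :
    lo / (2 * √n) ≤ t * Λ / n ∧ t * Λ / n ≤ hi * |D| * √(L / n) := by
  have hn0 : (0 : ℝ) < n := by exact_mod_cast hn
  have hsn : 0 < √(n : ℝ) := Real.sqrt_pos.2 hn0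
  have hsq : √(n : ℝ) * √n = n := Real.mul_self_sqrt hn0.le
  have hΛ0 : 0 < Λ := by linarith
  constructor
  · rw [le_div_iff₀ hn0, div_mul_eq_mul_div, div_le_iff₀ (by positivity)]
    nth_rewrite 1 [← hsq]
    have : lo * √n ≤ t * (2 * Λ) := mul_le_mul ht hΛ hsn.le (by linarith)
    nlinarith
  · have h1 : √(n * L) = √n * √L := Real.sqrt_mul hn0.le _
    have h2 : √(L / n) = √L / √n := Real.sqrt_div' _ hn0.le
    rw [h2, div_le_iff₀ hn0]
    have h3 : Λ ≤ |D| * (√n * √L) := by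
      rw [← h1]; exact hΛ'.trans (by gcongr; exact le_abs_self D)
    calc t * Λ ≤ hi * (|D| * (√n * √L)) := mul_le_mul ht' h3 hΛ0.le (by linarith)
      _ = hi * |D| * (√L / √n) * n := by
        nth_rewrite 3 [← hsq]; field_simp

/-- Lasso with a consistent estimate of the noise level. -/
theorem SparseRegression.whp_lasso (h : SparseRegression μ x s f σ G y) (hΛ : IsScoreBound x Λ)
    {c : ℝ} (hc : 1 < c) {σhat : ∀ n, Ω n → ℝ} {βhat : ∀ n, Ω n → Fin (p n) → ℝ}
    (hσ : Tendsto (fun q => σhat q.1 q.2 - σ q.1) (whp μ) (𝓝 0))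
    (hβ : ∀ᶠ q in whp μ, IsLasso (x q.1) (fun i => y q.1 i q.2)
      (2 * c * σhat q.1 q.2 * Λ q.1) (βhat q.1 q.2)) :
    ∃ C : ℝ, 0 ≤ C ∧ ∀ᶠ q in whp μ, ((supp (βhat q.1 q.2)).card : ℝ) ≤ C * s q.1 ∧
      ‖emb (f q.1) - design (x q.1) (βhat q.1 q.2)‖ ≤
        C * √(s q.1 * logDim (p q.1) q.1 / q.1) := by
  obtain ⟨lo, hi, hlo, hσb⟩ := h.sigma
  obtain ⟨Cf, hCf, happ⟩ := h.approx
  obtain ⟨D, hD⟩ := hΛ.upper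
  obtain ⟨a, M, ha, hM, hdes, hup⟩ := exists_designBounds h.se h.one_le_s
  obtain ⟨η, hη0, hη1, hθ0, hθ1⟩ := exists_slack hc
  set θ := (1 + η) / (c * (1 - η)) with hθ
  have h1θ : 0 < 1 - θ := by linarith
  obtain ⟨k, hk1, hk⟩ := exists_blocks ha (4 * M * ((1 + θ) / (1 - θ)))
  set b := 2 * Cf / lo with hb
  have hb0 : 0 ≤ b := by positivity
  set C₀ := 2 * (coneConst a M ((1 + θ) / (1 - θ)) (2 * b / (1 - θ)) + b) + b with hC₀
  have hC₀0 : 0 ≤ C₀ := by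
    have := coneConst_nonneg (a := a) (M := M) (c := (1 + θ) / (1 - θ)) (b := 2 * b / (1 - θ))
      ha hM.le (by positivity) (by positivity)
    positivity
  set E := (2 * M * C₀ / (1 - θ)) ^ 2 * 2 with hE
  obtain ⟨K, hK⟩ := exists_nat_gt E
  refine ⟨max E (C₀ * (2 * c * (2 * hi) * |D| * √2)), le_max_of_le_left (by positivity), ?_⟩
  filter_upwards [hβ, hΛ.whp h.law hη0, Metric.tendsto_nhds.1 hσ (η * lo) (by positivity),
    Eventually.whp (hdes k hk1), Eventually.whp (hup K), Eventually.whp hD,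
    Eventually.whp (hΛ.lower h.tendsto_p h.normalized),
    Eventually.whp (eventually_ge_atTop 1)] with q hq1 hq2 hq3 hq4 hq5 hq6 hq7 hq8
  obtain ⟨n, ω⟩ := q
  dsimp only at hq1 hq2 hq3 hq4 hq5 hq6 hq7 hq8 ⊢
  have hn0 : (0 : ℝ) < n := by exact_mod_cast hq8
  have hsn : 0 < √(n : ℝ) := Real.sqrt_pos.2 hn0
  have hΛ0 : 0 < Λ n := by linarith
  have hs1 : (1 : ℝ) ≤ s n := by exact_mod_cast h.one_le_s n
  have hσn := hσb n
  rw [Real.dist_eq, sub_zero, abs_lt] at hq3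
  have hlow : (1 - η) * σ n ≤ σhat n ω := by nlinarith
  have hhi : σhat n ω ≤ 2 * hi := by nlinarith
  have hlow' : lo / 2 ≤ σhat n ω := by nlinarith
  set τ := 2 * c * σhat n ω * Λ n / n with hτ
  obtain ⟨hτ1, hτ2⟩ := penalty_bounds hq8 hq7 hq6 hlo (t := 2 * c * σhat n ω)
    (hi := 2 * c * (2 * hi)) (by nlinarith) (by gcongr)
  rw [← hτ] at hτ1 hτ2
  have hτ0 : 0 < τ := lt_of_lt_of_le (by positivity) hτ1
  obtain ⟨β₀, hβ₀, hr⟩ := happ n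
  have hr' : ‖emb (f n) - design (x n) β₀‖ ≤ b * (τ * √((2 * s n : ℕ) : ℝ)) := by
    refine hr.trans ?_
    rw [Real.sqrt_div' _ hn0.le]
    have e1 : √(s n : ℝ) ≤ √((2 * s n : ℕ) : ℝ) := by
      apply Real.sqrt_le_sqrt; push_cast; linarith
    calc Cf * (√(s n : ℝ) / √n) = b * (lo / (2 * √n) * √(s n : ℝ)) := by
          rw [hb]; field_simp
      _ ≤ b * (τ * √((2 * s n : ℕ) : ℝ)) := by gcongr
  have hscore : ScoreLE (design (x n)) (emb fun i => σ n * G n ω i) (θ * τ / 2) := by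
    refine scoreLE_of_maxScore_le hq8 (hlo.le.trans hσn.1) ?_
    have hσ0 : 0 ≤ σ n := hlo.le.trans hσn.1
    calc σ n * (maxScore (x n) (G n ω) / n) ≤ σ n * ((1 + η) * Λ n / n) := by gcongr
      _ = (1 + η) / (1 - η) * ((1 - η) * σ n) * (Λ n / n) := by
          have : 1 - η ≠ 0 := by linarith
          field_simp
      _ ≤ (1 + η) / (1 - η) * σhat n ω * (Λ n / n) := by
          have : 0 ≤ (1 + η) / (1 - η) := div_nonneg (by linarith) (by linarith)
          gcongr
      _ = θ * τ / 2 := by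
          have : 1 - η ≠ 0 := by linarith
          rw [hθ, hτ]; field_simp
  rw [isLasso_iff, h.emb_eq] at hq1
  have hEs : (2 * M * C₀ / (1 - θ)) ^ 2 * ((2 * s n : ℕ) : ℝ) = E * s n := by
    push_cast; rw [hE]; ring
  obtain ⟨hrate, hcard⟩ := hq4.lasso_bounds hθ0 hθ1 hb0 hτ0 hk hC₀ hq5 (by
    rw [hEs]; push_cast; gcongr) hβ₀ hr' hscore hq1
  rw [hEs] at hcard
  constructor
  · exact hcard.trans (by gcongr; exact le_max_left _ _)
  · have e2 : √((2 * s n : ℕ) : ℝ) = √2 * √(s n : ℝ) := by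
      push_cast; exact Real.sqrt_mul (by norm_num) _
    calc ‖emb (f n) - design (x n) (βhat n ω)‖ ≤ C₀ * (τ * √((2 * s n : ℕ) : ℝ)) := hrate
      _ ≤ C₀ * ((2 * c * (2 * hi) * |D| * √(logDim (p n) n / n)) * √((2 * s n : ℕ) : ℝ)) := by
          gcongr
      _ = C₀ * (2 * c * (2 * hi) * |D| * √2) * √(s n * logDim (p n) n / n) := by
          rw [e2, mul_div_assoc, Real.sqrt_mul (by positivity)]; ring
      _ ≤ _ := by gcongr; exact le_max_right _ _

theorem tendsto_of_relative {α : Type*} {l : Filter α} {q q₀ e : α → ℝ} {hi : ℝ}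
    (he : Tendsto e l (𝓝 0)) (hq : ∀ᶠ t in l, |q t - q₀ t| ≤ e t * (q t + q₀ t))
    (h0 : ∀ᶠ t in l, 0 ≤ q₀ t ∧ q₀ t ≤ hi ∧ 0 ≤ q t) :
    Tendsto (fun t => q t - q₀ t) l (𝓝 0) := by
  have hlim : Tendsto (fun t => 4 * |e t| * hi) l (𝓝 0) := by
    have := (he.abs.const_mul 4).mul_const hi
    simpa using this
  refine squeeze_zero_norm' ?_ hlim
  filter_upwards [hq, h0, he.eventually (Metric.ball_mem_nhds 0 (by norm_num : (0 : ℝ) < 1 / 2))]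
    with t h1 h2 h3
  rw [Real.dist_eq, sub_zero] at h3
  rw [Real.norm_eq_abs]
  have h4 : e t ≤ |e t| := le_abs_self _
  have h5 := (le_abs_self _).trans h1
  have h6 : q t ≤ 3 * q₀ t := by nlinarith
  calc |q t - q₀ t| ≤ |e t| * (q t + q₀ t) := h1.trans (by gcongr; linarith)
    _ ≤ |e t| * (4 * hi) := by gcongr; linarith
    _ = _ := by ring

/-- The residual norm of Square-root Lasso consistently estimates the noise level. -/
theorem SparseRegression.tendsto_sqrtLasso_residual (h : SparseRegression μ x s f σ G y)
    (hΛ : IsScoreBound x Λ) {c : ℝ} (hc : 1 < c) {βhat : ∀ n, Ω n → Fin (p n) → ℝ}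
    (hβ : ∀ᶠ q in whp μ, IsSqrtLasso (x q.1) (fun i => y q.1 i q.2) (c * Λ q.1)
      (βhat q.1 q.2)) :
    Tendsto (fun q => ‖emb (fun i => y q.1 i q.2) - design (x q.1) (βhat q.1 q.2)‖ - σ q.1)
      (whp μ) (𝓝 0) := by
  obtain ⟨lo, hi, hlo, hσb⟩ := h.sigma
  obtain ⟨Cf, hCf, happ⟩ := h.approx
  choose β₀ hβ₀ hr using happ
  obtain ⟨D, hD⟩ := hΛ.upper
  obtain ⟨a, M, ha, hM, hdes, -⟩ := exists_designBounds h.se h.one_le_s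
  have hhi : 0 < hi := hlo.trans_le ((hσb 0).1.trans (hσb 0).2)
  -- the norm of the disturbance, including the approximation error
  set q₀ : (Σ n, Ω n) → ℝ := fun q =>
    ‖(emb (f q.1) - design (x q.1) (β₀ q.1)) + emb fun i => σ q.1 * G q.1 q.2 i‖ with hq₀
  have hnoise : ∀ n ω, ‖emb fun i => σ n * G n ω i‖ = σ n * √(En fun i => G n ω i ^ 2) := by
    intro n ω
    have : (emb fun i => σ n * G n ω i) = σ n • emb (G n ω) := by rw [← map_smul]; rfl
    rw [this, norm_smul, norm_emb, Real.norm_eq_abs, abs_of_pos (hlo.trans_le (hσb n).1)]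
  have hq₀lim : Tendsto (fun q => q₀ q - σ q.1) (whp μ) (𝓝 0) := by
    have h1 : Tendsto (fun q : Σ n, Ω n => Cf * √(s q.1 * logDim (p q.1) q.1 / q.1) +
        hi * |√(En fun i => G q.1 q.2 i ^ 2) - 1|) (whp μ) (𝓝 0) := by
      have e1 := (Tendsto.whp (μ := μ) h.tendsto_sqrt).const_mul Cf
      have e2 := (((tendsto_En_sq_whp h.law).sqrt.sub_const 1).abs).const_mul hi
      simpa using e1.add e2
    refine squeeze_zero_norm' ?_ h1
    filter_upwards [Eventually.whp ((tendsto_logDim (p := p)).eventually_ge_atTop 1)] with q hL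
    have hσ0 : 0 < σ q.1 := hlo.trans_le (hσb q.1).1
    rw [Real.norm_eq_abs]
    have e3 : |q₀ q - ‖emb fun i => σ q.1 * G q.1 q.2 i‖| ≤
        ‖emb (f q.1) - design (x q.1) (β₀ q.1)‖ := by
      refine (abs_norm_sub_norm_le _ _).trans (le_of_eq ?_)
      rw [add_sub_cancel_right]
    have e4 : |‖emb fun i => σ q.1 * G q.1 q.2 i‖ - σ q.1| ≤
        hi * |√(En fun i => G q.1 q.2 i ^ 2) - 1| := by
      have : ‖emb fun i => σ q.1 * G q.1 q.2 i‖ - σ q.1 =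
          σ q.1 * (√(En fun i => G q.1 q.2 i ^ 2) - 1) := by rw [hnoise]; ring
      rw [this, abs_mul, abs_of_pos hσ0]
      gcongr
      exact (hσb q.1).2
    have e5 : √((s q.1 : ℝ) / q.1) ≤ √(s q.1 * logDim (p q.1) q.1 / q.1) := by
      apply Real.sqrt_le_sqrt
      gcongr
      exact le_mul_of_one_le_right (Nat.cast_nonneg _) hL
    calc |q₀ q - σ q.1| ≤ |q₀ q - ‖emb fun i => σ q.1 * G q.1 q.2 i‖| +
          |‖emb fun i => σ q.1 * G q.1 q.2 i‖ - σ q.1| := abs_sub_le _ _ _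
      _ ≤ _ := by
        gcongr
        exact e3.trans ((hr q.1).trans (by gcongr))
  obtain ⟨η, hη0, hη1, hθ0, hθ1⟩ := exists_slack hc
  set θ := (1 + η) / (c * (1 - η)) with hθ
  have h1θ : 0 < 1 - θ := by linarith
  obtain ⟨k, hk1, hk⟩ := exists_blocks ha (4 * M * ((1 + θ) / (1 - θ)))
  set b := 4 * Cf / lo with hb
  have hb0 : 0 ≤ b := by positivity
  set C₀ := coneConst a M ((1 + θ) / (1 - θ)) (b / (1 - θ)) + b with hC₀
  have hC₀0 : 0 ≤ C₀ := by
    have := coneConst_nonneg (a := a) (M := M) (c := (1 + θ) / (1 - θ)) (b := b / (1 - θ))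
      ha hM.le (by positivity) (by positivity)
    positivity
  have key : Tendsto (fun q : Σ n, Ω n =>
      ‖emb (fun i => y q.1 i q.2) - design (x q.1) (βhat q.1 q.2)‖ - q₀ q) (whp μ) (𝓝 0) := by
    refine tendsto_of_relative (hi := 2 * hi)
      (e := fun q => C₀ * (c * |D| * √2) * √(s q.1 * logDim (p q.1) q.1 / q.1))
      (by simpa using (Tendsto.whp (μ := μ) h.tendsto_sqrt).const_mul (C₀ * (c * |D| * √2)))
      ?_ ?_
    · filter_upwards [hβ, hΛ.whp h.law hη0, Metric.tendsto_nhds.1 hq₀lim (η * lo) (by positivity),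
        Eventually.whp (hdes k hk1), Eventually.whp hD,
        Eventually.whp (hΛ.lower h.tendsto_p h.normalized),
        Eventually.whp (eventually_ge_atTop 1)] with q hq1 hq2 hq3 hq4 hq6 hq7 hq8
      obtain ⟨n, ω⟩ := q
      dsimp only at hq1 hq2 hq3 hq4 hq6 hq7 hq8 ⊢
      have hn0 : (0 : ℝ) < n := by exact_mod_cast hq8
      have hsn : 0 < √(n : ℝ) := Real.sqrt_pos.2 hn0
      have hΛ0 : 0 < Λ n := by linarith
      have hσn := hσb n
      have hσ0 : 0 ≤ σ n := hlo.le.trans hσn.1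
      rw [Real.dist_eq, sub_zero, abs_lt] at hq3
      set w := q₀ ⟨n, ω⟩ with hw
      have hlow : (1 - η) * σ n ≤ w := by nlinarith
      have hlow' : lo / 2 ≤ w := by nlinarith
      set τ := c * Λ n / n with hτ
      obtain ⟨hτ1, hτ2⟩ := penalty_bounds hq8 hq7 hq6 one_pos hc.le (le_refl c)
      rw [← hτ] at hτ1 hτ2
      have hτ0 : 0 < τ := lt_of_lt_of_le (by positivity) hτ1
      have hr' : ‖emb (f n) - design (x n) (β₀ n)‖ ≤ b * (τ * √((2 * s n : ℕ) : ℝ)) * w := by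
        refine (hr n).trans ?_
        rw [Real.sqrt_div' _ hn0.le]
        have e1 : √(s n : ℝ) ≤ √((2 * s n : ℕ) : ℝ) := by
          apply Real.sqrt_le_sqrt; push_cast; linarith [(Nat.cast_nonneg (s n) : (0 : ℝ) ≤ s n)]
        calc Cf * (√(s n : ℝ) / √n) = b * (1 / (2 * √n) * √(s n : ℝ)) * (lo / 2) := by
              rw [hb]; field_simp; norm_num
          _ ≤ b * (τ * √((2 * s n : ℕ) : ℝ)) * w := by gcongr
      have hscore : ScoreLE (design (x n)) (emb fun i => σ n * G n ω i) (θ * τ * w) := by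
        refine scoreLE_of_maxScore_le hq8 hσ0 ?_
        calc σ n * (maxScore (x n) (G n ω) / n) ≤ σ n * ((1 + η) * Λ n / n) := by gcongr
          _ = (1 + η) / (1 - η) * (Λ n / n) * ((1 - η) * σ n) := by
              have : 1 - η ≠ 0 := by linarith
              field_simp
          _ ≤ (1 + η) / (1 - η) * (Λ n / n) * w := by
              have : 0 ≤ (1 + η) / (1 - η) := div_nonneg (by linarith) (by linarith)
              gcongr
          _ = θ * τ * w := by
              have : 1 - η ≠ 0 := by linarith
              rw [hθ, hτ]; field_simp
      rw [isSqrtLasso_iff, h.emb_eq] at hq1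
      rw [h.emb_eq]
      have hdec : emb (f n) + (emb fun i => σ n * G n ω i) = design (x n) (β₀ n) +
          (emb (f n) - design (x n) (β₀ n)) + emb fun i => σ n * G n ω i := by abel
      rw [hdec] at hq1 ⊢
      have hres := hq4.sqrtLasso_residual hθ0 hθ1 hb0 hτ0 hk (hβ₀ n)
        (show 0 < w by linarith) hr' hscore hq1
      refine hres.trans ?_
      gcongr ?_ * _
      have e2 : √((2 * s n : ℕ) : ℝ) = √2 * √(s n : ℝ) := by
        push_cast; exact Real.sqrt_mul (by norm_num) _
      calc C₀ * (τ * √((2 * s n : ℕ) : ℝ))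
          ≤ C₀ * ((c * |D| * √(logDim (p n) n / n)) * √((2 * s n : ℕ) : ℝ)) := by gcongr
        _ = C₀ * (c * |D| * √2) * √(s n * logDim (p n) n / n) := by
            rw [e2, mul_div_assoc, Real.sqrt_mul (by positivity)]; ring
    · filter_upwards [Metric.tendsto_nhds.1 hq₀lim hi hhi] with q hq
      rw [Real.dist_eq, sub_zero, abs_lt] at hq
      exact ⟨norm_nonneg _, by linarith [(hσb q.1).2], norm_nonneg _⟩
  have := key.add hq₀lim
  rw [add_zero] at this
  refine this.congr fun q => ?_
  ring

/-- Square-root Lasso, as a Lasso whose noise level is estimated by its own residuals. -/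
theorem SparseRegression.whp_sqrtLasso (h : SparseRegression μ x s f σ G y)
    (hΛ : IsScoreBound x Λ) {c : ℝ} (hc : 1 < c) {βhat : ∀ n, Ω n → Fin (p n) → ℝ}
    (hβ : ∀ᶠ q in whp μ, IsSqrtLasso (x q.1) (fun i => y q.1 i q.2) (c * Λ q.1)
      (βhat q.1 q.2)) :
    ∃ C : ℝ, 0 ≤ C ∧ ∀ᶠ q in whp μ, ((supp (βhat q.1 q.2)).card : ℝ) ≤ C * s q.1 ∧
      ‖emb (f q.1) - design (x q.1) (βhat q.1 q.2)‖ ≤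
        C * √(s q.1 * logDim (p q.1) q.1 / q.1) := by
  have hlim := h.tendsto_sqrtLasso_residual hΛ hc hβ
  obtain ⟨lo, hi, hlo, hσb⟩ := h.sigma
  refine h.whp_lasso hΛ hc
    (σhat := fun n ω => ‖emb (fun i => y n i ω) - design (x n) (βhat n ω)‖) hlim ?_
  filter_upwards [hβ, Metric.tendsto_nhds.1 hlim lo hlo] with q hq1 hq2
  rw [Real.dist_eq, sub_zero, abs_lt] at hq2
  rw [isSqrtLasso_iff] at hq1
  rw [isLasso_iff]
  have := hq1.lassoMin (by linarith [(hσb q.1).1])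
  convert this using 1
  ring

/-- A feasible Lasso estimator selects at most a multiple of `s` regressors and has the prediction
error `√(s log (p ∨ n) / n)`, with probability tending to one. -/
theorem SparseRegression.whp_feasible (h : SparseRegression μ x s f σ G y)
    {βhat : ∀ n, Ω n → Fin (p n) → ℝ} (hβ : IsFeasibleLasso μ x y σ βhat) :
    ∃ C : ℝ, 0 ≤ C ∧ ∀ᶠ q in whp μ, ((supp (βhat q.1 q.2)).card : ℝ) ≤ C * s q.1 ∧
      ‖emb (f q.1) - design (x q.1) (βhat q.1 q.2)‖ ≤
        C * √(s q.1 * logDim (p q.1) q.1 / q.1) := by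
  obtain ⟨c, hc, γ, hγ, hγ0, hO, hcase⟩ := hβ
  have hL : Tendsto (fun n => logDim (p n) n / n) atTop (𝓝 0) := by
    refine tendsto_of_tendsto_of_tendsto_of_le_of_le' tendsto_const_nhds h.growth ?_ ?_
    · filter_upwards [(tendsto_logDim (p := p)).eventually_ge_atTop 0] with n hn
      positivity
    · filter_upwards [(tendsto_logDim (p := p)).eventually_ge_atTop 0] with n hn
      gcongr
      exact le_mul_of_one_le_left hn (by exact_mod_cast h.one_le_s n)
  have hind := isScoreBound_indepBound h.tendsto_p h.normalized hγ hγ0 hO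
  have hdep := isScoreBound_depBound h.tendsto_p h.normalized hγ hγ0 hO
  have hdepS := isScoreBound_depBoundSqrt h.tendsto_p hL h.normalized hγ hγ0 hO
  rcases hcase with ⟨σhat, hσ, hcase⟩ | hcase | hcase
  · rw [isLittleOP_iff] at hσ
    rcases hcase with hcase | hcase
    · exact h.whp_lasso hind hc hσ (whp_of_ae hcase)
    · exact h.whp_lasso hdep hc hσ (whp_of_ae hcase)
  · exact h.whp_sqrtLasso hdepS hc (whp_of_ae hcase)
  · exact h.whp_sqrtLasso hind hc (whp_of_ae hcase)

end regression

end

section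

/-! ### The partially linear model -/

theorem tendsto_div_of_bdd_below {α : Type*} {l : Filter α} {Z c : α → ℝ} {lo : ℝ} (hlo : 0 < lo)
    (hc : ∀ a, lo ≤ c a) (hZ : Tendsto Z l (𝓝 0)) : Tendsto (fun a => Z a / c a) l (𝓝 0) := by
  have h := hZ.abs.div_const lo
  rw [abs_zero, zero_div] at h
  refine squeeze_zero_norm (fun a => ?_) h
  rw [Real.norm_eq_abs, abs_div, abs_of_pos (hlo.trans_le (hc a))]
  gcongr
  exact hc a

theorem tendsto_mul_of_bdd {α : Type*} {l : Filter α} {Z c : α → ℝ} {hi : ℝ}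
    (hc : ∀ a, |c a| ≤ hi) (hZ : Tendsto Z l (𝓝 0)) :
    Tendsto (fun a => c a * Z a) l (𝓝 0) := by
  have h := hZ.abs.const_mul hi
  rw [abs_zero, mul_zero] at h
  refine squeeze_zero_norm (fun a => ?_) h
  rw [Real.norm_eq_abs, abs_mul]
  gcongr
  exact hc a

/-- The limit of the studentized estimation error, from the consistency of the variance estimators
and the expansion of the estimator. -/
theorem tendsto_studentized {α : Type*} {l : Filter α} {S V W T e N D σζ σv : α → ℝ} {lo : ℝ}
    (hlo : 0 < lo) (hζ : ∀ a, lo ≤ σζ a) (hv : ∀ a, lo ≤ σv a)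
    (hS : Tendsto (fun a => S a / σζ a ^ 2) l (𝓝 1))
    (hV : Tendsto (fun a => V a / σv a ^ 2) l (𝓝 1))
    (hW : Tendsto (fun a => W a / σv a ^ 2) l (𝓝 1)) (hT : Tendsto (fun a => T a / σv a) l (𝓝 1))
    (he : Tendsto e l (𝓝 0)) (hD : ∀ᶠ a in l, W a * D a = N a * σζ a * T a + e a)
    (hN : ∀ Z : α → ℝ, Tendsto Z l (𝓝 0) → Tendsto (fun a => Z a * N a) l (𝓝 0)) :
    Tendsto (fun a => (S a * (V a)⁻¹) ^ (-(1 / 2) : ℝ) * D a - N a) l (𝓝 0) := by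
  have hF : Tendsto (fun a => (S a / σζ a ^ 2 * (V a / σv a ^ 2)⁻¹) ^ (-(1 / 2) : ℝ) *
      (W a / σv a ^ 2)⁻¹) l (𝓝 1) := by
    have h1 := (hS.mul (hV.inv₀ one_ne_zero)).rpow_const (p := (-(1 / 2) : ℝ)) (Or.inl (by norm_num))
    have h2 := h1.mul (hW.inv₀ one_ne_zero)
    simpa using h2
  have hmain := hN _ (by simpa using (hF.mul hT).sub_const 1)
  have hrest := hF.mul (tendsto_div_of_bdd_below (c := fun a => σv a * σζ a)
    (mul_pos hlo hlo) (fun a => mul_le_mul (hv a) (hζ a) hlo.le (hlo.le.trans (hv a))) he)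
  have hsum := hmain.add hrest
  rw [mul_zero, add_zero] at hsum
  refine hsum.congr' ?_
  filter_upwards [hD, hS.eventually (lt_mem_nhds one_pos), hV.eventually (lt_mem_nhds one_pos),
    hW.eventually (lt_mem_nhds one_pos)] with a h1 h2 h3 h4
  have hσζ : 0 < σζ a := hlo.trans_le (hζ a)
  have hσv : 0 < σv a := hlo.trans_le (hv a)
  have hS0 : 0 < S a := by
    have := mul_pos h2 (pow_pos hσζ 2); rwa [div_mul_cancel₀ _ (by positivity)] at this
  have hV0 : 0 < V a := by
    have := mul_pos h3 (pow_pos hσv 2); rwa [div_mul_cancel₀ _ (by positivity)] at this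
  have hW0 : 0 < W a := by
    have := mul_pos h4 (pow_pos hσv 2); rwa [div_mul_cancel₀ _ (by positivity)] at this
  have hDa : D a = (N a * σζ a * T a + e a) / W a := by
    rw [eq_div_iff hW0.ne', mul_comm]; exact h1
  have hfac : (S a * (V a)⁻¹) ^ (-(1 / 2) : ℝ) =
      (S a / σζ a ^ 2 * (V a / σv a ^ 2)⁻¹) ^ (-(1 / 2) : ℝ) * (σv a / σζ a) := by
    have h5 : S a * (V a)⁻¹ =
        S a / σζ a ^ 2 * (V a / σv a ^ 2)⁻¹ * ((σv a / σζ a)⁻¹) ^ (2 : ℝ) := by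
      rw [Real.rpow_two]; field_simp
    rw [h5, Real.mul_rpow (by positivity) (by positivity), ← Real.rpow_mul (by positivity)]
    congr 1
    norm_num
    rw [Real.rpow_neg_one, inv_div]
  rw [hDa, hfac]
  field_simp
  ring

section

variable {Ω : ℕ → Type*} [∀ n, MeasurableSpace (Ω n)] {μ : ∀ n, Measure (Ω n)}

/-- Scaled inner products of Gaussian noise with vanishing fixed vectors vanish. -/
theorem tendsto_sqrt_mul_inner {G : ∀ n, Ω n → Fin n → ℝ}
    (hG : ∀ n, HasLaw (G n) (stdGaussian n) (μ n)) {r : ∀ n, Fin n → ℝ}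
    (hr : Tendsto (fun n => ‖emb (r n)‖) atTop (𝓝 0)) :
    Tendsto (fun q : Σ n, Ω n => √(q.1 : ℝ) * inner ℝ (emb (G q.1 q.2)) (emb (r q.1)))
      (whp μ) (𝓝 0) := by
  rw [← isLittleOP_iff (Z := fun n ω => √(n : ℝ) * inner ℝ (emb (G n ω)) (emb (r n)))]
  intro ε hε
  have hlim : Tendsto (fun n => ENNReal.ofReal (‖emb (r n)‖ ^ 2 / ε ^ 2)) atTop (𝓝 0) := by
    rw [← ENNReal.ofReal_zero]
    refine ENNReal.tendsto_ofReal ?_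
    simpa using (hr.pow 2).div_const (ε ^ 2)
  refine tendsto_of_tendsto_of_tendsto_of_le_of_le tendsto_const_nhds hlim
    (fun _ => zero_le) fun n => ?_
  set c : ℝ≥0 := .mk (‖emb (r n)‖ ^ 2) (by positivity) with hc
  have hsum : (c : ℝ) = ∑ i, (r n i / √n) ^ 2 := by
    simp only [hc, NNReal.coe_mk, norm_emb_sq, En, div_pow, Real.sq_sqrt (Nat.cast_nonneg n),
      Finset.sum_div]
  have hlaw := (hasLaw_linear_stdGaussian (fun i => r n i / √n) hsum).comp (hG n)
  have heq : ∀ ω, √(n : ℝ) * inner ℝ (emb (G n ω)) (emb (r n)) =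
      ((fun g : Fin n → ℝ => ∑ i, r n i / √n * g i) ∘ G n) ω := by
    intro ω
    rcases Nat.eq_zero_or_pos n with rfl | hn
    · simp
    have hn0 : (0 : ℝ) < n := by exact_mod_cast hn
    have hsn : 0 < √(n : ℝ) := Real.sqrt_pos.2 hn0
    have hsq : (n : ℝ) = √n * √n := (Real.mul_self_sqrt hn0.le).symm
    rw [inner_emb, En, Function.comp_apply, mul_div_assoc', Finset.mul_sum, Finset.sum_div]
    refine Finset.sum_congr rfl fun i _ => ?_
    generalize √(n : ℝ) = w at *
    rw [hsq]
    field_simp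
  simp only [heq]
  rw [hlaw.measure_eq (p := fun t => ε < |t|) (measurableSet_lt measurable_const (by fun_prop))]
  have hcheb := meas_ge_le_variance_div_sq (μ := gaussianReal 0 c) (X := id)
    (memLp_id_gaussianReal 2) hε
  rw [variance_id_gaussianReal] at hcheb
  refine (measure_mono fun t ht => ?_).trans hcheb
  have ht' : ε < |t| := ht
  show ε ≤ |id t - ∫ x, id x ∂gaussianReal 0 c|
  have h0 : ∫ x, id x ∂gaussianReal 0 c = 0 := integral_id_gaussianReal
  rw [h0, sub_zero]
  exact ht'.le

end

namespace ConditionASTE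

variable {Ω : ℕ → Type*} [∀ n, MeasurableSpace (Ω n)] {μ : ∀ n, Measure (Ω n)}
  {𝒵 : ℕ → Type*} {p s : ℕ → ℕ} {z : ∀ n, Fin n → 𝒵 n} {P : ∀ n, 𝒵 n → Fin (p n) → ℝ}
  {m g : ∀ n, 𝒵 n → ℝ} {α₀ : ℕ → ℝ} {σζ σv : ℕ → ℝ≥0} {ζ v y d : ∀ n, Fin n → Ω n → ℝ}
  {I₁ I₂ I₃ : ∀ n, Ω n → Finset (Fin (p n))}

theorem exists_sigma_bounds (h : ConditionASTE μ s z P m g α₀ σζ σv ζ v y d I₁ I₂ I₃) :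
    ∃ lo hi : ℝ, 0 < lo ∧ 0 < hi ∧
      ∀ n, (lo ≤ σv n ∧ (σv n : ℝ) ≤ hi) ∧ (lo ≤ σζ n ∧ (σζ n : ℝ) ≤ hi) := by
  obtain ⟨lo, hi, -, hlo, hv, hζ, -⟩ := h.variances_and_approximation
  have hhi : 0 < hi := hlo.trans_le ((hv 0).1.trans (hv 0).2)
  refine ⟨√lo, √hi, Real.sqrt_pos.2 hlo, Real.sqrt_pos.2 hhi, fun n => ⟨⟨?_, ?_⟩, ?_, ?_⟩⟩
  · exact Real.sqrt_le_iff.2 ⟨NNReal.coe_nonneg _, (hv n).1⟩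
  · exact Real.le_sqrt_of_sq_le (hv n).2
  · exact Real.sqrt_le_iff.2 ⟨NNReal.coe_nonneg _, (hζ n).1⟩
  · exact Real.le_sqrt_of_sq_le (hζ n).2

/-- The approximation errors of both regression functions. -/
theorem exists_approx (h : ConditionASTE μ s z P m g α₀ σζ σv ζ v y d I₁ I₂ I₃) :
    ∃ C : ℝ, 0 ≤ C ∧ ∃ βm βg : ∀ n, Fin (p n) → ℝ, ∀ n,
      (supp (βm n)).card ≤ s n ∧ (supp (βg n)).card ≤ s n ∧
      ‖(emb fun i => m n (z n i)) - design (fun i => P n (z n i)) (βm n)‖ ≤ C * √(s n / n) ∧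
      ‖(emb fun i => g n (z n i)) - design (fun i => P n (z n i)) (βg n)‖ ≤ C * √(s n / n) := by
  obtain ⟨-, hi, K, -, -, -, hm, hg⟩ := h.variances_and_approximation
  choose βm hm₁ hm₂ using hm
  choose βg hg₁ hg₂ using hg
  refine ⟨|K * hi|, abs_nonneg _, βm, βg, fun n => ⟨hm₁ n, hg₁ n, ?_, ?_⟩⟩
  · rw [design_apply, ← map_sub, norm_emb]
    exact (hm₂ n).trans (by gcongr; exact le_abs_self _)
  · rw [design_apply, ← map_sub, norm_emb]
    exact (hg₂ n).trans (by gcongr; exact le_abs_self _)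

/-- The rate `s log (p ∨ n) / n` is of smaller order than `1 / √n`. -/
theorem tendsto_sqrt_mul_rate (h : ConditionASTE μ s z P m g α₀ σζ σv ζ v y d I₁ I₂ I₃) :
    Tendsto (fun n : ℕ => √(n : ℝ) * (s n * logDim (p n) n / n)) atTop (𝓝 0) := by
  have h1 := h.growth.tendsto_div_nhds_zero.sqrt
  rw [Real.sqrt_zero] at h1
  refine h1.congr' ?_
  filter_upwards [eventually_ge_atTop 1, (tendsto_logDim (p := p)).eventually_ge_atTop 0]
    with n hn hL
  have hn0 : (0 : ℝ) < n := by exact_mod_cast hn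
  have hsn : 0 < √(n : ℝ) := Real.sqrt_pos.2 hn0
  have hsq : √(n : ℝ) * √n = n := Real.mul_self_sqrt hn0.le
  rw [Real.sqrt_div' _ hn0.le, ← mul_pow, div_eq_iff hsn.ne']
  change √((s n * logDim (p n) n) ^ 2) = _
  rw [Real.sqrt_sq (by positivity), mul_right_comm, hsq]
  field_simp

theorem tendsto_rate (h : ConditionASTE μ s z P m g α₀ σζ σv ζ v y d I₁ I₂ I₃) :
    Tendsto (fun n : ℕ => s n * logDim (p n) n / n) atTop (𝓝 0) := by
  refine tendsto_of_tendsto_of_tendsto_of_le_of_le' tendsto_const_nhds h.tendsto_sqrt_mul_rate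
    ?_ ?_
  · filter_upwards [(tendsto_logDim (p := p)).eventually_ge_atTop 0] with n hL
    positivity
  · filter_upwards [(tendsto_logDim (p := p)).eventually_ge_atTop 0, eventually_ge_atTop 1]
      with n hL hn
    refine le_mul_of_one_le_left (by positivity) (Real.one_le_sqrt.2 (by exact_mod_cast hn))

/-- The regression of the treatment on the controls. -/
theorem treatmentRegression (h : ConditionASTE μ s z P m g α₀ σζ σv ζ v y d I₁ I₂ I₃)
    (hp : Tendsto p atTop atTop) :
    SparseRegression μ (fun n i => P n (z n i)) s (fun n i => m n (z n i)) (fun n => σv n)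
      (fun n ω i => v n i ω / σv n) d := by
  obtain ⟨lo, hi, hlo, -, hσ⟩ := h.exists_sigma_bounds
  have hv0 : ∀ n, (0 : ℝ) < σv n := fun n => hlo.trans_le (hσ n).1.1
  have hζ0 : ∀ n, (0 : ℝ) < σζ n := fun n => hlo.trans_le (hσ n).2.1
  obtain ⟨C, hC, βm, βg, hβ⟩ := h.exists_approx
  refine ⟨hp, h.normalized, h.sparse_eigenvalues, h.one_le_s, h.tendsto_rate,
    ⟨C, hC, fun n => ⟨βm n, by have := (hβ n).1; omega, (hβ n).2.2.1⟩⟩,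
    ⟨lo, hi, hlo, fun n => (hσ n).1⟩, fun n => (h.model n).hasLaw_v (hζ0 n) (hv0 n),
    fun n i ω => ?_⟩
  rw [(h.model n).treatment, mul_div_cancel₀ _ (hv0 n).ne']

/-- The reduced form regression of the outcome on the controls. -/
theorem outcomeRegression (h : ConditionASTE μ s z P m g α₀ σζ σv ζ v y d I₁ I₂ I₃)
    (hp : Tendsto p atTop atTop) :
    SparseRegression μ (fun n i => P n (z n i)) s
      (fun n i => α₀ n * m n (z n i) + g n (z n i))
      (fun n => √(α₀ n ^ 2 * (σv n : ℝ) ^ 2 + (σζ n : ℝ) ^ 2))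
      (fun n ω i => (α₀ n * v n i ω + ζ n i ω) /
        √(α₀ n ^ 2 * (σv n : ℝ) ^ 2 + (σζ n : ℝ) ^ 2)) y := by
  obtain ⟨lo, hi, hlo, hhi, hσ⟩ := h.exists_sigma_bounds
  have hζ0 : ∀ n, (0 : ℝ) < σζ n := fun n => hlo.trans_le (hσ n).2.1
  obtain ⟨C, hC, βm, βg, hβ⟩ := h.exists_approx
  obtain ⟨A, hA⟩ := h.alpha_bounded
  have hA0 : 0 ≤ A := (abs_nonneg _).trans (hA 0)
  refine ⟨hp, h.normalized, h.sparse_eigenvalues, h.one_le_s, h.tendsto_rate,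
    ⟨A * C + C, by positivity, fun n => ⟨α₀ n • βm n + βg n, ?_, ?_⟩⟩,
    ⟨lo, √(A ^ 2 * hi ^ 2 + hi ^ 2), hlo, fun n => ⟨?_, ?_⟩⟩,
    fun n => (h.model n).hasLaw_reducedForm (hζ0 n), fun n i ω => ?_⟩
  · have h1 := supp_add_card_le (α₀ n • βm n) (βg n)
    have h2 := supp_smul_card_le (α₀ n) (βm n)
    have h3 := (hβ n).1
    have h4 := (hβ n).2.1
    omega
  · have h1 : (emb fun i => α₀ n * m n (z n i) + g n (z n i)) -
        design (fun i => P n (z n i)) (α₀ n • βm n + βg n) =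
        α₀ n • ((emb fun i => m n (z n i)) - design (fun i => P n (z n i)) (βm n)) +
        ((emb fun i => g n (z n i)) - design (fun i => P n (z n i)) (βg n)) := by
      have : (emb fun i => α₀ n * m n (z n i) + g n (z n i)) =
          α₀ n • (emb fun i => m n (z n i)) + emb fun i => g n (z n i) := by
        rw [← map_smul, ← map_add]; rfl
      rw [this, map_add, map_smul, smul_sub]; abel
    rw [h1]
    refine (norm_add_le _ _).trans ?_
    rw [norm_smul, Real.norm_eq_abs, add_mul, mul_assoc]
    exact add_le_add (mul_le_mul (hA n) (hβ n).2.2.1 (norm_nonneg _) hA0) (hβ n).2.2.2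
  · apply Real.le_sqrt_of_sq_le
    have := (hσ n).2.1
    nlinarith [sq_nonneg (α₀ n * (σv n : ℝ))]
  · apply Real.sqrt_le_sqrt
    have h1 : α₀ n ^ 2 ≤ A ^ 2 := by
      rw [← sq_abs]; exact pow_le_pow_left₀ (abs_nonneg _) (hA n) 2
    have h2 := (hσ n).1.2
    have h3 := (hσ n).2.2
    gcongr
  · have hpos : 0 < √(α₀ n ^ 2 * (σv n : ℝ) ^ 2 + (σζ n : ℝ) ^ 2) := by
      have := hζ0 n; positivity
    rw [(h.model n).outcome, (h.model n).treatment, mul_div_cancel₀ _ hpos.ne']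
    ring

/-- The selected controls number at most a multiple of `s`. -/
theorem whp_card_le (h : ConditionASTE μ s z P m g α₀ σζ σv ζ v y d I₁ I₂ I₃)
    {I : ∀ n, Ω n → Finset (Fin (p n))} (hI : ∀ n ω, I n ω = I₁ n ω ∪ I₂ n ω ∪ I₃ n ω)
    {C₁ C₂ : ℝ} (h₁ : ∀ᶠ q in whp μ, ((I₁ q.1 q.2).card : ℝ) ≤ C₁ * s q.1)
    (h₂ : ∀ᶠ q in whp μ, ((I₂ q.1 q.2).card : ℝ) ≤ C₂ * s q.1) :
    ∃ C : ℕ, ∀ᶠ q in whp μ, (I q.1 q.2).card ≤ C * s q.1 := by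
  obtain ⟨C, hC⟩ := h.extra_controls
  obtain ⟨k, hk⟩ := exists_nat_ge (|C₁| + |C₂| + |C| * (1 + |C₁| + |C₂|))
  refine ⟨k, ?_⟩
  filter_upwards [h₁, h₂, whp_of_ae hC] with q h1 h2 h3
  obtain ⟨n, ω⟩ := q
  dsimp only at h1 h2 h3 ⊢
  have hs : (1 : ℝ) ≤ s n := by exact_mod_cast h.one_le_s n
  have h1' : ((I₁ n ω).card : ℝ) ≤ |C₁| * s n := h1.trans (by gcongr; exact le_abs_self _)
  have h2' : ((I₂ n ω).card : ℝ) ≤ |C₂| * s n := h2.trans (by gcongr; exact le_abs_self _)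
  have hmax : max 1 (max ((I₁ n ω).card : ℝ) (I₂ n ω).card) ≤ (1 + |C₁| + |C₂|) * s n := by
    have e1 : 0 ≤ |C₁| * s n := by positivity
    have e2 : 0 ≤ |C₂| * s n := by positivity
    refine max_le (by nlinarith) (max_le (by nlinarith) (by nlinarith))
  have h3' : ((I₃ n ω).card : ℝ) ≤ |C| * ((1 + |C₁| + |C₂|) * s n) := by
    refine h3.trans ?_
    have : (0 : ℝ) ≤ max 1 (max ((I₁ n ω).card : ℝ) (I₂ n ω).card) :=
      zero_le_one.trans (le_max_left _ _)
    calc C * max 1 (max ((I₁ n ω).card : ℝ) (I₂ n ω).card)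
        ≤ |C| * max 1 (max ((I₁ n ω).card : ℝ) (I₂ n ω).card) := by gcongr; exact le_abs_self _
      _ ≤ _ := by gcongr
  have hcard : ((I n ω).card : ℝ) ≤ (I₁ n ω).card + (I₂ n ω).card + (I₃ n ω).card := by
    rw [hI]
    exact_mod_cast (Finset.card_union_le _ _).trans
      (Nat.add_le_add_right (Finset.card_union_le _ _) _)
  have : ((I n ω).card : ℝ) ≤ (k * s n : ℕ) := by
    push_cast
    calc ((I n ω).card : ℝ) ≤ (|C₁| + |C₂| + |C| * (1 + |C₁| + |C₂|)) * s n := by linarith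
      _ ≤ k * s n := by gcongr
  exact_mod_cast this

end ConditionASTE

end

section

/-! ### Double selection -/

theorem IsFeasibleLasso.exists_isScoreBound {Ω : ℕ → Type*} [∀ n, MeasurableSpace (Ω n)]
    {μ : ∀ n, Measure (Ω n)} {p : ℕ → ℕ} {x : ∀ n, Fin n → Fin (p n) → ℝ}
    {y : ∀ n, Fin n → Ω n → ℝ} {σ : ℕ → ℝ} {βhat : ∀ n, Ω n → Fin (p n) → ℝ}
    (h : IsFeasibleLasso μ x y σ βhat) (hp : Tendsto p atTop atTop)
    (hx : ∀ n, 1 ≤ n → ∀ j, (En fun i => x n i j ^ 2) = 1) : ∃ Λ, IsScoreBound x Λ := by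
  obtain ⟨c, -, γ, hγ, hγ0, hO, -⟩ := h
  exact ⟨_, isScoreBound_indepBound hp hx hγ hγ0 hO⟩

/-- Scores of Gaussian noise are of the order `√(log (p ∨ n) / n)`. -/
theorem IsScoreBound.whp_scoreLE {Ω : ℕ → Type*} [∀ n, MeasurableSpace (Ω n)]
    {μ : ∀ n, Measure (Ω n)} {p : ℕ → ℕ} {x : ∀ n, Fin n → Fin (p n) → ℝ} {Λ : ℕ → ℝ}
    (h : IsScoreBound x Λ) : ∃ C : ℝ, 0 ≤ C ∧ ∀ (G : ∀ n, Ω n → Fin n → ℝ) (σ : ℕ → ℝ) (hi : ℝ),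
      (∀ n, HasLaw (G n) (stdGaussian n) (μ n)) → (∀ n, 0 ≤ σ n ∧ σ n ≤ hi) →
      ∀ᶠ q in DoublePostLasso.whp μ, ScoreLE (design (x q.1)) (emb fun i => σ q.1 * G q.1 q.2 i)
        (hi * C * √(logDim (p q.1) q.1 / q.1)) := by
  obtain ⟨D, hD⟩ := h.upper
  refine ⟨2 * |D|, by positivity, fun G σ hi hG hσ => ?_⟩
  filter_upwards [h.whp hG one_pos, Eventually.whp hD, Eventually.whp (eventually_ge_atTop 1)]
    with q h1 h2 h3
  obtain ⟨n, ω⟩ := q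
  dsimp only at h1 h2 h3 ⊢
  have hn0 : (0 : ℝ) < n := by exact_mod_cast h3
  refine scoreLE_of_maxScore_le h3 (hσ n).1 ?_
  have h4 : maxScore (x n) (G n ω) / n ≤ 2 * |D| * √(logDim (p n) n / n) := by
    rw [div_le_iff₀ hn0]
    have e1 : √(n * logDim (p n) n) = √(logDim (p n) n / n) * n := by
      have e2 : (n : ℝ) * logDim (p n) n = logDim (p n) n / n * n ^ 2 := by field_simp
      rw [e2, Real.sqrt_mul' _ (by positivity), Real.sqrt_sq hn0.le]
    calc maxScore (x n) (G n ω) ≤ (1 + 1) * (|D| * √(n * logDim (p n) n)) := by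
          refine h1.trans ?_
          gcongr
          exact h2.trans (by gcongr; exact le_abs_self _)
      _ = _ := by rw [e1]; ring
  have h5 : 0 ≤ maxScore (x n) (G n ω) / n := div_nonneg (maxScore_nonneg _ _) hn0.le
  calc σ n * (maxScore (x n) (G n ω) / n) ≤ hi * (2 * |D| * √(logDim (p n) n / n)) :=
        mul_le_mul (hσ n).2 h4 h5 ((hσ n).1.trans (hσ n).2)
    _ = _ := by ring

namespace ConditionASTE

variable {Ω : ℕ → Type*} [∀ n, MeasurableSpace (Ω n)] {μ : ∀ n, Measure (Ω n)}
  {𝒵 : ℕ → Type*} {p s : ℕ → ℕ} {z : ∀ n, Fin n → 𝒵 n} {P : ∀ n, 𝒵 n → Fin (p n) → ℝ}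
  {m g : ∀ n, 𝒵 n → ℝ} {α₀ : ℕ → ℝ} {σζ σv : ℕ → ℝ≥0} {ζ v y d : ∀ n, Fin n → Ω n → ℝ}
  {βhat₁ βhat₂ : ∀ n, Ω n → Fin (p n) → ℝ} {I₃ I : ∀ n, Ω n → Finset (Fin (p n))}

/-- With probability tending to one, the hypotheses of the deterministic double selection argument
hold, with errors of the order `√(s log (p ∨ n) / n)`. -/
theorem whp_selectionBounds
    (h : ConditionASTE μ s z P m g α₀ σζ σv ζ v y d (fun n ω => supp (βhat₁ n ω))
      (fun n ω => supp (βhat₂ n ω)) I₃)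
    (hp : Tendsto p atTop atTop)
    (hβ₁ : IsFeasibleLasso μ (fun n i => P n (z n i)) d (fun n => (σv n : ℝ)) βhat₁)
    (hβ₂ : IsFeasibleLasso μ (fun n i => P n (z n i)) y
      (fun n => √(α₀ n ^ 2 * (σv n : ℝ) ^ 2 + (σζ n : ℝ) ^ 2)) βhat₂)
    (hI : ∀ n ω, I n ω = supp (βhat₁ n ω) ∪ supp (βhat₂ n ω) ∪ I₃ n ω) :
    ∃ (a A C : ℝ) (k : ℕ) (t : (Σ n, Ω n) → ℝ) (κ : (Σ n, Ω n) → ℝ)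
      (βm βg : ∀ n, Fin (p n) → ℝ),
      Tendsto (fun q => √(q.1 : ℝ) * κ q) (whp μ) (𝓝 0) ∧
      (∀ᶠ q in whp μ, (I q.1 q.2).card ≤ k * s q.1) ∧
      ∀ᶠ q in whp μ, SelectionBounds (design fun i => P q.1 (z q.1 i)) (I q.1 q.2) (α₀ q.1)
        (emb fun i => m q.1 (z q.1 i)) (emb fun i => g q.1 (z q.1 i)) (emb fun i => v q.1 i q.2)
        (emb fun i => ζ q.1 i q.2) (βm q.1) (βg q.1) (βhat₁ q.1 q.2) (βhat₂ q.1 q.2)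
        ((k + 1) * s q.1) a A (C * √(s q.1 * logDim (p q.1) q.1 / q.1)) (t q) (κ q) := by
  obtain ⟨lo, hi, hlo, hhi, hσ⟩ := h.exists_sigma_bounds
  have hv0 : ∀ n, (0 : ℝ) < σv n := fun n => hlo.trans_le (hσ n).1.1
  have hζ0 : ∀ n, (0 : ℝ) < σζ n := fun n => hlo.trans_le (hσ n).2.1
  have hGv := fun n => (h.model n).hasLaw_v (hζ0 n) (hv0 n)
  have hGζ := fun n => (h.model n).hasLaw_ζ (hζ0 n) (hv0 n)
  have hev : ∀ n ω, (emb fun i => v n i ω) = (σv n : ℝ) • emb fun i => v n i ω / σv n := by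
    intro n ω
    rw [← map_smul]; congr 1; ext i
    simp [mul_div_cancel₀ _ (hv0 n).ne']
  have heζ : ∀ n ω, (emb fun i => ζ n i ω) = (σζ n : ℝ) • emb fun i => ζ n i ω / σζ n := by
    intro n ω
    rw [← map_smul]; congr 1; ext i
    simp [mul_div_cancel₀ _ (hζ0 n).ne']
  obtain ⟨C₀, hC₀, βm, βg, happ⟩ := h.exists_approx
  obtain ⟨A, hA⟩ := h.alpha_bounded
  obtain ⟨C₁, hC₁, h₁⟩ := (h.treatmentRegression hp).whp_feasible hβ₁
  obtain ⟨C₂, hC₂, h₂⟩ := (h.outcomeRegression hp).whp_feasible hβ₂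
  obtain ⟨k, hk⟩ := h.whp_card_le hI (h₁.mono fun q hq => hq.1) (h₂.mono fun q hq => hq.1)
  obtain ⟨a, M, ha, hM, hsparse⟩ := h.sparse_eigenvalues.exists_sparse_bounds
  obtain ⟨Λ, hΛ⟩ := hβ₁.exists_isScoreBound hp h.normalized
  obtain ⟨D, hD, hscore⟩ := hΛ.whp_scoreLE (μ := μ)
  -- the approximation errors, as fixed vectors
  set rm : ∀ n, Fin n → ℝ := fun n i => m n (z n i) - P n (z n i) ⬝ᵥ βm n with hrm
  set rg : ∀ n, Fin n → ℝ := fun n i => g n (z n i) - P n (z n i) ⬝ᵥ βg n with hrg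
  have herm : ∀ n, emb (rm n) =
      (emb fun i => m n (z n i)) - design (fun i => P n (z n i)) (βm n) := fun n => by
    rw [design_apply, ← map_sub]; rfl
  have herg : ∀ n, emb (rg n) =
      (emb fun i => g n (z n i)) - design (fun i => P n (z n i)) (βg n) := fun n => by
    rw [design_apply, ← map_sub]; rfl
  have hL1 := (tendsto_logDim (p := p)).eventually_ge_atTop 1
  have hrate_le : ∀ᶠ n : ℕ in atTop, √((s n : ℝ) / n) ≤ √(s n * logDim (p n) n / n) := by
    filter_upwards [hL1] with n hL
    apply Real.sqrt_le_sqrt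
    gcongr
    exact le_mul_of_one_le_right (Nat.cast_nonneg _) hL
  have hsqrt : Tendsto (fun n => C₀ * √(s n * logDim (p n) n / n)) atTop (𝓝 0) := by
    simpa using (h.tendsto_rate.sqrt).const_mul C₀
  have hrm0 : Tendsto (fun n => ‖emb (rm n)‖) atTop (𝓝 0) := by
    refine squeeze_zero' (Eventually.of_forall fun _ => norm_nonneg _) ?_ hsqrt
    filter_upwards [hrate_le] with n hn
    rw [herm]
    exact (happ n).2.2.1.trans (by gcongr)
  have hrg0 : Tendsto (fun n => ‖emb (rg n)‖) atTop (𝓝 0) := by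
    refine squeeze_zero' (Eventually.of_forall fun _ => norm_nonneg _) ?_ hsqrt
    filter_upwards [hrate_le] with n hn
    rw [herg]
    exact (happ n).2.2.2.trans (by gcongr)
  set κ : (Σ n, Ω n) → ℝ := fun q =>
    |inner ℝ (emb fun i => v q.1 i q.2) (emb (rm q.1))| +
    |inner ℝ (emb fun i => v q.1 i q.2) (emb (rg q.1))| +
    |inner ℝ (emb fun i => ζ q.1 i q.2) (emb (rm q.1))| with hκ
  have hκ0 : Tendsto (fun q => √(q.1 : ℝ) * κ q) (whp μ) (𝓝 0) := by
    have e1 := (tendsto_mul_of_bdd (c := fun q : Σ n, Ω n => (σv q.1 : ℝ)) (hi := hi)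
      (fun q => by rw [abs_of_pos (hv0 q.1)]; exact (hσ q.1).1.2)
      (tendsto_sqrt_mul_inner hGv hrm0)).abs
    have e2 := (tendsto_mul_of_bdd (c := fun q : Σ n, Ω n => (σv q.1 : ℝ)) (hi := hi)
      (fun q => by rw [abs_of_pos (hv0 q.1)]; exact (hσ q.1).1.2)
      (tendsto_sqrt_mul_inner hGv hrg0)).abs
    have e3 := (tendsto_mul_of_bdd (c := fun q : Σ n, Ω n => (σζ q.1 : ℝ)) (hi := hi)
      (fun q => by rw [abs_of_pos (hζ0 q.1)]; exact (hσ q.1).2.2)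
      (tendsto_sqrt_mul_inner hGζ hrm0)).abs
    have e4 := (e1.add e2).add e3
    simp only [abs_zero, add_zero] at e4
    refine e4.congr fun q => ?_
    rw [hκ]
    simp only [hev, heζ, real_inner_smul_left, abs_mul, abs_of_nonneg (Real.sqrt_nonneg _)]
    ring
  refine ⟨a, A, C₀ + C₁ + C₂ + √((k + 1 : ℕ) : ℝ) * (hi * D) / a, k,
    fun q => hi * D * √(logDim (p q.1) q.1 / q.1), κ, βm, βg, hκ0, hk, ?_⟩
  filter_upwards [h₁, h₂, hk, Eventually.whp (hsparse (k + 1)), Eventually.whp hrate_le,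
    hscore _ (fun n => (σv n : ℝ)) hi hGv fun n => ⟨(hv0 n).le, (hσ n).1.2⟩,
    hscore _ (fun n => (σζ n : ℝ)) hi hGζ fun n => ⟨(hζ0 n).le, (hσ n).2.2⟩]
    with q hq₁ hq₂ hqk hqs hqr hqv hqζ
  obtain ⟨n, ω⟩ := q
  dsimp only at hq₁ hq₂ hqk hqs hqr hqv hqζ ⊢
  set R := √(s n * logDim (p n) n / n) with hR
  have hR0 : 0 ≤ R := Real.sqrt_nonneg _
  have hE0 : 0 ≤ √((k + 1 : ℕ) : ℝ) * (hi * D) / a := by positivity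
  have hfn : (emb fun i => α₀ n * m n (z n i) + g n (z n i)) =
      α₀ n • (emb fun i => m n (z n i)) + emb fun i => g n (z n i) := by
    rw [← map_smul, ← map_add]; rfl
  have hle : ∀ c, 0 ≤ c → c ≤ C₀ + C₁ + C₂ + √((k + 1 : ℕ) : ℝ) * (hi * D) / a →
      ∀ b : ℝ, b ≤ c * R → b ≤ (C₀ + C₁ + C₂ + √((k + 1 : ℕ) : ℝ) * (hi * D) / a) * R :=
    fun c _ hc b hb => hb.trans (mul_le_mul_of_nonneg_right hc hR0)
  have hsubset₁ : supp (βhat₁ n ω) ⊆ I n ω := by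
    rw [hI]; exact Finset.subset_union_left.trans Finset.subset_union_left
  have hsubset₂ : supp (βhat₂ n ω) ⊆ I n ω := by
    rw [hI]; exact Finset.subset_union_right.trans Finset.subset_union_left
  constructor
  case a_pos => exact ha
  case R_nonneg => positivity
  case t_nonneg => positivity
  case alpha => exact hA n
  case lower => exact hqs.1
  case card_m => have := (happ n).1; rw [add_mul]; omega
  case card_g => have := (happ n).2.1; rw [add_mul]; omega
  case mem_one => exact mem_modelSpace_of_supp_subset hsubset₁
  case mem_two => exact mem_modelSpace_of_supp_subset hsubset₂
  case rate_one => exact hle C₁ hC₁ (by linarith) _ hq₁.2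
  case rate_two => rw [← hfn]; exact hle C₂ hC₂ (by linarith) _ hq₂.2
  case approx_m =>
    exact hle C₀ hC₀ (by linarith) _ ((happ n).2.2.1.trans (by gcongr))
  case approx_g =>
    exact hle C₀ hC₀ (by linarith) _ ((happ n).2.2.2.trans (by gcongr))
  case score_v =>
    convert hqv using 3
    rw [mul_div_cancel₀ _ (hv0 n).ne']
  case score_ζ =>
    convert hqζ using 3
    rw [mul_div_cancel₀ _ (hζ0 n).ne']
  case score_R =>
    have e1 : √(((k + 1) * s n : ℕ) : ℝ) * (hi * D * √(logDim (p n) n / n)) =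
        a * (√((k + 1 : ℕ) : ℝ) * (hi * D) / a * R) := by
      have e2 : R = √(s n) * √(logDim (p n) n / n) := by
        rw [hR, ← Real.sqrt_mul (Nat.cast_nonneg (s n)), mul_div_assoc]
      rw [e2, Nat.cast_mul, Real.sqrt_mul (Nat.cast_nonneg (k + 1))]
      field_simp
    rw [e1]
    gcongr
    linarith
  case inner_v_m =>
    rw [← herm]
    exact (le_add_of_nonneg_right (abs_nonneg _)).trans (le_add_of_nonneg_right (abs_nonneg _))
  case inner_v_g =>
    rw [← herg]
    exact (le_add_of_nonneg_left (abs_nonneg _)).trans (le_add_of_nonneg_right (abs_nonneg _))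
  case inner_ζ_m =>
    rw [← herm]
    exact le_add_of_nonneg_left (by positivity)

end ConditionASTE

end

section

/-! ### The double-Post-Lasso estimator -/

section

variable {n p : ℕ} {x : Fin n → Fin p → ℝ} {y d : Fin n → ℝ} {I : Finset (Fin p)} {α : ℝ}
  {β : Fin p → ℝ}

theorem En_residual_sq (x : Fin n → Fin p → ℝ) (y d : Fin n → ℝ) (α : ℝ) (β : Fin p → ℝ) :
    (En fun i => (y i - d i * α - x i ⬝ᵥ β) ^ 2) = ‖emb y - α • emb d - design x β‖ ^ 2 := by
  rw [design_apply, ← map_smul, ← map_sub, ← map_sub, norm_emb_sq]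
  simp only [Pi.sub_apply, Pi.smul_apply, smul_eq_mul, mul_comm α]

namespace IsPostSelectionOLS

theorem inner_eq_zero (h : IsPostSelectionOLS x y d I α β) (a : ℝ) {b : Fin p → ℝ}
    (hb : b ∈ modelSpace I) :
    inner ℝ (a • emb d + design x b) (emb y - α • emb d - design x β) = 0 := by
  refine inner_eq_zero_of_norm_le fun t => ?_
  have h1 := h.2 (α + t * a) (β + t • b)
    ((modelSpace I).add_mem (mem_modelSpace.2 h.1) ((modelSpace I).smul_mem t hb))
  rw [En_residual_sq, En_residual_sq] at h1
  have h2 : emb y - (α + t * a) • emb d - design x (β + t • b) =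
      emb y - α • emb d - design x β - t • (a • emb d + design x b) := by
    rw [map_add, map_smul, add_smul, mul_smul, smul_add]; abel
  rw [h2] at h1
  exact le_of_sq_le_sq h1 (norm_nonneg _)

theorem inner_design_eq_zero (h : IsPostSelectionOLS x y d I α β) {b : Fin p → ℝ}
    (hb : b ∈ modelSpace I) :
    inner ℝ (design x b) (emb y - α • emb d - design x β) = 0 := by
  simpa using h.inner_eq_zero 0 hb

theorem inner_sub_eq_zero (h : IsPostSelectionOLS x y d I α β) {b : Fin p → ℝ}
    (hb : b ∈ modelSpace I) :
    inner ℝ (emb d - design x b) (emb y - α • emb d - design x β) = 0 := by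
  simpa [sub_eq_add_neg] using h.inner_eq_zero 1 ((modelSpace I).neg_mem hb)

end IsPostSelectionOLS

/-- By the Pythagorean theorem, the minimum is attained at the projection. -/
theorem vHatSq_eq {b : Fin p → ℝ} (hb : b ∈ modelSpace I)
    (hperp : ∀ b' ∈ modelSpace I, inner ℝ (design x b') (emb d - design x b) = 0) :
    vHatSq x d I = ‖emb d - design x b‖ ^ 2 := by
  refine IsLeast.csInf_eq ⟨⟨b, hb, Qhat_eq x d b⟩, ?_⟩
  rintro _ ⟨b', hb', rfl⟩
  have h1 : emb d - design x b' = (emb d - design x b) + design x (b - b') := by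
    rw [map_sub]; abel
  rw [Qhat_eq, h1, norm_add_sq_real, real_inner_comm,
    hperp _ ((modelSpace I).sub_mem hb hb')]
  nlinarith [sq_nonneg ‖design x (b - b')‖]

end

/-- The standard normal variable of the expansion: `√n E_n[v ζ]`, studentized by the empirical
second moment of `v`. -/
theorem IsGaussianPLM.hasLaw_ratio {Ω : Type*} [MeasurableSpace Ω] {μ : Measure Ω} {𝒵 : Type*}
    {n : ℕ} {z : Fin n → 𝒵} {m g : 𝒵 → ℝ} {α₀ : ℝ} {σζ σv : ℝ≥0} {ζ v y d : Fin n → Ω → ℝ}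
    (h : IsGaussianPLM μ z m g α₀ σζ σv ζ v y d) (hζ : 0 < σζ) (hv : 0 < σv) (hn : 1 ≤ n) :
    HasLaw (fun ω => √(n : ℝ) * inner ℝ (emb fun i => v i ω) (emb fun i => ζ i ω) /
      (σζ * ‖emb fun i => v i ω‖)) (gaussianReal 0 1) μ := by
  have hζ' : (0 : ℝ) < σζ := by exact_mod_cast hζ
  have hv' : (0 : ℝ) < σv := by exact_mod_cast hv
  have hn0 : (0 : ℝ) < n := by exact_mod_cast hn
  refine ((hasLaw_selfNormalized hn).comp (h.hasLaw_disturbances hζ hv)).congr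
    (ae_of_all _ fun ω => ?_)
  have h1 : ∑ i, v i ω / σv * (ζ i ω / σζ) = (∑ i, v i ω * ζ i ω) / (σv * σζ) := by
    rw [Finset.sum_div]
    exact Finset.sum_congr rfl fun i _ => by field_simp
  have h2 : ∑ i, (v i ω / σv) ^ 2 = (∑ i, v i ω ^ 2) / (σv : ℝ) ^ 2 := by
    rw [Finset.sum_div]
    exact Finset.sum_congr rfl fun i _ => by field_simp
  have hsn : 0 < √(n : ℝ) := Real.sqrt_pos.2 hn0
  have hsq : (n : ℝ) = √n * √n := (Real.mul_self_sqrt hn0.le).symm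
  simp only [Function.comp_apply]
  rw [h1, h2, inner_emb, norm_emb, En, En, Real.sqrt_div' _ hn0.le,
    Real.sqrt_div' _ (sq_nonneg (σv : ℝ)), Real.sqrt_sq hv'.le]
  generalize √(n : ℝ) = w at *
  rw [hsq]
  field_simp

theorem tendsto_div_of_sub {α : Type*} {l : Filter α} {u w σ : α → ℝ} {lo : ℝ} (hlo : 0 < lo)
    (hσ : ∀ a, lo ≤ σ a) (hw : Tendsto (fun a => w a / σ a) l (𝓝 1))
    (hu : Tendsto (fun a => u a - w a) l (𝓝 0)) :
    Tendsto (fun a => u a / σ a) l (𝓝 1) := by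
  have h := hw.add (tendsto_div_of_bdd_below hlo hσ hu)
  rw [add_zero] at h
  refine h.congr fun a => ?_
  rw [← add_div, add_sub_cancel]

/-- The estimation error of the treatment effect, scaled by the size of the partialled-out
treatment, vanishes. -/
theorem tendsto_error {α : Type*} {l : Filter α} {r T ν N D σζ σv e : α → ℝ} {lo hi : ℝ}
    (hlo : 0 < lo) (hζ : ∀ a, lo ≤ σζ a ∧ σζ a ≤ hi) (hv : ∀ a, lo ≤ σv a)
    (hr : Tendsto r l atTop) (hT : Tendsto (fun a => T a / σv a) l (𝓝 1))
    (hν : Tendsto (fun a => ν a / σv a) l (𝓝 1)) (he : Tendsto e l (𝓝 0))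
    (hD : ∀ᶠ a in l, ν a ^ 2 * (r a * D a) = N a * σζ a * T a + e a)
    (hN : ∀ Z : α → ℝ, Tendsto Z l (𝓝 0) → Tendsto (fun a => Z a * N a) l (𝓝 0)) :
    Tendsto (fun a => |D a| * ν a) l (𝓝 0) := by
  have hr0 : Tendsto (fun a => (r a)⁻¹) l (𝓝 0) := tendsto_inv_atTop_zero.comp hr
  have h1 : Tendsto (fun a => T a / σv a * ((r a)⁻¹ * N a)) l (𝓝 0) := by
    simpa using hT.mul (hN _ hr0)
  have h2 := tendsto_mul_of_bdd (c := σζ) (hi := hi)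
    (fun a => by rw [abs_of_pos (hlo.trans_le (hζ a).1)]; exact (hζ a).2) h1
  have h3 : Tendsto (fun a => (r a)⁻¹ * e a) l (𝓝 0) := by simpa using hr0.mul he
  have h4 := ((h2.add (tendsto_div_of_bdd_below hlo hv h3)).div hν one_ne_zero).abs
  rw [add_zero, zero_div, abs_zero] at h4
  simp only [Pi.div_apply] at h4
  refine h4.congr' ?_
  filter_upwards [hD, hν.eventually (lt_mem_nhds one_pos), hr.eventually_gt_atTop 0]
    with a h5 h6 h7
  have h8 : 0 < σv a := hlo.trans_le (hv a)
  have h9 : 0 < ν a := by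
    have := mul_pos h6 h8; rwa [div_mul_cancel₀ _ h8.ne'] at this
  have h10 : D a * ν a = (N a * σζ a * T a + e a) / (r a * ν a) := by
    rw [← h5]; field_simp
  have h11 : |D a| * ν a = |D a * ν a| := by rw [abs_mul, abs_of_pos h9]
  rw [h11, h10]
  congr 1
  field_simp

theorem tendsto_degrees_of_freedom {α : Type*} {l : Filter α} {n i : α → ℝ}
    (hn : Tendsto n l atTop) (hi : Tendsto (fun a => i a / n a) l (𝓝 0)) :
    Tendsto (fun a => n a / (n a - i a - 1)) l (𝓝 1) := by
  have h := ((hi.const_sub 1).sub (tendsto_inv_atTop_zero.comp hn)).inv₀ (by norm_num)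
  simp only [sub_zero, inv_one] at h
  refine h.congr' ?_
  filter_upwards [hn.eventually_gt_atTop 0] with a ha
  simp only [Function.comp_apply]
  have : 1 - i a / n a - (n a)⁻¹ = (n a - i a - 1) / n a := by field_simp
  rw [this, inv_div]

/-- The deterministic bounds for the least squares estimator after double selection, in terms of
the estimators themselves. -/
theorem SelectionBounds.abs_postSelection_le {n p : ℕ} {x : Fin n → Fin p → ℝ}
    {I : Finset (Fin p)} {α₀ : ℝ} {m g v ζ y d : Fin n → ℝ} {βm βg β₁ β₂ : Fin p → ℝ} {K : ℕ}
    {a A R t κ α : ℝ} {β : Fin p → ℝ}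
    (h : SelectionBounds (design x) I α₀ (emb m) (emb g) (emb v) (emb ζ) βm βg β₁ β₂ K a A R t κ)
    (hy : ∀ i, y i = d i * α₀ + g i + ζ i) (hd : ∀ i, d i = m i + v i)
    (hols : IsPostSelectionOLS x y d I α β) :
    |vHatSq x d I - En fun i => v i ^ 2| ≤ 2 * κ + 17 * R ^ 2 ∧
    |vHatSq x d I * (α - α₀) - En fun i => v i * ζ i| ≤ 2 * κ + (9 + 4 * A) * R ^ 2 ∧
    |√(En fun i => (y i - d i * α - x i ⬝ᵥ β) ^ 2) - √(En fun i => ζ i ^ 2)| ≤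
      (3 + 2 * A) * R + |α - α₀| * √(vHatSq x d I) := by
  obtain ⟨b, hb, hperp⟩ := exists_projection (design x) I (emb d)
  have hβ : β ∈ modelSpace I := mem_modelSpace.2 hols.1
  have hols₁ := hols.inner_sub_eq_zero hb
  have hols₂ := fun b' (hb' : b' ∈ modelSpace I) => hols.inner_design_eq_zero hb'
  rw [En_residual_sq, Real.sqrt_sq (norm_nonneg _), vHatSq_eq hb hperp,
    Real.sqrt_sq (norm_nonneg _), ← inner_emb, ← norm_emb_sq, ← norm_emb]
  have hd' : emb d = emb m + emb v := by rw [← map_add]; exact congrArg emb (funext hd)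
  have hy' : emb y - α • emb d - design x β =
      emb g + emb ζ - (α - α₀) • emb d - design x β := by
    have h1 : emb y = α₀ • emb d + emb g + emb ζ := by
      rw [← map_smul, ← map_add, ← map_add]
      exact congrArg emb (funext fun i => by simp [hy, mul_comm])
    rw [h1, sub_smul]; abel
  rw [hy'] at hols₁ ⊢
  simp only [hy'] at hols₂
  rw [hd'] at hols₁ hperp ⊢
  rw [hd'] at hols₂
  exact ⟨h.abs_residual_sq_sub_le hb hperp, h.abs_alpha_sub_le hb hperp hβ hols₁,
    h.abs_residual_sub_le hb hβ hperp hols₂⟩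

/-- Asymptotics of the post-selection estimators. Here `r` stands for `√n`, `ρ` for
`s log (p ∨ n) / n`, `V`, `S` and `B` for the second moments of the disturbances, `W` and `U` for
the residual mean squares of the treatment and of the outcome, and `D` for the estimation error. -/
theorem tendsto_postSelection {α : Type*} {l : Filter α}
    {n r ρ κ V W S U B D N σζ σv i : α → ℝ} {lo hi A C : ℝ} (hlo : 0 < lo)
    (hζ : ∀ a, lo ≤ σζ a ∧ σζ a ≤ hi) (hv : ∀ a, lo ≤ σv a)
    (hn : Tendsto n l atTop) (hr : Tendsto r l atTop)
    (hρ : Tendsto ρ l (𝓝 0)) (hrρ : Tendsto (fun a => r a * ρ a) l (𝓝 0))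
    (hκ : Tendsto (fun a => r a * κ a) l (𝓝 0)) (hi : Tendsto (fun a => i a / n a) l (𝓝 0))
    (hU : ∀ a, 0 ≤ U a)
    (hV : Tendsto (fun a => V a / σv a ^ 2) l (𝓝 1))
    (hS : Tendsto (fun a => S a / σζ a ^ 2) l (𝓝 1))
    (hbound : ∀ᶠ a in l, 0 ≤ ρ a ∧
      |W a - V a| ≤ 2 * κ a + 17 * (C * √(ρ a)) ^ 2 ∧
      |W a * D a - B a| ≤ 2 * κ a + (9 + 4 * A) * (C * √(ρ a)) ^ 2 ∧
      |√(U a) - √(S a)| ≤ (3 + 2 * A) * (C * √(ρ a)) + |D a| * √(W a))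
    (hN : ∀ a, N a = r a * B a / (σζ a * √(V a)))
    (hmul : ∀ Z : α → ℝ, Tendsto Z l (𝓝 0) → Tendsto (fun a => Z a * N a) l (𝓝 0)) :
    Tendsto (fun a => W a / σv a ^ 2) l (𝓝 1) ∧
    Tendsto (fun a => U a * (n a / (n a - i a - 1)) / σζ a ^ 2) l (𝓝 1) ∧
    ∀ S' V' : α → ℝ, Tendsto (fun a => S' a / σζ a ^ 2) l (𝓝 1) →
      Tendsto (fun a => V' a / σv a ^ 2) l (𝓝 1) →
      Tendsto (fun a => (S' a * (V' a)⁻¹) ^ (-(1 / 2) : ℝ) * (r a * D a) - N a) l (𝓝 0) := by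
  have hv0 : ∀ a, 0 < σv a := fun a => hlo.trans_le (hv a)
  have hζ0 : ∀ a, 0 < σζ a := fun a => hlo.trans_le (hζ a).1
  have hrE : ∀ c : ℝ, Tendsto (fun a => r a * (2 * κ a + c * (C * √(ρ a)) ^ 2)) l (𝓝 0) := by
    intro c
    have h1 := (hκ.const_mul 2).add (hrρ.const_mul (c * C ^ 2))
    rw [mul_zero, mul_zero, add_zero] at h1
    refine h1.congr' ?_
    filter_upwards [hbound] with a ha
    rw [mul_pow, Real.sq_sqrt ha.1]
    ring
  have hE : Tendsto (fun a => 2 * κ a + 17 * (C * √(ρ a)) ^ 2) l (𝓝 0) := by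
    have h1 := (tendsto_inv_atTop_zero.comp hr).mul (hrE 17)
    rw [mul_zero] at h1
    refine h1.congr' ?_
    filter_upwards [hr.eventually_gt_atTop 0] with a ha
    simp only [Function.comp_apply]
    rw [inv_mul_cancel_left₀ ha.ne']
  have hsqrt : ∀ {Y σ : α → ℝ}, (∀ a, 0 < σ a) → Tendsto (fun a => Y a / σ a ^ 2) l (𝓝 1) →
      Tendsto (fun a => √(Y a) / σ a) l (𝓝 1) := by
    intro Y σ hσ hY
    have h1 := hY.sqrt
    rw [Real.sqrt_one] at h1
    refine h1.congr fun a => ?_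
    rw [Real.sqrt_div' _ (sq_nonneg _), Real.sqrt_sq (hσ a).le]
  have hW : Tendsto (fun a => W a / σv a ^ 2) l (𝓝 1) :=
    tendsto_div_of_sub (lo := lo ^ 2) (by positivity) (fun a => pow_le_pow_left₀ hlo.le (hv a) 2)
      hV (squeeze_zero_norm' (hbound.mono fun a ha => ha.2.1) hE)
  have he : Tendsto (fun a => r a * (W a * D a - B a)) l (𝓝 0) := by
    refine squeeze_zero_norm' ?_ (hrE (9 + 4 * A))
    filter_upwards [hbound, hr.eventually_ge_atTop 0] with a ha h0
    rw [Real.norm_eq_abs, abs_mul, abs_of_nonneg h0]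
    exact mul_le_mul_of_nonneg_left ha.2.2.1 h0
  have hexp : ∀ᶠ a in l,
      W a * (r a * D a) = N a * σζ a * √(V a) + r a * (W a * D a - B a) := by
    filter_upwards [hV.eventually (lt_mem_nhds one_pos)] with a ha
    have h1 : 0 < √(V a) := by
      rw [Real.sqrt_pos]
      exact (div_pos_iff_of_pos_right (pow_pos (hv0 a) 2)).1 ha
    have h2 := hζ0 a
    rw [hN]
    field_simp
    ring
  have herr : Tendsto (fun a => |D a| * √(W a)) l (𝓝 0) := by
    refine tendsto_error (ν := fun a => √(W a)) hlo hζ hv hr (hsqrt hv0 hV) (hsqrt hv0 hW) he ?_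
      hmul
    filter_upwards [hexp, hW.eventually (lt_mem_nhds one_pos)] with a h1 h2
    rw [Real.sq_sqrt ((div_pos_iff_of_pos_right (pow_pos (hv0 a) 2)).1 h2).le, h1]
  have hUlim : Tendsto (fun a => U a / σζ a ^ 2) l (𝓝 1) := by
    have h1 : Tendsto (fun a => (3 + 2 * A) * (C * √(ρ a)) + |D a| * √(W a)) l (𝓝 0) := by
      simpa using ((hρ.sqrt.const_mul C).const_mul (3 + 2 * A)).add herr
    have h2 := (tendsto_div_of_sub (u := fun a => √(U a)) hlo (fun a => (hζ a).1)
      (hsqrt hζ0 hS) (squeeze_zero_norm' (hbound.mono fun a ha => ha.2.2.2) h1)).pow 2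
    rw [one_pow] at h2
    exact h2.congr fun a => by rw [div_pow, Real.sq_sqrt (hU a)]
  refine ⟨hW, ?_, fun S' V' hS' hV' => tendsto_studentized hlo (fun a => (hζ a).1) hv hS' hV' hW
    (hsqrt hv0 hV) he hexp hmul⟩
  have h1 := hUlim.mul (tendsto_degrees_of_freedom hn hi)
  rw [one_mul] at h1
  exact h1.congr fun a => (mul_div_right_comm _ _ _).symm

end

end DoublePostLasso

theorem theorem5
    -- for each sample size, a probability space
    {Ω : ℕ → Type*} [∀ n, MeasurableSpace (Ω n)]
    (μ : ∀ n, Measure (Ω n)) [∀ n, IsProbabilityMeasure (μ n)]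
    -- number of controls, sparsity index, confounders, dictionary and regression functions
    {𝒵 : ℕ → Type*} (p s : ℕ → ℕ) (hp : Tendsto p atTop atTop)
    (z : ∀ n, Fin n → 𝒵 n) (P : ∀ n, 𝒵 n → Fin (p n) → ℝ) (m g : ∀ n, 𝒵 n → ℝ)
    -- parameters, disturbances and data
    (α₀ : ℕ → ℝ) (σζ σv : ℕ → ℝ≥0) (ζ v y d : ∀ n, Fin n → Ω n → ℝ)
    -- feasible Lasso estimators in the regressions of `d` on `x` and of `y` on `x`
    (βhat₁ βhat₂ : ∀ n, Ω n → Fin (p n) → ℝ)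
    (hβ₁ : IsFeasibleLasso μ (fun n i => P n (z n i)) d (fun n => (σv n : ℝ)) βhat₁)
    (hβ₂ : IsFeasibleLasso μ (fun n i => P n (z n i)) y
      (fun n => √(α₀ n ^ 2 * (σv n : ℝ) ^ 2 + (σζ n : ℝ) ^ 2)) βhat₂)
    -- additional controls, and all selected controls
    (I₃ I : ∀ n, Ω n → Finset (Fin (p n)))
    (hI : ∀ n ω, I n ω = supp (βhat₁ n ω) ∪ supp (βhat₂ n ω) ∪ I₃ n ω)
    (hASTE : ConditionASTE μ s z P m g α₀ σζ σv ζ v y d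
      (fun n ω => supp (βhat₁ n ω)) (fun n ω => supp (βhat₂ n ω)) I₃)
    -- the double-Post-Lasso estimator
    (αcheck : ∀ n, Ω n → ℝ) (βcheck : ∀ n, Ω n → Fin (p n) → ℝ)
    (hcheck : ∀ n, ∀ᵐ ω ∂μ n, IsPostSelectionOLS (fun i => P n (z n i))
      (fun i => y n i ω) (fun i => d n i ω) (I n ω) (αcheck n ω) (βcheck n ω)) :
    ∃ N : ∀ n, Ω n → ℝ, (∀ n, 1 ≤ n → HasLaw (N n) (gaussianReal 0 1) (μ n)) ∧
      IsLittleOP μ (fun n ω => studentized n ((σζ n : ℝ) ^ 2) (En fun i => v n i ω ^ 2)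
        (αcheck n ω) (α₀ n) - N n ω) ∧
      IsLittleOP μ (fun n ω => studentized n
        (sigmaHatSq (fun i => P n (z n i)) (fun i => y n i ω) (fun i => d n i ω) (I n ω)
          (αcheck n ω) (βcheck n ω))
        (vHatSq (fun i => P n (z n i)) (fun i => d n i ω) (I n ω))
        (αcheck n ω) (α₀ n) - N n ω) ∧
      -- each of the two replacements alone
      IsLittleOP μ (fun n ω => studentized n
        (sigmaHatSq (fun i => P n (z n i)) (fun i => y n i ω) (fun i => d n i ω) (I n ω)
          (αcheck n ω) (βcheck n ω))
        (En fun i => v n i ω ^ 2) (αcheck n ω) (α₀ n) - N n ω) ∧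
      IsLittleOP μ (fun n ω => studentized n ((σζ n : ℝ) ^ 2)
        (vHatSq (fun i => P n (z n i)) (fun i => d n i ω) (I n ω))
        (αcheck n ω) (α₀ n) - N n ω) := by
  obtain ⟨lo, hi, hlo, hhi, hσ⟩ := hASTE.exists_sigma_bounds
  have hv0 : ∀ n, (0 : ℝ) < σv n := fun n => hlo.trans_le (hσ n).1.1
  have hζ0 : ∀ n, (0 : ℝ) < σζ n := fun n => hlo.trans_le (hσ n).2.1
  obtain ⟨a, A, C, k, t, κ, βm, βg, hκ, hcard, hsel⟩ :=
    hASTE.whp_selectionBounds hp hβ₁ hβ₂ hI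
  have hL := Eventually.whp (μ := μ) ((tendsto_logDim (p := p)).eventually_ge_atTop 1)
  have hn_top : Tendsto (fun q : Σ n, Ω n => (q.1 : ℝ)) (whp μ) atTop :=
    Tendsto.whp (μ := μ) tendsto_natCast_atTop_atTop
  have hlaw : ∀ n : ℕ, 1 ≤ n → HasLaw (fun ω => √(n : ℝ) * (En fun i => v n i ω * ζ n i ω) /
      (σζ n * √(En fun i => v n i ω ^ 2))) (gaussianReal 0 1) (μ n) := fun n hn => by
    simpa only [inner_emb, norm_emb] using (hASTE.model n).hasLaw_ratio (hζ0 n) (hv0 n) hn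
  have hV : Tendsto (fun q : Σ n, Ω n => (En fun i => v q.1 i q.2 ^ 2) / (σv q.1 : ℝ) ^ 2)
      (whp μ) (𝓝 1) := by
    refine (tendsto_En_sq_whp fun n => (hASTE.model n).hasLaw_v (hζ0 n) (hv0 n)).congr fun q => ?_
    simp only [En, div_pow, ← Finset.sum_div]
    exact div_right_comm _ _ _
  have hS : Tendsto (fun q : Σ n, Ω n => (En fun i => ζ q.1 i q.2 ^ 2) / (σζ q.1 : ℝ) ^ 2)
      (whp μ) (𝓝 1) := by
    refine (tendsto_En_sq_whp fun n => (hASTE.model n).hasLaw_ζ (hζ0 n) (hv0 n)).congr fun q => ?_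
    simp only [En, div_pow, ← Finset.sum_div]
    exact div_right_comm _ _ _
  have hρ := Tendsto.whp (μ := μ) hASTE.tendsto_rate
  have hrρ := Tendsto.whp (μ := μ) hASTE.tendsto_sqrt_mul_rate
  have hI₀ : Tendsto (fun q : Σ n, Ω n => ((I q.1 q.2).card : ℝ) / q.1) (whp μ) (𝓝 0) := by
    have h1 := hρ.const_mul (k : ℝ)
    rw [mul_zero] at h1
    refine squeeze_zero' (Eventually.of_forall fun q => by positivity) ?_ h1
    filter_upwards [hcard, hL] with q h2 h3
    have h4 : ((I q.1 q.2).card : ℝ) ≤ k * s q.1 := by exact_mod_cast h2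
    rw [mul_div_assoc']
    gcongr
    refine h4.trans ?_
    gcongr
    exact le_mul_of_one_le_right (Nat.cast_nonneg _) h3
  -- all that is random enters through scalar functions on `Σ n, Ω n`
  obtain ⟨hW, hU, hlim⟩ := tendsto_postSelection
    (l := whp μ) (r := fun q => √(q.1 : ℝ)) (κ := κ) (A := A) (C := C) (B := fun q => En fun i => v q.1 i q.2 * ζ q.1 i q.2)
    (D := fun q => αcheck q.1 q.2 - α₀ q.1)
    (W := fun q => vHatSq (fun i => P q.1 (z q.1 i)) (fun i => d q.1 i q.2) (I q.1 q.2))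
    (U := fun q => En fun i =>
      (y q.1 i q.2 - d q.1 i q.2 * αcheck q.1 q.2 - P q.1 (z q.1 i) ⬝ᵥ βcheck q.1 q.2) ^ 2)
    hlo (fun q => (hσ q.1).2) (fun q => (hσ q.1).1.1) hn_top
    (Real.tendsto_sqrt_atTop.comp hn_top) hρ hrρ
    hκ hI₀ (fun q => by unfold En; positivity) hV hS
    (by
      filter_upwards [hsel, whp_of_ae hcheck, hL] with q h1 h2 h3
      refine ⟨?_, h1.abs_postSelection_le (fun i => (hASTE.model q.1).outcome i q.2)
        (fun i => (hASTE.model q.1).treatment i q.2) h2⟩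
      have h4 : 0 ≤ logDim (p q.1) q.1 := zero_le_one.trans h3
      positivity)
    (fun q => rfl)
    (fun Z hZ => by
      have h1 := tendsto_mul_of_hasLaw (Z := fun n ω => Z ⟨n, ω⟩) hlaw hZ
      exact h1)
  have hσζ : Tendsto (fun q : Σ n, Ω n => (σζ q.1 : ℝ) ^ 2 / (σζ q.1 : ℝ) ^ 2) (whp μ) (𝓝 1) :=
    tendsto_const_nhds.congr fun q => (div_self (pow_pos (hζ0 q.1) 2).ne').symm
  exact ⟨_, hlaw, isLittleOP_iff.2 (hlim _ _ hσζ hV), isLittleOP_iff.2 (hlim _ _ hU hW),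
    isLittleOP_iff.2 (hlim _ _ hU hV), isLittleOP_iff.2 (hlim _ _ hσζ hW)⟩
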